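/- Let $k$ be a field and let $(S,\mathfrak m)$ be a noetherian local $k$-algebra that is $\mathfrak m$-adically complete (and separated) and whose residue field is $k$, i.e. $k\to S/\mathfrak m$ is bijective. Let $D(S)$ be the unbounded derived category of $S$-modules. Let $\omega\in D(S)$ be a normalized dualizing complex: $\omega$ has finite injective dimension (it is represented by a bounded complex of injective $S$-modules), all its cohomology modules are finitely generated, the natural map $S\to\mathrm{RHom}_S(\omega,\omega)$ is an isomorphism, and $\mathrm{RHom}_S(k,\omega)\simeq k$, placed in degree $0$. Write $$\mathbf D(-)=\mathrm{RHom}_S(-,\omega),\qquad (-)^\vee=\mathrm{RHom}_k(-,k),$$ regarded as functors $D(S)^{op}\to D(S)$, and let $R\Gamma_{\mathfrak m}:D(S)\to D(S)$ be the local cohomology functor $R\Gamma_{\mathfrak m}(N)=\operatorname{colim}_n \mathrm{RHom}_S(S/\mathfrak m^n,N)$. Sequential colimits are derived (homotopy) colimits, computed by filtered colimits of complexes. Then: 1. There is an isomorphism $\mathbf D M\simeq R\Gamma_{\mathfrak m}(M)^\vee$ in $D(S)$, natural in $M\in D(S)$. 2. There is an isomorphism $\mathrm{RHom}_S\bigl(A,\mathrm{RHom}_k(N,k)\bigr)\simeq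 (N\otimes_S^L A)^\vee$ in $D(S)$, natural in $N\in D(S)$ and in the $S$-module $A$ of finite length. 3. There is an isomorphism $R\Gamma_{\mathfrak m}(\mathbf D M)\simeq \operatorname{colim}_n\,(M\otimes_S^L S/\mathfrak m^n)^\vee$ in $D(S)$, natural in $M\in D(S)$, the transition maps on the right being induced by the projections $S/\mathfrak m^{n+1}\to S/\mathfrak m^n$. -/

import Mathlib

universe w u

namespace GrothendieckDuality
open CategoryTheory Limits HomologicalComplex Opposite

/-- Unbounded cochain complexes of `S`-modules. -/
abbrev Cplx (S : Type u) [CommRing S] : Type (u + 1) := CochainComplex (ModuleCat.{u} S) ℤ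

section Resolution

variable (S : Type u) [CommRing S]

/-- The complex `S` placed in degree `n`. -/
noncomputable abbrev sphere (n : ℤ) : Cplx S :=
  (single (ModuleCat.{u} S) (ComplexShape.up ℤ) n).obj (ModuleCat.of S S)

theorem rel_succ (n : ℤ) : (ComplexShape.up ℤ).Rel n (n + 1) := rfl

/-- The contractible complex `S = S` placed in degrees `n` and `n + 1`. -/
noncomputable abbrev disk (n : ℤ) : Cplx S :=
  double (𝟙 (ModuleCat.of S S)) (rel_succ n)

/-- The inclusion of the sphere as the top degree part of the disk. -/
noncomputable def sphereToDisk (n : ℤ) : sphere S (n + 1) ⟶ disk S n :=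
  mkHomFromSingle (doubleXIso₁ (𝟙 (ModuleCat.of S S)) (rel_succ n) (by simp)).inv (fun k hk => by
    rw [double_d_eq_zero₀ _ _ _ _ (by lia), comp_zero])

/-- The generating cofibrations. -/
def genCof : MorphismProperty (Cplx S) := MorphismProperty.ofHoms (sphereToDisk S)

variable {S}

theorem d_sq {K : Cplx S} {i j l : ℤ} (x : K.X i) : K.d j l (K.d i j x) = 0 := by
  rw [← ConcreteCategory.comp_apply, K.d_comp_d]; rfl

theorem hom_d {K L : Cplx S} (f : K ⟶ L) {i j : ℤ} (x : K.X i) :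
    L.d i j (f.f i x) = f.f j (K.d i j x) := by
  rw [← ConcreteCategory.comp_apply, ← ConcreteCategory.comp_apply, f.comm]

/-- The morphism from a sphere determined by a cocycle. -/
noncomputable def ofCocycle {K : Cplx S} {n : ℤ} (x : K.X n) (hx : K.d n (n + 1) x = 0) :
    sphere S n ⟶ K :=
  mkHomFromSingle (ModuleCat.ofHom (LinearMap.toSpanSingleton S _ x)) (fun k hk => by
    obtain rfl : n + 1 = k := hk
    ext
    simpa using hx)

/-- The cocycle determined by a morphism from a sphere. -/
noncomputable def toCocycle {K : Cplx S} {n : ℤ} (f : sphere S n ⟶ K) : K.X n :=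
  f.f n ((singleObjXSelf (ComplexShape.up ℤ) n (ModuleCat.of S S)).inv (1 : S))

theorem toCocycle_ofCocycle {K : Cplx S} {n : ℤ} (x : K.X n) (hx : K.d n (n + 1) x = 0) :
    toCocycle (ofCocycle x hx) = x := by
  simp [toCocycle, ofCocycle]

theorem d_toCocycle {K : Cplx S} {n : ℤ} (f : sphere S n ⟶ K) (m : ℤ) :
    K.d n m (toCocycle f) = 0 := by
  rw [toCocycle, hom_d]
  simp

theorem toCocycle_comp {K L : Cplx S} {n : ℤ} (f : sphere S n ⟶ K) (g : K ⟶ L) :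
    toCocycle (f ≫ g) = g.f n (toCocycle f) := by
  simp [toCocycle]

theorem toCocycle_injective {K : Cplx S} {n : ℤ} {f g : sphere S n ⟶ K}
    (h : toCocycle f = toCocycle g) : f = g := by
  apply from_single_hom_ext
  rw [← cancel_epi (singleObjXSelf (ComplexShape.up ℤ) n (ModuleCat.of S S)).inv]
  ext
  simpa [toCocycle] using h

/-- The morphism from a disk determined by an element. -/
noncomputable def ofElement {K : Cplx S} {n : ℤ} (x : K.X n) : disk S n ⟶ K :=
  mkHomFromDouble (rel_succ n) (by simp) (ModuleCat.ofHom (LinearMap.toSpanSingleton S _ x))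
    (ModuleCat.ofHom (LinearMap.toSpanSingleton S _ (K.d n (n + 1) x)))
    (by ext; simp) (by intro k hk; ext; simp [d_sq])

/-- The element determined by a morphism from a disk. -/
noncomputable def toElement {K : Cplx S} {n : ℤ} (f : disk S n ⟶ K) : K.X n :=
  f.f n ((doubleXIso₀ (𝟙 (ModuleCat.of S S)) (rel_succ n)).inv (1 : S))

theorem toElement_ofElement {K : Cplx S} {n : ℤ} (x : K.X n) :
    toElement (ofElement x) = x := by
  simp [toElement, ofElement]

theorem toElement_comp {K L : Cplx S} {n : ℤ} (f : disk S n ⟶ K) (g : K ⟶ L) :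
    toElement (f ≫ g) = g.f n (toElement f) := by
  simp [toElement]

theorem d_toElement {K : Cplx S} {n : ℤ} (f : disk S n ⟶ K) :
    K.d n (n + 1) (toElement f) = toCocycle (sphereToDisk S n ≫ f) := by
  rw [toElement, hom_d]
  rw [double_d _ (rel_succ n) (by simp)]
  simp [toCocycle, sphereToDisk]

theorem toElement_injective {K : Cplx S} {n : ℤ} {f g : disk S n ⟶ K}
    (h : toElement f = toElement g) : f = g := by
  have h1 : sphereToDisk S n ≫ f = sphereToDisk S n ≫ g :=
    toCocycle_injective (by rw [← d_toElement, ← d_toElement, h])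
  apply from_double_hom_ext
  · rw [← cancel_epi (doubleXIso₀ (𝟙 (ModuleCat.of S S)) (rel_succ n)).inv]
    ext
    simpa [toElement] using h
  · have := congr_arg (fun φ => HomologicalComplex.Hom.f φ (n + 1)) h1
    simpa [sphereToDisk] using this

theorem mem_rlp_iff {X Y : Cplx S} (p : X ⟶ Y) :
    (genCof S).rlp p ↔ ∀ (n : ℤ) (x : X.X (n + 1)) (y : Y.X n),
      X.d (n + 1) (n + 1 + 1) x = 0 → p.f (n + 1) x = Y.d n (n + 1) y →
      ∃ z : X.X n, X.d n (n + 1) z = x ∧ p.f n z = y := by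
  constructor
  · intro hp n x y hx hxy
    have := hp (sphereToDisk S n) ⟨n⟩
    have sq : CommSq (ofCocycle x hx) (sphereToDisk S n) p (ofElement y) := ⟨by
      apply toCocycle_injective
      rw [toCocycle_comp, ← d_toElement, toCocycle_ofCocycle, toElement_ofElement, hxy]⟩
    refine ⟨toElement sq.lift, ?_, ?_⟩
    · rw [d_toElement, sq.fac_left, toCocycle_ofCocycle]
    · rw [← toElement_comp, sq.fac_right, toElement_ofElement]
  · rintro h _ _ _ ⟨n⟩
    refine ⟨fun {f g} sq => ?_⟩
    obtain ⟨z, hz, hz'⟩ := h n (toCocycle f) (toElement g) (d_toCocycle f _)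
      (by rw [d_toElement, ← sq.w, toCocycle_comp])
    exact ⟨⟨{ l := ofElement z
              fac_left := toCocycle_injective
                (by rw [← d_toElement, toElement_ofElement, hz])
              fac_right := toElement_injective
                (by rw [toElement_comp, toElement_ofElement, hz']) }⟩⟩

theorem exists_rep {J : Type*} [Category* J] [IsFiltered J]
    [PreservesColimitsOfShape J (forget (ModuleCat.{u} S))] [HasColimitsOfShape J (ModuleCat.{u} S)]
    {F : J ⥤ Cplx S} {c : Cocone F}
    (hc : IsColimit c) (n : ℤ) (x : c.pt.X n) : ∃ j, ∃ y : (F.obj j).X n, (c.ι.app j).f n y = x :=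
  Concrete.isColimit_exists_rep (F ⋙ eval _ _ n) (isColimitOfPreserves (eval _ _ n) hc) x

theorem exists_eq {J : Type*} [Category* J] [IsFiltered J]
    [PreservesColimitsOfShape J (forget (ModuleCat.{u} S))] [HasColimitsOfShape J (ModuleCat.{u} S)]
    {F : J ⥤ Cplx S} {c : Cocone F}
    (hc : IsColimit c) (n : ℤ) {i j : J} (x : (F.obj i).X n) (y : (F.obj j).X n)
    (h : (c.ι.app i).f n x = (c.ι.app j).f n y) :
    ∃ (k : J) (f : i ⟶ k) (g : j ⟶ k), (F.map f).f n x = (F.map g).f n y :=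
  (Concrete.isColimit_rep_eq_iff_exists (F ⋙ eval _ _ n)
    (isColimitOfPreserves (eval _ _ n) hc) x y).1 h

theorem naturality_f {J : Type*} [Category* J] {F : J ⥤ Cplx S} (c : Cocone F)
    {i j : J} (f : i ⟶ j) (n : ℤ) (x : (F.obj i).X n) :
    (c.ι.app j).f n ((F.map f).f n x) = (c.ι.app i).f n x := by
  rw [← ConcreteCategory.comp_apply, ← comp_f, c.w]

instance (n : ℤ) : IsFinitelyPresentable.{u} (sphere S n) := by
  rw [isFinitelyPresentable_iff_preservesFilteredColimitsOfSize]
  refine ⟨fun J _ _ => ⟨fun {F} => ⟨fun {c} hc => ⟨Types.FilteredColimit.isColimitOf _ _ ?_ ?_⟩⟩⟩⟩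
  · intro (f : sphere S n ⟶ c.pt)
    obtain ⟨j, y, hy⟩ := exists_rep hc n (toCocycle f)
    obtain ⟨k, a, b, hab⟩ := exists_eq hc (n + 1) ((F.obj j).d n (n + 1) y) (0 : (F.obj j).X (n + 1))
      (by rw [← hom_d, hy, d_toCocycle, map_zero])
    rw [map_zero, ← hom_d] at hab
    refine ⟨k, ofCocycle _ hab, ?_⟩
    apply toCocycle_injective
    change _ = toCocycle (ofCocycle _ hab ≫ c.ι.app k)
    rw [toCocycle_comp, toCocycle_ofCocycle, naturality_f, hy]
  · intro i j (f : sphere S n ⟶ F.obj i) (g : sphere S n ⟶ F.obj j) h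
    change f ≫ c.ι.app i = g ≫ c.ι.app j at h
    obtain ⟨k, a, b, hab⟩ := exists_eq hc n (toCocycle f) (toCocycle g)
      (by rw [← toCocycle_comp, ← toCocycle_comp, h])
    refine ⟨k, a, b, ?_⟩
    change f ≫ F.map a = g ≫ F.map b
    exact toCocycle_injective (by rw [toCocycle_comp, toCocycle_comp, hab])

attribute [local instance] Cardinal.fact_isRegular_aleph0 Cardinal.orderBotAleph0OrdToType

instance : MorphismProperty.IsSmall.{u} (genCof S) := MorphismProperty.isSmall_ofHoms ..

instance : (genCof S).IsCardinalForSmallObjectArgument Cardinal.aleph0.{u} where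
  preservesColimit {A B X Y} i hi f hf := by
    have : IsFinitelyPresentable.{u} A := by
      obtain ⟨n⟩ := hi
      infer_instance
    infer_instance

instance : MorphismProperty.HasSmallObjectArgument.{u} (genCof S) :=
  ⟨.aleph0, inferInstance, inferInstance, inferInstance⟩

end Resolution

section Resolution2
open scoped ZeroObject
variable {S : Type u} [CommRing S]

open CochainComplex CochainComplex.HomComplex

theorem exactAt_iff_elements (K : Cplx S) (n : ℤ) :
    K.ExactAt n ↔ ∀ x : K.X n, K.d n (n + 1) x = 0 → ∃ y : K.X (n - 1), K.d (n - 1) n y = x := by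
  rw [K.exactAt_iff' (n - 1) n (n + 1) (by simp) (by simp), ShortComplex.moduleCat_exact_iff]
  rfl

/-- A linear map out of a free module covering `A`, from a choice of values. -/
noncomputable def freeLift {A X : ModuleCat.{u} S} (φ : A → X) :
    ModuleCat.of S (A →₀ S) ⟶ X :=
  ModuleCat.ofHom (Finsupp.linearCombination S φ)

theorem freeLift_single {A X : ModuleCat.{u} S} (φ : A → X) (a : A) :
    freeLift φ (Finsupp.single a (1 : S)) = φ a := by
  simp [freeLift]

theorem free_hom_ext {A X : ModuleCat.{u} S} {f g : ModuleCat.of S (A →₀ S) ⟶ X}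
    (h : ∀ a, f (Finsupp.single a (1 : S)) = g (Finsupp.single a (1 : S))) : f = g := by
  ext a
  simpa using h a

instance (A : ModuleCat.{u} S) : Epi (freeLift (id : A → A)) := by
  rw [ModuleCat.epi_iff_surjective]
  exact fun a => ⟨_, freeLift_single _ a⟩

/-- A quasi-isomorphism criterion in terms of elements. -/
theorem quasiIso_iff_elements {K L : Cplx S} (f : K ⟶ L) : QuasiIso f ↔
    (∀ (n : ℤ) (y : L.X n), L.d n (n + 1) y = 0 → ∃ (x : K.X n) (w : L.X (n - 1)),
      K.d n (n + 1) x = 0 ∧ y = f.f n x + L.d (n - 1) n w) ∧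
    (∀ (n : ℤ) (x : K.X n) (w : L.X (n - 1)), K.d n (n + 1) x = 0 →
      f.f n x = L.d (n - 1) n w → ∃ v : K.X (n - 1), K.d (n - 1) n v = x) := by
  have hprev (n : ℤ) : (ComplexShape.up ℤ).prev n = n - 1 := by simp
  have hnext (n : ℤ) : (ComplexShape.up ℤ).next n = n + 1 := by simp
  simp only [quasiIso_iff, quasiIsoAt_iff_isIso_homologyMap, isIso_iff_mono_and_epi,
    mono_homologyMap_iff_up_to_refinements f _ _ _ (hprev _) (hnext _),
    epi_homologyMap_iff_up_to_refinements f _ _ _ (hprev _) (hnext _)]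
  constructor
  · intro h
    constructor
    · intro n y hy
      obtain ⟨A', π, hπ, x₂, hx₂, y₁, hy₁⟩ := (h n).2
        (A := ModuleCat.of S S) (ModuleCat.ofHom (LinearMap.toSpanSingleton S _ y))
        (by ext; simpa using hy)
      obtain ⟨a, ha⟩ := (ModuleCat.epi_iff_surjective π).1 hπ (1 : S)
      refine ⟨x₂ a, y₁ a, by rw [← ConcreteCategory.comp_apply, hx₂]; rfl, ?_⟩
      have := ConcreteCategory.congr_hom hy₁ a
      simpa [ha] using this
    · intro n x w hx hw
      obtain ⟨A', π, hπ, x₁, hx₁⟩ := (h n).1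
        (A := ModuleCat.of S S) (ModuleCat.ofHom (LinearMap.toSpanSingleton S _ x))
        (by ext; simpa using hx) (ModuleCat.ofHom (LinearMap.toSpanSingleton S _ w))
        (by ext; simpa using hw)
      obtain ⟨a, ha⟩ := (ModuleCat.epi_iff_surjective π).1 hπ (1 : S)
      refine ⟨x₁ a, ?_⟩
      have := ConcreteCategory.congr_hom hx₁ a
      simpa [ha] using this.symm
  · rintro ⟨h₁, h₂⟩ n
    constructor
    · intro A x₂ hx₂ y₁ hy₁
      have key (a : A) := h₂ n (x₂ a) (y₁ a) (by rw [← ConcreteCategory.comp_apply, hx₂]; rfl)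
        (by rw [← ConcreteCategory.comp_apply, hy₁]; rfl)
      choose v hv using key
      refine ⟨_, freeLift id, inferInstance, freeLift v, free_hom_ext fun a => ?_⟩
      rw [ConcreteCategory.comp_apply, ConcreteCategory.comp_apply, freeLift_single,
        freeLift_single, hv]
      rfl
    · intro A y₂ hy₂
      have key (a : A) := h₁ n (y₂ a) (by rw [← ConcreteCategory.comp_apply, hy₂]; rfl)
      choose x w hx hw using key
      refine ⟨_, freeLift id, inferInstance, freeLift x, free_hom_ext fun a => ?_, freeLift w,
        free_hom_ext fun a => ?_⟩
      · rw [ConcreteCategory.comp_apply, freeLift_single, hx]; rfl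
      · change y₂ (freeLift id (Finsupp.single a (1 : S))) =
          f.f n (freeLift x (Finsupp.single a (1 : S))) +
          L.d (n - 1) n (freeLift w (Finsupp.single a (1 : S)))
        rw [freeLift_single, freeLift_single, freeLift_single]
        exact hw a

/-- Surjective quasi-isomorphisms are acyclic fibrations. -/
theorem rlp_of_surjective {X Y : Cplx S} (p : X ⟶ Y) (hp : ∀ n, Function.Surjective (p.f n))
    [hq : QuasiIso p] : (genCof S).rlp p := by
  obtain ⟨h₁, h₂⟩ := (quasiIso_iff_elements p).1 hq
  rw [mem_rlp_iff]
  intro n x y hx hxy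
  have h₂' : ∀ (x : X.X (n + 1)) (w : Y.X n), X.d (n + 1) (n + 1 + 1) x = 0 →
      p.f (n + 1) x = Y.d n (n + 1) w → ∃ v : X.X n, X.d n (n + 1) v = x := by
    have : ∀ m : ℤ, m = n → ∀ (x : X.X (n + 1)) (w : Y.X m), X.d (n + 1) (n + 1 + 1) x = 0 →
      p.f (n + 1) x = Y.d m (n + 1) w → ∃ v : X.X m, X.d m (n + 1) v = x := by
      intro m hm
      obtain rfl : m = n + 1 - 1 := by lia
      exact h₂ (n + 1)
    exact this n rfl
  obtain ⟨z₀, hz₀⟩ := hp n y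
  obtain ⟨v, hv⟩ := h₂' (x - X.d n (n + 1) z₀) 0 (by rw [map_sub, hx, d_sq, sub_zero])
    (by rw [map_sub, hxy, ← hom_d, hz₀, map_zero, sub_self])
  obtain ⟨u, w, hu, huw⟩ := h₁ n (p.f n v) (by
    rw [hom_d, hv, map_sub, hxy, ← hom_d, hz₀, sub_self])
  obtain ⟨w', hw'⟩ := hp (n - 1) w
  refine ⟨z₀ + v - u - X.d (n - 1) n w', ?_, ?_⟩
  · rw [map_sub, map_sub, map_add, hv, hu, d_sq]
    abel
  · rw [map_sub, map_sub, map_add, hz₀, ← hom_d, hw', huw]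
    abel

theorem isKProjective_of_llp {P : Cplx S} {Z : Cplx S} (hZ : IsZero Z) (i : Z ⟶ P)
    (hP : (genCof S).rlp.llp i) : P.IsKProjective := by
  refine ⟨fun {L} f hL => ?_⟩
  have h₀ : IsZero ((HomotopyCategory.quotient _ _).obj (mappingCone (𝟙 L))) := by
    have := (HomotopyCategory.mappingCone_triangleh_distinguished (𝟙 L))
    exact Pretriangulated.Triangle.isZero₃_of_isIso₁ _ this
      (inferInstanceAs (IsIso ((HomotopyCategory.quotient _ _).map (𝟙 L))))
  have h₁ : IsZero ((HomotopyCategory.quotient _ _).obj (mappingCocone (𝟙 L))) :=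
    ((CategoryTheory.shiftFunctor _ (-1 : ℤ)).map_isZero h₀).of_iso
      (((HomotopyCategory.quotient _ _).commShiftIso (-1 : ℤ)).app _)
  have h₂ : Homotopy (𝟙 (mappingCocone (𝟙 L))) 0 :=
    HomotopyCategory.homotopyOfEq _ _ (h₁.eq_of_src _ _)
  have hE : (mappingCocone (𝟙 L)).Acyclic := by
    intro n
    rw [exactAt_iff_isZero_homology, IsZero.iff_id_eq_zero, ← homologyMap_id,
      h₂.homologyMap_eq, homologyMap_zero]
  have : QuasiIso (mappingCocone.fst (𝟙 L)) := by
    rw [quasiIso_iff]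
    intro n
    rw [quasiIsoAt_iff_exactAt _ _ (hE n)]
    exact hL n
  have hr : (genCof S).rlp (mappingCocone.fst (𝟙 L)) := by
    refine rlp_of_surjective _ fun n y => ⟨(mappingCocone.inl (𝟙 L)).v n n (add_zero n) y, ?_⟩
    rw [← ConcreteCategory.comp_apply, mappingCocone.inl_v_fst_f]
    rfl
  have sq : CommSq (0 : Z ⟶ _) i (mappingCocone.fst (𝟙 L)) f := ⟨hZ.eq_of_src _ _⟩
  have := hP _ hr
  refine ⟨(Homotopy.ofEq (by rw [Category.id_comp, sq.fac_right])).trans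
    (((h₂.compRight (mappingCocone.fst (𝟙 L))).compLeft sq.lift).trans
      (Homotopy.ofEq (by simp)))⟩

variable (S) in
/-- A functorial factorization into a cofibration followed by an acyclic fibration. -/
noncomputable def factorization :
    MorphismProperty.FunctorialFactorizationData (genCof S).rlp.llp (genCof S).rlp :=
  MorphismProperty.functorialFactorizationData _ _

variable (S) in
/-- A functorial K-projective resolution. -/
noncomputable def res : Cplx S ⥤ Cplx S where
  obj M := (factorization S).Z.obj (Arrow.mk (0 : 0 ⟶ M))
  map f := (factorization S).Z.map (Arrow.homMk (𝟙 0) f)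
  map_id M := by
    exact (factorization S).Z.map_id _
  map_comp f g := by
    rw [← Functor.map_comp]
    congr 1

variable (S) in
/-- The augmentation of the functorial resolution. -/
noncomputable def resπ : res S ⟶ 𝟭 (Cplx S) where
  app M := (factorization S).p.app (Arrow.mk (0 : 0 ⟶ M))
  naturality M N f := (factorization S).p.naturality (Arrow.homMk (u := 𝟙 0) (v := f) (f := Arrow.mk (0 : 0 ⟶ M)) (g := Arrow.mk (0 : 0 ⟶ N)))

theorem quasiIso_of_rlp {X Y : Cplx S} (p : X ⟶ Y) (hp : (genCof S).rlp p) : QuasiIso p := by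
  rw [mem_rlp_iff] at hp
  have hp' : ∀ (n m : ℤ) (h : n + 1 = m) (x : X.X m) (y : Y.X n),
      X.d m (m + 1) x = 0 → p.f m x = Y.d n m y →
      ∃ z : X.X n, X.d n m z = x ∧ p.f n z = y := by
    rintro n m rfl
    exact hp n
  refine (quasiIso_iff_elements p).2 ⟨?_, ?_⟩
  · intro n y hy
    obtain ⟨z, hz, hz'⟩ := hp n 0 y (by simp) (by simp [hy])
    exact ⟨z, 0, hz, by simp [hz']⟩
  · intro n x w hx hw
    obtain ⟨z, hz, hz'⟩ := hp' (n - 1) n (by lia) x w hx hw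
    exact ⟨z, hz⟩

instance (M : Cplx S) : QuasiIso ((resπ S).app M) :=
  quasiIso_of_rlp _ ((factorization S).hp (Arrow.mk (0 : 0 ⟶ M)))

instance (M : Cplx S) : ((res S).obj M).IsKProjective :=
  isKProjective_of_llp (isZero_zero _) _ ((factorization S).hi (Arrow.mk (0 : 0 ⟶ M)))

end Resolution2

section Hom
variable {S : Type u} [CommRing S]
open CochainComplex CochainComplex.HomComplex

/-- The internal Hom complex of two complexes of `S`-modules: in degree `n` it is the module of
families of linear maps raising degrees by `n`, with differential
`z ↦ d ∘ z - (-1) ^ n • z ∘ d`. -/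
@[simps]
noncomputable def homCplx (K L : Cplx S) : Cplx S where
  X n := ModuleCat.of S (Cochain K L n)
  d i j := ModuleCat.ofHom (δ_hom S K L i j)
  shape i j hij := by
    apply ConcreteCategory.hom_ext
    intro z
    exact δ_shape _ _ hij z
  d_comp_d' i j l _ _ := by
    apply ConcreteCategory.hom_ext
    intro z
    exact δ_δ i j l z

/-- The map on cochains induced by pre- and postcomposition. -/
noncomputable def cochainMap {K K' L L' : Cplx S} (f : K' ⟶ K) (g : L ⟶ L') (n : ℤ) :
    Cochain K L n →ₗ[S] Cochain K' L' n where
  toFun z := (Cochain.ofHom f).comp (z.comp (Cochain.ofHom g) (add_zero n)) (zero_add n)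
  map_add' a b := by simp
  map_smul' r a := by simp

theorem cochainMap_apply {K K' L L' : Cplx S} (f : K' ⟶ K) (g : L ⟶ L') (n : ℤ)
    (z : Cochain K L n) : cochainMap f g n z =
      (Cochain.ofHom f).comp (z.comp (Cochain.ofHom g) (add_zero n)) (zero_add n) := rfl

theorem δ_cochainMap {K K' L L' : Cplx S} (f : K' ⟶ K) (g : L ⟶ L') (i j : ℤ)
    (z : Cochain K L i) : δ i j (cochainMap f g i z) = cochainMap f g j (δ i j z) := by
  rw [cochainMap_apply, cochainMap_apply, δ_ofHom_comp, δ_comp_ofHom]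

theorem cochainMap_id (K L : Cplx S) (n : ℤ) : cochainMap (𝟙 K) (𝟙 L) n = LinearMap.id := by
  ext1 z
  simp [cochainMap_apply]

theorem cochainMap_comp {K K' K'' L L' L'' : Cplx S} (f : K' ⟶ K) (f' : K'' ⟶ K') (g : L ⟶ L')
    (g' : L' ⟶ L'') (n : ℤ) :
    cochainMap (f' ≫ f) (g ≫ g') n = cochainMap f' g' n ∘ₗ cochainMap f g n := by
  ext1 z
  simp [cochainMap_apply]

/-- Functoriality of the internal Hom complex. -/
@[simps]
noncomputable def homMap {K K' L L' : Cplx S} (f : K' ⟶ K) (g : L ⟶ L') :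
    homCplx K L ⟶ homCplx K' L' where
  f n := ModuleCat.ofHom (cochainMap f g n)
  comm' i j _ := by
    apply ConcreteCategory.hom_ext
    intro z
    exact δ_cochainMap f g i j z

theorem homMap_id (K L : Cplx S) : homMap (𝟙 K) (𝟙 L) = 𝟙 (homCplx K L) := by
  ext n : 1
  simp only [homMap_f, cochainMap_id]
  rfl

theorem homMap_comp {K K' K'' L L' L'' : Cplx S} (f : K' ⟶ K) (f' : K'' ⟶ K') (g : L ⟶ L')
    (g' : L' ⟶ L'') : homMap (f' ≫ f) (g ≫ g') = homMap f g ≫ homMap f' g' := by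
  ext n : 1
  simp only [homMap_f, cochainMap_comp]
  rfl

variable (S) in
/-- The internal Hom bifunctor on complexes of `S`-modules. -/
noncomputable def homFunctor : (Cplx S)ᵒᵖ ⥤ Cplx S ⥤ Cplx S where
  obj K :=
    { obj := fun L => homCplx K.unop L
      map := fun g => homMap (𝟙 _) g
      map_id := fun L => homMap_id _ _
      map_comp := fun f g => by rw [← homMap_comp, Category.comp_id] }
  map f :=
    { app := fun L => homMap f.unop (𝟙 L)
      naturality := fun L L' g => by
        simp only [← homMap_comp, Category.comp_id, Category.id_comp] }
  map_id K := by
    ext L : 2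
    exact homMap_id _ _
  map_comp f g := by
    ext L : 2
    simp only [NatTrans.comp_app, ← homMap_comp, Category.comp_id]
    rfl

theorem acyclic_mappingCone {L L' : Cplx S} (g : L ⟶ L') [hg : QuasiIso g] :
    (mappingCone g).Acyclic := by
  rw [← HomotopyCategory.quotient_obj_mem_subcategoryAcyclic_iff_acyclic]
  refine ((HomotopyCategory.subcategoryAcyclic (ModuleCat.{u} S)).trW_iff_of_distinguished _
    (HomotopyCategory.mappingCone_triangleh_distinguished g)).1 ?_
  rw [← HomotopyCategory.quasiIso_eq_trW_subcategoryAcyclic]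
  exact (HomotopyCategory.quotient_map_mem_quasiIso_iff g).2 hg

theorem cochain_eq_lift {K L L' : Cplx S} (g : L ⟶ L') {n m : ℤ} (h : n + 1 = m)
    (w : Cochain K (mappingCone g) n) :
    ∃ (α : Cochain K L m) (β : Cochain K L' n), w = mappingCone.liftCochain g α β h := by
  refine ⟨w.comp (mappingCone.fst g).1 h, w.comp (mappingCone.snd g) (add_zero n), ?_⟩
  rw [mappingCone.ext_cochain_to_iff _ _ _ h]
  simp

theorem acyclic_shift {C : Cplx S} (hC : C.Acyclic) (n : ℤ) :
    (HomologicalComplex.Acyclic (C⟦n⟧ : Cplx S)) := by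
  rw [← HomotopyCategory.quotient_obj_mem_subcategoryAcyclic_iff_acyclic] at hC ⊢
  exact ObjectProperty.prop_of_iso _
    (((HomotopyCategory.quotient _ (.up ℤ)).commShiftIso n).symm.app C)
    ((HomotopyCategory.subcategoryAcyclic _).le_shift n _ hC)

theorem eq_δ_of_cocycle {K C : Cplx S} [K.IsKProjective] (hC : C.Acyclic) {n : ℤ}
    (z : Cochain K C n) (hz : δ n (n + 1) z = 0) (m : ℤ) (hm : m + 1 = n) :
    ∃ α : Cochain K C m, δ m n α = z := by
  obtain ⟨φ, hφ⟩ := (Cocycle.equivHom K (C⟦n⟧)).surjective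
    ((Cocycle.mk z (n + 1) rfl hz).rightShift n 0 (zero_add n))
  replace hφ : Cochain.ofHom φ = z.rightShift n 0 (zero_add n) := congr_arg Subtype.val hφ
  obtain ⟨h⟩ := IsKProjective.nonempty_homotopy_zero φ (acyclic_shift hC n)
  obtain ⟨f, hf⟩ := Cochain.equivHomotopy φ 0 h
  simp only [Int.reduceNeg, Cochain.ofHom_zero, add_zero] at hf
  refine ⟨n.negOnePow • Cochain.rightUnshift f m (by lia), ?_⟩
  apply (Cochain.rightShiftAddEquiv K C n n 0 (by simp)).injective
  change Cochain.rightShift (δ m n (n.negOnePow • Cochain.rightUnshift f m (by lia))) n 0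
    (zero_add n) = Cochain.rightShift z n 0 (zero_add n)
  rw [← hφ, hf, δ_units_smul, Cochain.rightShift_units_smul,
    Cochain.δ_rightUnshift _ _ _ _ 0 (by simp)]
  simp [smul_smul]

theorem homMap_quasiIso_right (K : Cplx S) [K.IsKProjective] {L L' : Cplx S} (g : L ⟶ L')
    [QuasiIso g] : QuasiIso (homMap (𝟙 K) g) := by
  have hC := acyclic_mappingCone g
  have hg (n : ℤ) (z : Cochain K L n) :
      (homMap (𝟙 K) g).f n z = z.comp (Cochain.ofHom g) (add_zero n) := by
    change cochainMap (𝟙 K) g n z = _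
    simp [cochainMap_apply]
  refine (quasiIso_iff_elements _).2 ⟨fun n (z : Cochain K L' n) hz => ?_,
    fun n (x : Cochain K L n) (w : Cochain K L' (n - 1)) hx hw => ?_⟩
  · change δ n (n + 1) z = 0 at hz
    obtain ⟨w, hw⟩ := eq_δ_of_cocycle hC (z.comp (Cochain.ofHom (mappingCone.inr g)) (add_zero n))
      (by rw [δ_comp_ofHom, hz, Cochain.zero_comp]) (n - 1) (by lia)
    obtain ⟨α, β, rfl⟩ := cochain_eq_lift g (show n - 1 + 1 = n by lia) w
    rw [mappingCone.δ_liftCochain _ _ _ _ (n + 1) rfl, mappingCone.ext_cochain_to_iff _ _ _ rfl] at hw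
    obtain ⟨h₁, h₂⟩ := hw
    refine ⟨α, β, ?_, ?_⟩
    · change δ n (n + 1) α = 0
      simpa using h₁
    · rw [hg]
      change z = _ + δ (n - 1) n β
      rw [add_comm]
      simpa using h₂.symm
  · change δ n (n + 1) x = 0 at hx
    rw [hg] at hw
    change x.comp (Cochain.ofHom g) (add_zero n) = δ (n - 1) n w at hw
    have hn : n - 1 + 1 = n := by lia
    have key : ∀ m : ℤ, m = n → ∀ x' : Cochain K L m, δ m (n + 1) x' = 0 →
        x'.comp (Cochain.ofHom g) (add_zero m) = δ (n - 1) m w →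
        ∃ v : Cochain K L (n - 1), δ (n - 1) m v = x' := by
      rintro m hm x' hx' hw'
      obtain rfl : m = n - 1 + 1 := by lia
      obtain ⟨u, hu⟩ := eq_δ_of_cocycle hC (mappingCone.liftCochain g x' (-w) rfl)
        (by rw [mappingCone.δ_liftCochain _ _ _ _ (n + 1) (by lia), hx', hw']; simp) (n - 1 - 1)
        (by lia)
      obtain ⟨α, β, rfl⟩ := cochain_eq_lift g (show n - 1 - 1 + 1 = n - 1 by lia) u
      rw [mappingCone.δ_liftCochain _ _ _ _ (n - 1 + 1) rfl,
        mappingCone.ext_cochain_to_iff _ _ _ rfl] at hu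
      refine ⟨-α, ?_⟩
      simpa using hu.1
    exact key n rfl x hx hw

theorem comp_sub_comp_eq_δ {K K' L : Cplx S} {f f' : K' ⟶ K} (h : Homotopy f f') {n : ℤ}
    (z : Cochain K L n) (hz : δ n (n + 1) z = 0) : ∃ w : Cochain K' L (n - 1),
      (Cochain.ofHom f).comp z (zero_add n) =
        (Cochain.ofHom f').comp z (zero_add n) + δ (n - 1) n w := by
  obtain ⟨u, hu⟩ := Cochain.equivHomotopy _ _ h
  refine ⟨n.negOnePow • u.comp z (by lia), ?_⟩
  rw [hu, δ_units_smul, δ_comp u z _ 0 (n + 1) n (by lia) (by lia) rfl, hz]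
  simp only [Cochain.add_comp, Cochain.comp_zero, zero_add, smul_smul, Int.units_mul_self, one_smul]
  exact add_comm _ _

theorem homMap_quasiIso_left {K K' : Cplx S} [K.IsKProjective] [K'.IsKProjective] (f : K' ⟶ K)
    [hf : QuasiIso f] (L : Cplx S) : QuasiIso (homMap f (𝟙 L)) := by
  obtain ⟨e, rfl⟩ := (IsKProjective.quasiIso_iff f).1 hf
  have hg (n : ℤ) (z : Cochain K L n) :
      (homMap e.hom (𝟙 L)).f n z = (Cochain.ofHom e.hom).comp z (zero_add n) := by
    change cochainMap e.hom (𝟙 L) n z = _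
    simp [cochainMap_apply]
  refine (quasiIso_iff_elements _).2 ⟨fun n (z : Cochain K' L n) hz => ?_,
    fun n (x : Cochain K L n) (w : Cochain K' L (n - 1)) hx hw => ?_⟩
  · change δ n (n + 1) z = 0 at hz
    obtain ⟨w, hw⟩ := comp_sub_comp_eq_δ e.homotopyHomInvId.symm z hz
    refine ⟨(Cochain.ofHom e.inv).comp z (zero_add n), w, ?_, ?_⟩
    · change δ n (n + 1) _ = 0
      rw [δ_ofHom_comp, hz, Cochain.comp_zero]
    · rw [hg]
      change _ = _ + δ (n - 1) n w
      simpa using hw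
  · change δ n (n + 1) x = 0 at hx
    rw [hg] at hw
    change _ = δ (n - 1) n w at hw
    obtain ⟨w', hw'⟩ := comp_sub_comp_eq_δ e.homotopyInvHomId.symm x hx
    refine ⟨(Cochain.ofHom e.inv).comp w (zero_add _) + w', ?_⟩
    change δ (n - 1) n _ = _
    rw [δ_add, δ_ofHom_comp, ← hw]
    simpa using hw'.symm

end Hom

section Dual
variable (k : Type u) {S : Type u} [Field k] [CommRing S] [Algebra k S]

/-- The `k`-linear dual of an `S`-module. -/
noncomputable def LinDual (M : ModuleCat.{u} S) : Type u :=
  (ModuleCat.restrictScalars (algebraMap k S)).obj M →ₗ[k] k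

noncomputable instance (M : ModuleCat.{u} S) : AddCommGroup (LinDual k M) :=
  inferInstanceAs (AddCommGroup ((ModuleCat.restrictScalars (algebraMap k S)).obj M →ₗ[k] k))

noncomputable instance (M : ModuleCat.{u} S) : FunLike (LinDual k M) M k :=
  inferInstanceAs (FunLike ((ModuleCat.restrictScalars (algebraMap k S)).obj M →ₗ[k] k) _ k)

variable {k}

@[ext]
theorem LinDual.ext {M : ModuleCat.{u} S} {φ ψ : LinDual k M} (h : ∀ m, φ m = ψ m) : φ = ψ :=
  DFunLike.ext _ _ h

@[simp]
theorem LinDual.add_apply {M : ModuleCat.{u} S} (φ ψ : LinDual k M) (m : M) :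
    (φ + ψ) m = φ m + ψ m := rfl

@[simp]
theorem LinDual.zero_apply {M : ModuleCat.{u} S} (m : M) : (0 : LinDual k M) m = 0 := rfl

theorem LinDual.map_add {M : ModuleCat.{u} S} (φ : LinDual k M) (m m' : M) :
    φ (m + m') = φ m + φ m' :=
  LinearMap.map_add (show (ModuleCat.restrictScalars (algebraMap k S)).obj M →ₗ[k] k from φ) m m'

theorem LinDual.map_algebraMap_smul {M : ModuleCat.{u} S} (φ : LinDual k M) (a : k) (m : M) :
    φ (algebraMap k S a • m) = a * φ m :=
  LinearMap.map_smul (show (ModuleCat.restrictScalars (algebraMap k S)).obj M →ₗ[k] k from φ) a m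

theorem LinDual.map_zero {M : ModuleCat.{u} S} (φ : LinDual k M) : φ 0 = 0 :=
  LinearMap.map_zero (show (ModuleCat.restrictScalars (algebraMap k S)).obj M →ₗ[k] k from φ)

/-- Constructor for elements of the dual. -/
noncomputable def LinDual.mk {M : ModuleCat.{u} S} (φ : M → k) (h₁ : ∀ m m', φ (m + m') = φ m + φ m')
    (h₂ : ∀ (a : k) (m : M), φ (algebraMap k S a • m) = a * φ m) : LinDual k M :=
  (show (ModuleCat.restrictScalars (algebraMap k S)).obj M →ₗ[k] k from
    { toFun := φ, map_add' := h₁, map_smul' := h₂ })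

@[simp]
theorem LinDual.mk_apply {M : ModuleCat.{u} S} (φ : M → k) (h₁) (h₂) (m : M) :
    (LinDual.mk (S := S) φ h₁ h₂ : LinDual k M) m = φ m := rfl

/-- The action of `S` on the dual: `(s • φ) m = φ (s • m)`. -/
noncomputable instance (M : ModuleCat.{u} S) : Module S (LinDual k M) where
  smul s φ := LinDual.mk (fun m => φ (s • m)) (fun m m' => by rw [smul_add, LinDual.map_add])
    (fun a m => by rw [smul_comm, LinDual.map_algebraMap_smul])
  one_smul φ := by
    ext m
    exact congr_arg φ (one_smul S m)
  mul_smul s t φ := by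
    ext m
    change φ ((s * t) • m) = φ (t • s • m)
    rw [mul_comm, mul_smul]
  smul_zero s := rfl
  smul_add s φ ψ := rfl
  add_smul s t φ := by
    ext m
    change φ ((s + t) • m) = φ (s • m) + φ (t • m)
    rw [add_smul, LinDual.map_add]
  zero_smul φ := by
    ext m
    change φ ((0 : S) • m) = 0
    rw [zero_smul, LinDual.map_zero]

@[simp]
theorem LinDual.smul_apply {M : ModuleCat.{u} S} (s : S) (φ : LinDual k M) (m : M) :
    (s • φ) m = φ (s • m) := rfl

variable (k S) in
/-- The functor `Hom_k(-, k)` from `S`-modules to `S`-modules. -/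
noncomputable def linDual : (ModuleCat.{u} S)ᵒᵖ ⥤ ModuleCat.{u} S where
  obj M := ModuleCat.of S (LinDual k M.unop)
  map {M N} f := ModuleCat.ofHom
    { toFun := fun φ => LinDual.mk (fun m => φ (f.unop m))
        (fun m m' => by rw [_root_.map_add, LinDual.map_add])
        (fun a m => by rw [_root_.map_smul, LinDual.map_algebraMap_smul])
      map_add' := fun _ _ => rfl
      map_smul' := fun s φ => by
        ext m
        exact congr_arg φ (f.unop.hom.map_smul s m).symm }
  map_id _ := rfl
  map_comp _ _ := rfl

theorem linDual_map_apply {M N : (ModuleCat.{u} S)ᵒᵖ} (f : M ⟶ N) (φ : LinDual k M.unop)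
    (m : N.unop) : (show LinDual k N.unop from (linDual k S).map f φ) m = φ (f.unop m) := rfl

instance : (linDual k S).Additive where
  map_add {M N f g} := by
    apply ConcreteCategory.hom_ext
    intro φ
    apply LinDual.ext
    intro m
    exact LinDual.map_add φ _ _

theorem exists_extension {X Y : ModuleCat.{u} S} (g : X ⟶ Y) (φ : LinDual k X)
    (h : ∀ x, g x = 0 → φ x = 0) : ∃ ψ : LinDual k Y, ∀ x, ψ (g x) = φ x := by
  let g' := ((ModuleCat.restrictScalars (algebraMap k S)).map g).hom
  let φ' : (ModuleCat.restrictScalars (algebraMap k S)).obj X →ₗ[k] k := φ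
  obtain ⟨ψ, hψ⟩ := LinearMap.exists_extend (p := LinearMap.range g')
    (((LinearMap.ker g').liftQ φ' (fun x hx => h x hx)) ∘ₗ
      (g'.quotKerEquivRange).symm.toLinearMap)
  refine ⟨ψ, fun x => ?_⟩
  have := LinearMap.congr_fun hψ (g'.quotKerEquivRange (Submodule.Quotient.mk x))
  rw [LinearMap.comp_apply, LinearMap.comp_apply, LinearEquiv.coe_coe,
    LinearEquiv.symm_apply_apply] at this
  exact this

instance : (linDual k S).PreservesHomology := by
  refine ((linDual k S).exact_tfae.out 1 2).1 fun T hT => ?_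
  rw [ShortComplex.moduleCat_exact_iff]
  intro (φ : LinDual k T.X₂.unop) hφ
  have hT' := hT.unop
  rw [ShortComplex.moduleCat_exact_iff] at hT'
  obtain ⟨ψ, hψ⟩ := exists_extension T.f.unop φ (fun x hx => by
    obtain ⟨y, rfl⟩ := hT' x hx
    exact DFunLike.congr_fun (F := LinDual k T.X₃.unop) hφ y)
  exact ⟨ψ, LinDual.ext hψ⟩

variable (k S) in
/-- The functor `RHom_k(-, k)` on complexes of `S`-modules: the complex with
`Hom_k(M⁻ⁿ, k)` in degree `n`. As `k` is a field it needs no resolution. -/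
noncomputable def dualCplx : (Cplx S)ᵒᵖ ⥤ Cplx S :=
  (CochainComplex.opEquivalence (ModuleCat.{u} S)).functor ⋙
    (linDual k S).mapHomologicalComplex (ComplexShape.up ℤ)

variable (k) in
theorem dualCplx_quasiIso {K L : Cplx S} (f : K ⟶ L) [hf : QuasiIso f] :
    QuasiIso ((dualCplx k S).map f.op) := by
  have : QuasiIso ((CochainComplex.opEquivalence (ModuleCat.{u} S)).functor.map f.op) := by
    have h : QuasiIso ((HomologicalComplex.opFunctor (ModuleCat.{u} S) (.up ℤ)).map f.op) := by
      rwa [quasiIso_opFunctor_map_iff]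
    rw [quasiIso_iff] at h ⊢
    intro n
    have := h (-n)
    rw [quasiIsoAt_iff' _ (-(n - 1)) (-n) (-(n + 1))
      (ComplexShape.prev_eq' _ (show -n + 1 = -(n - 1) by lia))
      (ComplexShape.next_eq' _ (show -(n + 1) + 1 = -n by lia))] at this
    rw [quasiIsoAt_iff' _ (n - 1) n (n + 1) (by simp) (by simp)]
    exact this
  dsimp only [dualCplx, Functor.comp_map]
  exact quasiIso_map_of_preservesHomology _ (linDual k S)

end Dual

section Colim
variable {S : Type u} [CommRing S]

instance : PreservesColimitsOfShape ℕ (forget (ModuleCat.{u} S)) := by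
  have := preservesFilteredColimitsOfSize_shrink.{0, u, 0, u} (forget (ModuleCat.{u} S))
  infer_instance

variable (S) in
/-- The colimit over `ℕ` on complexes. As filtered colimits of modules are exact, it
computes the colimit of the underlying diagram in the derived (infinity-)category. -/
noncomputable abbrev seqColim : (ℕ ⥤ Cplx S) ⥤ Cplx S := colim

theorem seqColim_quasiIso {F G : ℕ ⥤ Cplx S} (α : F ⟶ G) (hα : ∀ n, QuasiIso (α.app n)) :
    QuasiIso ((seqColim S).map α) := by
  have hF := colimit.isColimit F
  have hG := colimit.isColimit G
  have hι (i : ℕ) (n : ℤ) (x : (F.obj i).X n) : ((seqColim S).map α).f n ((colimit.ι F i).f n x) =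
      (colimit.ι G i).f n ((α.app i).f n x) := by
    rw [← ConcreteCategory.comp_apply, ← ConcreteCategory.comp_apply, ← comp_f, ← comp_f]
    rw [colimit.ι_map]
  refine (quasiIso_iff_elements _).2 ⟨fun n y hy => ?_, fun n x w hx hw => ?_⟩
  · obtain ⟨i, y, rfl⟩ := exists_rep hG n y
    obtain ⟨j, a, b, hab⟩ := exists_eq hG (n + 1) ((G.obj i).d n (n + 1) y)
      (0 : (G.obj i).X (n + 1)) (by
        refine (hom_d (colimit.ι G i) y).symm.trans (hy.trans ?_)
        exact (map_zero ((colimit.ι G i).f (n + 1)).hom).symm)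
    rw [map_zero, ← hom_d] at hab
    obtain ⟨x, w, hx, hxw⟩ := ((quasiIso_iff_elements _).1 (hα j)).1 n _ hab
    refine ⟨(colimit.ι F j).f n x, (colimit.ι G j).f (n - 1) w, ?_, ?_⟩
    · rw [hom_d, hx, map_zero]
    · rw [hι, hom_d, ← map_add, ← hxw]
      exact (naturality_f (colimit.cocone G) a n y).symm
  · obtain ⟨i₁, x, rfl⟩ := exists_rep hF n x
    obtain ⟨i₂, w, rfl⟩ := exists_rep hG (n - 1) w
    obtain ⟨j₁, a₁, b₁, h₁⟩ := exists_eq hF (n + 1) ((F.obj i₁).d n (n + 1) x)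
      (0 : (F.obj i₁).X (n + 1)) (by
        refine (hom_d (colimit.ι F i₁) x).symm.trans (hx.trans ?_)
        exact (map_zero ((colimit.ι F i₁).f (n + 1)).hom).symm)
    rw [map_zero, ← hom_d] at h₁
    obtain ⟨j₂, a₂, b₂, h₂⟩ := exists_eq hG n ((α.app j₁).f n ((F.map a₁).f n x))
      ((G.obj i₂).d (n - 1) n w) (by
        rw [← hom_d]
        refine Eq.trans ?_ hw
        erw [← hι]
        congr 1
        exact naturality_f (colimit.cocone F) a₁ n x)
    obtain ⟨v, hv⟩ := ((quasiIso_iff_elements _).1 (hα j₂)).2 n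
      ((F.map a₂).f n ((F.map a₁).f n x)) ((G.map b₂).f (n - 1) w)
      (by rw [hom_d, h₁, map_zero]) (by
        rw [hom_d, ← h₂]
        exact ConcreteCategory.congr_hom (congr_arg (fun φ => HomologicalComplex.Hom.f φ n)
          (α.naturality a₂)) ((F.map a₁).f n x))
    refine ⟨(colimit.ι F j₂).f (n - 1) v, ?_⟩
    rw [hom_d, hv]
    exact (naturality_f (colimit.cocone F) a₂ n _).trans
      (naturality_f (colimit.cocone F) a₁ n x)

end Colim

section Tensor
open MonoidalCategory
variable (S : Type u) [CommRing S]

/-- The functor sending a module `A` and a complex `M` to the complex `M ⊗_S A`. -/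
noncomputable def tensorCplx : ModuleCat.{u} S ⥤ Cplx S ⥤ Cplx S where
  obj A := (tensorRight A).mapHomologicalComplex (ComplexShape.up ℤ)
  map f := NatTrans.mapHomologicalComplex ((curriedTensor (ModuleCat.{u} S)).flip.map f) _
  map_id A := by
    ext K n : 4
    simp
  map_comp f g := by
    ext K n : 4
    simp

variable {S}

theorem tensorCplx_quasiIso {K K' : Cplx S} [K.IsKProjective] [K'.IsKProjective] (f : K ⟶ K')
    [hf : QuasiIso f] (A : ModuleCat.{u} S) : QuasiIso (((tensorCplx S).obj A).map f) := by
  obtain ⟨e, rfl⟩ := (CochainComplex.IsKProjective.quasiIso_iff f).1 hf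
  exact ((tensorRight A).mapHomotopyEquiv e).quasiIso_hom

theorem res_quasiIso {K L : Cplx S} (f : K ⟶ L) [QuasiIso f] : QuasiIso ((res S).map f) := by
  have h := (resπ S).naturality f
  have : QuasiIso ((res S).map f ≫ (resπ S).app L) := by
    rw [h]
    dsimp only [Functor.id_map]
    infer_instance
  exact quasiIso_of_comp_right _ ((resπ S).app L)

end Tensor

section Derived0
variable (S : Type u) [CommRing S]

/-- The functor `M ↦ (A ↦ P ⊗_S A)` with `P` the functorial K-projective resolution of `M`. -/
noncomputable def preTensor : Cplx S ⥤ ModuleCat.{u} S ⥤ Cplx S :=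
  res S ⋙ (tensorCplx S).flip

theorem preTensor_quasiIso {M N : Cplx S} (f : M ⟶ N) [QuasiIso f] (A : ModuleCat.{u} S) :
    QuasiIso (((preTensor S).map f).app A) := by
  have := res_quasiIso f
  exact tensorCplx_quasiIso ((res S).map f) A

/-- The category of `S`-modules of finite length. -/
abbrev FiniteLengthModule : Type (u + 1) :=
  ObjectProperty.FullSubcategory (fun A : ModuleCat.{u} S => IsFiniteLength S A)

/-- The inclusion of the modules of finite length in all modules. -/
abbrev FiniteLengthModule.incl : FiniteLengthModule S ⥤ ModuleCat.{u} S :=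
  ObjectProperty.ι _

end Derived0

section Derived
variable (k S : Type u) [Field k] [CommRing S] [Algebra k S]
  [HasDerivedCategory.{w} (ModuleCat.{u} S)]

/-- The unbounded derived category of `S`-modules. -/
abbrev D : Type (u + 1) := DerivedCategory (ModuleCat.{u} S)

/-- The quasi-isomorphisms of complexes of `S`-modules. -/
abbrev qis : MorphismProperty (Cplx S) := quasiIso (ModuleCat.{u} S) (ComplexShape.up ℤ)

/-- The bifunctor `(M, N) ↦ Hom(P, N)` with `P` the functorial K-projective resolution of `M`. -/
noncomputable def preRHom : (Cplx S)ᵒᵖ ⥤ Cplx S ⥤ D S :=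
  (res S).op ⋙ homFunctor S ⋙ (Functor.whiskeringRight _ _ _).obj DerivedCategory.Q

theorem preRHom_inverts :
    MorphismProperty.IsInvertedBy₂ (qis S).op (qis S) (preRHom S) := by
  rintro ⟨M₁, N₁⟩ ⟨M₂, N₂⟩ ⟨f, g⟩ ⟨hf, hg⟩
  have hf' : QuasiIso f.unop := hf
  have hg' : QuasiIso g := hg
  have := res_quasiIso f.unop
  have h₁ := homMap_quasiIso_left ((res S).map f.unop) N₁
  have h₂ := homMap_quasiIso_right ((res S).obj M₂.unop) g
  have i₁ : IsIso (DerivedCategory.Q.map (homMap ((res S).map f.unop) (𝟙 N₁))) := inferInstance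
  have i₂ : IsIso (DerivedCategory.Q.map (homMap (𝟙 ((res S).obj M₂.unop)) g)) := inferInstance
  exact @IsIso.comp_isIso _ _ _ _ _ _ _ i₁ i₂

/-- The derived Hom bifunctor `RHom_S(-, -) : D(S)ᵒᵖ × D(S) → D(S)`. -/
noncomputable def RHom : (D S)ᵒᵖ ⥤ D S ⥤ D S :=
  Localization.lift₂ (preRHom S) (preRHom_inverts S) DerivedCategory.Q.op DerivedCategory.Q

theorem dual_inverts : (qis S).op.IsInvertedBy (dualCplx k S ⋙ DerivedCategory.Q) := by
  intro M N f hf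
  have : QuasiIso f.unop := hf
  have := dualCplx_quasiIso k f.unop
  exact inferInstanceAs (IsIso (DerivedCategory.Q.map ((dualCplx k S).map f.unop.op)))

/-- The functor `(-)^∨ = RHom_k(-, k) : D(S)ᵒᵖ → D(S)`. -/
noncomputable def dual : (D S)ᵒᵖ ⥤ D S :=
  Localization.lift (dualCplx k S ⋙ DerivedCategory.Q) (dual_inverts k S) DerivedCategory.Q.op

theorem tensor_inverts : (qis S).IsInvertedBy
    (preTensor S ⋙ (Functor.whiskeringRight _ _ _).obj DerivedCategory.Q) := by
  intro M N f hf
  have : QuasiIso f := hf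
  rw [NatTrans.isIso_iff_isIso_app]
  intro A
  have := preTensor_quasiIso S f A
  exact inferInstanceAs (IsIso (DerivedCategory.Q.map (((preTensor S).map f).app A)))

/-- The derived tensor product `M ⊗ᴸ_S A` of an object `M` of `D(S)` and an `S`-module `A`. -/
noncomputable def derivedTensor : D S ⥤ ModuleCat.{u} S ⥤ D S :=
  Localization.lift (preTensor S ⋙ (Functor.whiskeringRight _ _ _).obj DerivedCategory.Q)
    (tensor_inverts S) DerivedCategory.Q

variable {S} in
/-- The tower `⋯ → S/I² → S/I → S/I⁰` of `S`-modules. -/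
noncomputable abbrev quotientPowers (I : Ideal S) : ℕᵒᵖ ⥤ ModuleCat.{u} S :=
  localCohomology.ringModIdeals (localCohomology.idealPowersDiagram I)

variable {S} in
/-- The functor sending a complex `X` to the complex `colim_n Hom(Pₙ, X)`, with `Pₙ` the
functorial K-projective resolution of `S/Iⁿ`. -/
noncomputable def torsionCplx (I : Ideal S) : Cplx S ⥤ Cplx S :=
  ((quotientPowers I ⋙ single (ModuleCat.{u} S) (ComplexShape.up ℤ) 0 ⋙ res S).rightOp ⋙
    homFunctor S).flip ⋙ seqColim S

variable {S} in
theorem torsion_inverts (I : Ideal S) :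
    (qis S).IsInvertedBy (torsionCplx I ⋙ DerivedCategory.Q) := by
  intro M N f hf
  have : QuasiIso f := hf
  have : QuasiIso ((torsionCplx I).map f) :=
    seqColim_quasiIso _ (fun n => homMap_quasiIso_right ((res S).obj ((single (ModuleCat.{u} S)
      (ComplexShape.up ℤ) 0).obj ((quotientPowers I).obj (op n)))) f)
  exact inferInstanceAs (IsIso (DerivedCategory.Q.map ((torsionCplx I).map f)))

variable {S} in
/-- The derived torsion functor `RΓ_I(-) = colim_n RHom_S(S/Iⁿ, -) : D(S) → D(S)`. -/
noncomputable def derivedTorsion (I : Ideal S) : D S ⥤ D S :=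
  Localization.lift (torsionCplx I ⋙ DerivedCategory.Q) (torsion_inverts I) DerivedCategory.Q

variable {S} in
/-- The functor sending a complex `M` to the inverse system of complexes `P ⊗_S S/Iⁿ`, with `P`
the functorial K-projective resolution of `M`. -/
noncomputable def reductions (I : Ideal S) : Cplx S ⥤ ℕᵒᵖ ⥤ Cplx S :=
  preTensor S ⋙ (Functor.whiskeringLeft _ _ _).obj (quotientPowers I)

variable {S} in
/-- The functor sending a complex `M` to the complex `colim_n (P ⊗_S S/Iⁿ)^∨`, with `P` the
functorial K-projective resolution of `M`. -/
noncomputable def colimDualReductionsCplx (I : Ideal S) : (Cplx S)ᵒᵖ ⥤ Cplx S :=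
  (reductions I).op ⋙ (Functor.leftOpRightOpEquiv ℕ (Cplx S)).functor ⋙
    (Functor.whiskeringRight _ _ _).obj (dualCplx k S) ⋙ seqColim S

variable {S} in
theorem colimDualReductions_inverts (I : Ideal S) :
    (qis S).op.IsInvertedBy (colimDualReductionsCplx k I ⋙ DerivedCategory.Q) := by
  intro M N f hf
  have : QuasiIso f.unop := hf
  have : QuasiIso ((colimDualReductionsCplx k I).map f) := by
    refine seqColim_quasiIso _ (fun n => ?_)
    have := preTensor_quasiIso S f.unop ((quotientPowers I).obj (op n))
    exact dualCplx_quasiIso k (((preTensor S).map f.unop).app ((quotientPowers I).obj (op n)))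
  exact inferInstanceAs (IsIso (DerivedCategory.Q.map ((colimDualReductionsCplx k I).map f)))

variable {S} in
/-- The functor `M ↦ colim_n (M ⊗ᴸ_S S/Iⁿ)^∨ : D(S)ᵒᵖ → D(S)`. -/
noncomputable def colimDualReductions (I : Ideal S) : (D S)ᵒᵖ ⥤ D S :=
  Localization.lift (colimDualReductionsCplx k I ⋙ DerivedCategory.Q)
    (colimDualReductions_inverts k I) DerivedCategory.Q.op

/-- An `S`-module viewed as an object of `D(S)` in degree `0`. -/
noncomputable abbrev inD : ModuleCat.{u} S ⥤ D S :=
  DerivedCategory.singleFunctor (ModuleCat.{u} S) 0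

variable {S} in
/-- Normalized dualizing complexes of a (noetherian) local ring `S` with residue field `κ`:
finite injective dimension, finitely generated cohomology, `S → RHom_S(ω, ω)` an isomorphism,
and `RHom_S(κ, ω) ≃ κ`. -/
structure IsNormalizedDualizingComplex [IsLocalRing S] (ω : D S) : Prop where
  finite_injective_dimension : ∃ (I : Cplx S) (a b : ℤ), I.IsStrictlyGE a ∧ I.IsStrictlyLE b ∧
    (∀ n, Injective (I.X n)) ∧ Nonempty (ω ≅ DerivedCategory.Q.obj I)
  finite_homology : ∀ n : ℤ, Module.Finite S
    ((DerivedCategory.homologyFunctor (ModuleCat.{u} S) n).obj ω)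
  bijective_smul_id : Function.Bijective (fun s : S => s • 𝟙 ω)
  hom_shift_eq_zero : ∀ n : ℤ, n ≠ 0 → ∀ f : ω ⟶ (CategoryTheory.shiftFunctor (D S) n).obj ω,
    f = 0
  residueField : Nonempty (((RHom S).obj
    (op ((inD S).obj (ModuleCat.of S (IsLocalRing.ResidueField S))))).obj ω ≅
      (inD S).obj (ModuleCat.of S (IsLocalRing.ResidueField S)))

end Derived

end GrothendieckDuality

open CategoryTheory GrothendieckDuality

/-!
The dualizing complex `ω` is represented by a bounded complex `I` of injective modules. The idea is
that, as seen from complexes of `𝔪`-torsion modules, `I` cannot be distinguished from the module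
`E = Hom_k(S, k)`, while `Hom(-, E)` is the `k`-dual `(-)^∨` (`dualIsoHom`).

To compare `I` with `E`, let `X` be the subcomplex of `𝔪`-torsion elements of `I`, again a complex of
injectives. As `Ext(k, I) = k` in degree `0`, there is an element `x₀` of `X⁰` killed by `𝔪` whose
class generates `Ext⁰(k, I)`. It is not a boundary in `X`, so that some `k`-linear functional on `X⁰`
vanishes on the boundaries but not at `x₀`, and such a functional is a morphism `φ : X ⟶ E`. Since
the residue field is `k`, the elements of `E` killed by `𝔪` form a one-dimensional space. Therefore
`φ`, like the inclusion `X ⟶ I`, induces an isomorphism on `Ext(k, -)`, and by dévissage on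
`Hom(Y, -)` for every complex `Y` of `𝔪`-torsion modules, bounded or not
(`exists_dualizer_comparison`, based on `homCplx_acyclic_of_socleExact`).

The adjunction `RHom(A, N^∨) ≅ (N ⊗ A)^∨` is the isomorphism `Hom(A, Q^∨) ≅ (Q ⊗ A)^∨` of complexes
(`dualTensorIso`) for a K-projective resolution `Q` of `N`, because `Q^∨` is K-injective.

For the isomorphism `RΓ(RHom(M, ω)) ≅ colim_n (M ⊗ S ⧸ 𝔪ⁿ)^∨`, let `Q` be a K-projective resolution
of `M`. By the symmetry of `Hom(P, Hom(Q, C))` (`swapIso`) and the comparison above, `Hom(Q, I)` may be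
replaced by `Hom(Q, E) = Q^∨` inside `RΓ`, and the adjunction applies to the terms
`RHom(S ⧸ 𝔪ⁿ, Q^∨)` of the colimit.

The isomorphism `RHom(M, ω) ≅ RΓ(M)^∨` needs in addition that `RHom(M, I) → RHom(RΓ(M), I)` is an
isomorphism, and this is where completeness enters. If `x ∈ 𝔪` acts bijectively on `N` then
`Hom(N, I)` is acyclic, since the finitely generated cohomology modules of `I` are complete, so that
the homotopy limit of the tower of multiplications by `x` on `I` is zero (`homCplx_acyclic_of_smul`).
For a resolution `J` of `M` by injectives, `RΓ(M)` is the torsion subcomplex of `J`, and it is reached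
by taking torsion for one generator of `𝔪` at a time; in each step the quotient is a complex on
which the generator acts bijectively (`homMap_torsion_quasiIso`).

The argument uses K-injective resolutions of unbounded complexes whose terms are injective. They are
constructed as homotopy limits of towers of double duals (`injRes`): the dual of a K-projective
complex with projective terms is K-injective with injective terms, and a complex embeds in its
double dual, also in cohomology.
-/

namespace GrothendieckDuality
open CategoryTheory Limits HomologicalComplex Opposite CochainComplex CochainComplex.HomComplex

/-! ### Hom complexes and mapping cocones -/

section HomComplexes
variable {S : Type u} [CommRing S]

theorem homCplx_acyclic_iff (K L : Cplx S) : (homCplx K L).Acyclic ↔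
    ∀ (n : ℤ) (z : Cochain K L n), δ n (n + 1) z = 0 →
      ∃ w : Cochain K L (n - 1), δ (n - 1) n w = z := by
  constructor
  · intro h n z hz
    exact (exactAt_iff_elements _ n).1 (h n) z hz
  · intro h n
    exact (exactAt_iff_elements _ n).2 (h n)

theorem homMap_left_apply {K K' : Cplx S} (f : K' ⟶ K) (L : Cplx S) (n : ℤ) (z : Cochain K L n) :
    (homMap f (𝟙 L)).f n z = (Cochain.ofHom f).comp z (zero_add n) := by
  change cochainMap f (𝟙 L) n z = _
  simp [cochainMap_apply]

theorem homMap_right_apply (K : Cplx S) {L L' : Cplx S} (g : L ⟶ L') (n : ℤ)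
    (z : Cochain K L n) :
    (homMap (𝟙 K) g).f n z = z.comp (Cochain.ofHom g) (add_zero n) := by
  change cochainMap (𝟙 K) g n z = _
  simp [cochainMap_apply]

theorem homCplx_acyclic_of_acyclic_left {K : Cplx S} (hK : K.Acyclic) (L : Cplx S)
    [L.IsKInjective] : (homCplx K L).Acyclic :=
  (homCplx_acyclic_iff K L).2 fun n z hz =>
    IsKInjective.eq_δ_of_cocycle (Cocycle.mk z (n + 1) rfl hz) hK (n - 1) (by lia)

theorem homCplx_acyclic_of_acyclic_right (K : Cplx S) {L : Cplx S} (hL : L.Acyclic)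
    [L.IsKInjective] : (homCplx K L).Acyclic :=
  (homCplx_acyclic_iff K L).2 fun n z hz =>
    IsKInjective.eq_δ_of_cocycle' (Cocycle.mk z (n + 1) rfl hz) hL (n - 1) (by lia)

theorem homCplx_acyclic_of_isKProjective (K : Cplx S) [K.IsKProjective] {L : Cplx S}
    (hL : L.Acyclic) : (homCplx K L).Acyclic :=
  (homCplx_acyclic_iff K L).2 fun n z hz => eq_δ_of_cocycle hL z hz (n - 1) (by lia)

/-- K-injectivity from the acyclicity of the complexes `Hom(K, L)` for acyclic `K`: a morphism is a
cocycle of degree `0`, and a cochain that bounds it is a null-homotopy. -/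
theorem isKInjective_of_homCplx_acyclic {L : Cplx S}
    (h : ∀ K : Cplx S, K.Acyclic → (homCplx K L).Acyclic) : L.IsKInjective := by
  refine ⟨fun {K} f hK => ?_⟩
  obtain ⟨w, hw⟩ := (homCplx_acyclic_iff K L).1 (h K hK) 0 (Cochain.ofHom f) (by simp)
  exact ⟨(Cochain.equivHomotopy f 0).symm ⟨w, by rw [Cochain.ofHom_zero, add_zero]; exact hw.symm⟩⟩

theorem exists_δ_eq {K L : Cplx S} (h : (homCplx K L).Acyclic) {n n' : ℤ} (z : Cochain K L n)
    (hn' : n + 1 = n') (hz : δ n n' z = 0) (m : ℤ) (hm : m + 1 = n) :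
    ∃ w : Cochain K L m, δ m n w = z := by
  obtain rfl : m = n - 1 := by lia
  subst hn'
  exact (homCplx_acyclic_iff K L).1 h n z hz

/-- A quasi-isomorphism `Hom(K, L) → Hom(K', L)` in terms of cochains: surjectivity and
injectivity in cohomology. -/
theorem quasiIso_homMap_left_iff {K K' : Cplx S} (f : K' ⟶ K) (L : Cplx S) :
    QuasiIso (homMap f (𝟙 L)) ↔
    (∀ (m n : ℤ), m + 1 = n → ∀ (y : Cochain K' L n), δ n (n + 1) y = 0 →
      ∃ (x : Cochain K L n) (w : Cochain K' L m), δ n (n + 1) x = 0 ∧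
        y = (Cochain.ofHom f).comp x (zero_add n) + δ m n w) ∧
    (∀ (m n : ℤ), m + 1 = n → ∀ (x : Cochain K L n) (w : Cochain K' L m), δ n (n + 1) x = 0 →
      (Cochain.ofHom f).comp x (zero_add n) = δ m n w → ∃ v : Cochain K L m, δ m n v = x) := by
  have e (m n : ℤ) : m + 1 = n ↔ m = n - 1 := by lia
  simp only [e, quasiIso_iff_elements, ← homMap_left_apply]
  constructor
  · intro h
    exact ⟨fun m n hm => by subst hm; exact h.1 n, fun m n hm => by subst hm; exact h.2 n⟩
  · intro h
    exact ⟨fun n => h.1 _ n rfl, fun n => h.2 _ n rfl⟩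

/-- A quasi-isomorphism `Hom(K, L) → Hom(K, L')` in terms of cochains: surjectivity and
injectivity in cohomology. -/
theorem quasiIso_homMap_right_iff (K : Cplx S) {L L' : Cplx S} (g : L ⟶ L') :
    QuasiIso (homMap (𝟙 K) g) ↔
    (∀ (m n : ℤ), m + 1 = n → ∀ (y : Cochain K L' n), δ n (n + 1) y = 0 →
      ∃ (x : Cochain K L n) (w : Cochain K L' m), δ n (n + 1) x = 0 ∧
        y = x.comp (Cochain.ofHom g) (add_zero n) + δ m n w) ∧
    (∀ (m n : ℤ), m + 1 = n → ∀ (x : Cochain K L n) (w : Cochain K L' m), δ n (n + 1) x = 0 →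
      x.comp (Cochain.ofHom g) (add_zero n) = δ m n w → ∃ v : Cochain K L m, δ m n v = x) := by
  have e (m n : ℤ) : m + 1 = n ↔ m = n - 1 := by lia
  simp only [e, quasiIso_iff_elements, ← homMap_right_apply]
  constructor
  · intro h
    exact ⟨fun m n hm => by subst hm; exact h.1 n, fun m n hm => by subst hm; exact h.2 n⟩
  · intro h
    exact ⟨fun n => h.1 _ n rfl, fun n => h.2 _ n rfl⟩

/-- `Hom(-, L)` preserves quasi-isomorphisms if `L` is K-injective. -/
theorem homMap_quasiIso_left_of_isKInjective {K K' : Cplx S} (f : K' ⟶ K) [QuasiIso f]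
    (L : Cplx S) [L.IsKInjective] : QuasiIso (homMap f (𝟙 L)) := by
  -- `Hom(cone f, L)` is acyclic, and its cochains are pairs of cochains on `K'` and `K`
  have hC := homCplx_acyclic_of_acyclic_left (acyclic_mappingCone f) L
  have key (m n : ℤ) (hm : m + 1 = n) (w : Cochain (mappingCone f) L n) :
      ∃ (a : Cochain K' L m) (b : Cochain K L n), w = mappingCone.descCochain f a b hm := by
    refine ⟨(mappingCone.inl f).comp w (by lia),
      (Cochain.ofHom (mappingCone.inr f)).comp w (zero_add n), ?_⟩
    rw [mappingCone.ext_cochain_from_iff f m n (by lia)]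
    simp
  refine (quasiIso_homMap_left_iff f L).2
    ⟨fun m n hm z hz => ?_, fun m n hm x w hx hw => ?_⟩
  · obtain ⟨w, hw⟩ := exists_δ_eq hC (mappingCone.descCochain f z (0 : Cochain K L (n + 1)) rfl)
      rfl (by rw [mappingCone.δ_descCochain _ _ _ _ (n + 1 + 1) rfl, hz]; simp) n rfl
    obtain ⟨a, b, rfl⟩ := key m n hm w
    rw [mappingCone.δ_descCochain _ _ _ _ (n + 1) rfl,
      mappingCone.ext_cochain_from_iff f n (n + 1) rfl] at hw
    obtain ⟨h₁, h₂⟩ := hw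
    refine ⟨(n + 1).negOnePow • b, a, ?_, ?_⟩
    · have h₂ : δ n (n + 1) b = 0 := by simpa using h₂
      rw [δ_units_smul, h₂, smul_zero]
    · have h₁ : δ m n a + (n + 1).negOnePow • (Cochain.ofHom f).comp b (zero_add n) = z := by
        simpa using h₁
      rw [← h₁, Cochain.comp_units_smul, add_comm]
  · obtain ⟨u, hu⟩ := exists_δ_eq hC
      (mappingCone.descCochain f w (-(n + 1).negOnePow • x) hm) rfl (by
        rw [mappingCone.δ_descCochain _ _ _ _ (n + 1) rfl, δ_units_smul, hx, ← hw]
        simp [smul_smul]) m hm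
    obtain ⟨a, b, rfl⟩ := key (m - 1) m (by lia) u
    rw [mappingCone.δ_descCochain _ _ _ _ n hm,
      mappingCone.ext_cochain_from_iff f m n hm] at hu
    have h₂ : δ m n b = -(n + 1).negOnePow • x := by simpa using hu.2
    exact ⟨-(n + 1).negOnePow • b, by rw [δ_units_smul, h₂]; simp [smul_smul]⟩

theorem cocone_hom_ext {L L' : Cplx S} (g : L ⟶ L') {p q : ℤ} (hpq : p + -1 = q)
    {A : ModuleCat.{u} S} {a b : A ⟶ (mappingCocone g).X p}
    (h₁ : a ≫ (mappingCocone.fst g).f p = b ≫ (mappingCocone.fst g).f p)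
    (h₂ : a ≫ (mappingCocone.snd g).v p q hpq = b ≫ (mappingCocone.snd g).v p q hpq) : a = b := by
  rw [← Category.comp_id a, ← Category.comp_id b, ← mappingCocone.id_X g p q hpq,
    Preadditive.comp_add, Preadditive.comp_add, reassoc_of% h₁, reassoc_of% h₂]

theorem comp_inl_add_comp_inr {K L L' : Cplx S} (g : L ⟶ L') {m n : ℤ} (h : m + 1 = n)
    (α : Cochain K L n) (β : Cochain K L' m) :
    α.comp (mappingCocone.inl g) (add_zero n) + β.comp (mappingCocone.inr g).1 h =
      mappingCocone.liftCochain g α β h := by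
  refine Cochain.ext _ _ fun p q hpq => cocone_hom_ext g (show q + -1 = q - 1 by lia) ?_ ?_
  · simp [Cochain.comp_v β _ h p (q - 1) q (by lia) (by lia)]
  · simp [Cochain.comp_v β _ h p (q - 1) q (by lia) (by lia)]

/-- A cochain with values in a mapping cocone of `g : L ⟶ L'` is a pair of a cochain with values
in `L` and a cochain, of degree one less, with values in `L'`. -/
theorem cocone_cochain_eq_lift {K L L' : Cplx S} (g : L ⟶ L') {m n : ℤ} (h : m + 1 = n)
    (w : Cochain K (mappingCocone g) n) :
    ∃ (α : Cochain K L n) (β : Cochain K L' m), w = mappingCocone.liftCochain g α β h := by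
  refine ⟨w.comp (Cochain.ofHom (mappingCocone.fst g)) (add_zero n),
    w.comp (mappingCocone.snd g) (by lia), ?_⟩
  refine Cochain.ext _ _ fun p q hpq => cocone_hom_ext g (show q + -1 = q - 1 by lia) ?_ ?_
  · simp
  · simp [Cochain.comp_v _ _ _ p q _ hpq (show q + -1 = q - 1 by lia)]

theorem lift_eq_lift_iff {K L L' : Cplx S} (g : L ⟶ L') {m n : ℤ} (h : m + 1 = n)
    {α α' : Cochain K L n} {β β' : Cochain K L' m} :
    mappingCocone.liftCochain g α β h = mappingCocone.liftCochain g α' β' h ↔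
      α = α' ∧ β = β' := by
  constructor
  · intro e
    constructor
    · rw [← mappingCocone.liftCochain_comp_fst g α β h, e, mappingCocone.liftCochain_comp_fst]
    · rw [← mappingCocone.liftCochain_comp_snd g α β h, e, mappingCocone.liftCochain_comp_snd]
  · rintro ⟨rfl, rfl⟩
    rfl

theorem δ_cocone_lift {K L L' : Cplx S} (g : L ⟶ L') {m n n' : ℤ} (h : m + 1 = n)
    (h' : n + 1 = n') (α : Cochain K L n) (β : Cochain K L' m) :
    δ n n' (mappingCocone.liftCochain g α β h) = mappingCocone.liftCochain g (δ n n' α)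
      (-(δ m n β + α.comp (Cochain.ofHom g) (add_zero n))) h' := by
  rw [mappingCocone.δ_liftCochain g α β h n' h']
  rw [← comp_inl_add_comp_inr, Cochain.neg_comp, sub_eq_add_neg]

theorem cocone_zero_lift {K L L' : Cplx S} (g : L ⟶ L') {m n : ℤ} (h : m + 1 = n) :
    mappingCocone.liftCochain g (0 : Cochain K L n) (0 : Cochain K L' m) h = 0 := by
  obtain ⟨a, b, hab⟩ := cocone_cochain_eq_lift g h (0 : Cochain K (mappingCocone g) n)
  have h₁ := mappingCocone.liftCochain_comp_fst g a b h
  have h₂ := mappingCocone.liftCochain_comp_snd g a b h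
  rw [← hab, Cochain.zero_comp] at h₁ h₂
  rw [hab, ← h₁, ← h₂]

/-- The map `Hom(K, g)` is a quasi-isomorphism if and only if `Hom(K, cocone g)` is acyclic: the
latter is a cocone of the former. -/
theorem quasiIso_homMap_right_iff_acyclic_cocone (K : Cplx S) {L L' : Cplx S} (g : L ⟶ L') :
    QuasiIso (homMap (𝟙 K) g) ↔ (homCplx K (mappingCocone g)).Acyclic := by
  rw [quasiIso_homMap_right_iff, homCplx_acyclic_iff]
  constructor
  · rintro ⟨h₁, h₂⟩ n z hz
    obtain ⟨α, β, rfl⟩ := cocone_cochain_eq_lift g (show n - 1 + 1 = n by lia) z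
    rw [δ_cocone_lift _ _ rfl, ← cocone_zero_lift g rfl, lift_eq_lift_iff] at hz
    obtain ⟨hα, hβ⟩ := hz
    rw [neg_eq_zero] at hβ
    obtain ⟨v, rfl⟩ := h₂ (n - 1) n (by lia) α (-β) hα (by
      rw [δ_neg, eq_neg_iff_add_eq_zero, add_comm, hβ])
    obtain ⟨x, w, hx, hw⟩ := h₁ (n - 2) (n - 1) (by lia)
      (β + v.comp (Cochain.ofHom g) (add_zero _)) (by
        rw [δ_add, δ_comp_ofHom]
        have : n - 1 + 1 = n := by lia
        rw [this, hβ])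
    have hx' : δ (n - 1) n x = 0 := by
      have : n - 1 + 1 = n := by lia
      rwa [this] at hx
    refine ⟨mappingCocone.liftCochain g (v - x) (-w) (by lia), ?_⟩
    rw [δ_cocone_lift _ _ (by lia), lift_eq_lift_iff]
    refine ⟨by rw [δ_sub, hx', sub_zero], ?_⟩
    rw [δ_neg, Cochain.sub_comp, ← eq_sub_iff_add_eq] at *
    rw [hw]
    abel
  · intro h
    rw [← homCplx_acyclic_iff] at h
    refine ⟨fun m n hm z hz => ?_, fun m n hm x w hx hw => ?_⟩
    · obtain ⟨u, hu⟩ := exists_δ_eq h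
        (mappingCocone.liftCochain g (0 : Cochain K L (n + 1)) z rfl) rfl
        (by rw [δ_cocone_lift _ _ rfl, hz]; simp [cocone_zero_lift]) n rfl
      obtain ⟨α, β, rfl⟩ := cocone_cochain_eq_lift g hm u
      rw [δ_cocone_lift _ _ rfl, lift_eq_lift_iff] at hu
      obtain ⟨hα, hβ⟩ := hu
      refine ⟨-α, -β, by rw [δ_neg, hα, neg_zero], ?_⟩
      rw [← hβ, δ_neg, Cochain.neg_comp]
      abel
    · obtain ⟨u, hu⟩ := exists_δ_eq h (mappingCocone.liftCochain g x (-w) hm) rfl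
        (by rw [δ_cocone_lift _ _ rfl, hx, hw, δ_neg]; simp [cocone_zero_lift]) m hm
      obtain ⟨α, β, rfl⟩ := cocone_cochain_eq_lift g (show m - 1 + 1 = m by lia) u
      rw [δ_cocone_lift _ _ hm, lift_eq_lift_iff] at hu
      exact ⟨α, hu.1⟩

end HomComplexes

/-! ### The symmetry of `Hom(P, Hom(Q, C))` -/

section Swap
variable {S : Type u} [CommRing S]

theorem δ_apply {K L : Cplx S} {n m : ℤ} (hnm : n + 1 = m) (z : Cochain K L n) (p q : ℤ)
    (hpq : p + m = q) (q₁ p₁ : ℤ) (hq₁ : q₁ + 1 = q) (hp₁ : p + 1 = p₁) (x : K.X p) :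
    (δ n m z).v p q hpq x = L.d q₁ q (z.v p q₁ (by lia) x) +
      m.negOnePow • z.v p₁ q (by lia) (K.d p p₁ x) := by
  rw [δ_v n m hnm z p q hpq q₁ p₁ (by lia) (by lia)]
  rfl

/-- Evaluation of cochains of degree `r` at an element of degree `q`. -/
noncomputable def evalAt {Q : Cplx S} (C : Cplx S) {q : ℤ} (y : Q.X q) (r s : ℤ) (h : q + r = s) :
    (homCplx Q C).X r →ₗ[S] C.X s where
  toFun z := (show Cochain Q C r from z).v q s h y
  map_add' _ _ := rfl
  map_smul' _ _ := rfl

/-- The value at `x` and `y` of a cochain with values in a Hom complex. -/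
noncomputable def eval₂ {P Q C : Cplx S} {n : ℤ} (z : Cochain P (homCplx Q C) n) (p q s : ℤ)
    (h : p + q + n = s) : P.X p →ₗ[S] Q.X q →ₗ[S] C.X s :=
  LinearMap.mk₂ S (fun x y => evalAt C y (p + n) s (by lia) (z.v p (p + n) rfl x))
    (fun x x' y => by rw [map_add, map_add]) (fun a x y => by rw [map_smul, map_smul])
    (fun x y y' => map_add ((show Cochain Q C (p + n) from z.v p (p + n) rfl x).v q s _).hom y y')
    (fun a x y => map_smul ((show Cochain Q C (p + n) from z.v p (p + n) rfl x).v q s _).hom a y)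

theorem eval₂_eq {P Q C : Cplx S} {n : ℤ} (z : Cochain P (homCplx Q C) n) (p q s : ℤ)
    (h : p + q + n = s) (x : P.X p) (y : Q.X q) (r : ℤ) (hr : p + n = r) :
    evalAt C y r s (by lia) (z.v p r hr x) = eval₂ z p q s h x y := by
  subst hr
  rfl

theorem eval₂_ext {P Q C : Cplx S} {n : ℤ} {z z' : Cochain P (homCplx Q C) n}
    (h : ∀ (p q s : ℤ) (h : p + q + n = s) (x : P.X p) (y : Q.X q),
      eval₂ z p q s h x y = eval₂ z' p q s h x y) : z = z' := by
  refine Cochain.ext _ _ fun p r hpr => ?_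
  apply ConcreteCategory.hom_ext
  intro x
  refine Cochain.ext (F := Q) (G := C) _ _ fun q s hqs => ?_
  apply ConcreteCategory.hom_ext
  intro y
  exact (eval₂_eq z p q s (by lia) x y r hpr).trans
    ((h p q s (by lia) x y).trans (eval₂_eq z' p q s (by lia) x y r hpr).symm)

/-- The differential of `Hom(P, Hom(Q, C))` in terms of bilinear maps. -/
theorem eval₂_δ {P Q C : Cplx S} {n m : ℤ} (hnm : n + 1 = m) (z : Cochain P (homCplx Q C) n)
    (p q s : ℤ) (h : p + q + m = s) (s₁ : ℤ) (hs₁ : s₁ + 1 = s) (x : P.X p) (y : Q.X q) :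
    eval₂ (δ n m z) p q s h x y = C.d s₁ s (eval₂ z p q s₁ (by lia) x y) +
      (p + m).negOnePow • eval₂ z p (q + 1) s (by lia) x (Q.d q (q + 1) y) +
      m.negOnePow • eval₂ z (p + 1) q s (by lia) (P.d p (p + 1) x) y := by
  have h₁ := δ_apply hnm z p (p + m) rfl (p + n) (p + 1) (by lia) rfl x
  have h₂ := δ_apply (K := Q) (L := C) (show p + n + 1 = p + m by lia) (z.v p (p + n) rfl x) q s
    (by lia) s₁ (q + 1) hs₁ rfl y
  rw [← eval₂_eq _ _ _ _ _ _ _ (p + m) rfl, h₁, map_add, Units.smul_def, Units.smul_def,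
    Units.smul_def, map_zsmul, eval₂_eq z (p + 1) q s (by lia) (P.d p (p + 1) x) y]
  congr 1

/-- The exchange of the two variables of a `C`-valued bilinear map on `P × Q`, with the Koszul
sign `(-1) ^ (p * q)`. -/
noncomputable def swapCochain {P Q C : Cplx S} {n : ℤ} (z : Cochain P (homCplx Q C) n) :
    Cochain Q (homCplx P C) n :=
  Cochain.mk fun q r hqr => ModuleCat.ofHom (Y := ModuleCat.of S (Cochain P C r))
    { toFun := fun y => Cochain.mk fun p s hps => ModuleCat.ofHom
        ((p * q).negOnePow • (eval₂ z p q s (by lia)).flip y)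
      map_add' := fun y y' => by
        refine Cochain.ext _ _ fun p s hps => ?_
        ext x
        change (p * q).negOnePow • (eval₂ z p q s (by lia) x (y + y')) = (p * q).negOnePow •
          (eval₂ z p q s (by lia) x y) + (p * q).negOnePow • (eval₂ z p q s (by lia) x y')
        rw [map_add, smul_add]
      map_smul' := fun a y => by
        refine Cochain.ext _ _ fun p s hps => ?_
        ext x
        change (p * q).negOnePow • (eval₂ z p q s (by lia) x (a • y)) = a • (p * q).negOnePow •
          (eval₂ z p q s (by lia) x y)
        rw [map_smul, smul_comm] }

theorem eval₂_swapCochain {P Q C : Cplx S} {n : ℤ} (z : Cochain P (homCplx Q C) n) (p q s : ℤ)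
    (h : q + p + n = s) (x : P.X p) (y : Q.X q) : eval₂ (swapCochain z) q p s h y x =
      (p * q).negOnePow • eval₂ z p q s (by lia) x y := rfl

theorem swapCochain_swapCochain {P Q C : Cplx S} {n : ℤ} (z : Cochain P (homCplx Q C) n) :
    swapCochain (swapCochain z) = z := by
  refine eval₂_ext fun p q s h x y => ?_
  rw [eval₂_swapCochain, eval₂_swapCochain _ _ _ _ (by lia), smul_smul, mul_comm q p,
    Int.units_mul_self, one_smul]

theorem δ_swapCochain {P Q C : Cplx S} {n m : ℤ} (hnm : n + 1 = m)
    (z : Cochain P (homCplx Q C) n) : δ n m (swapCochain z) = swapCochain (δ n m z) := by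
  refine eval₂_ext fun q p s h y x => ?_
  rw [eval₂_δ hnm _ q p s h (s - 1) (by lia), eval₂_swapCochain, eval₂_swapCochain,
    eval₂_swapCochain, eval₂_swapCochain, eval₂_δ hnm _ p q s (by lia) (s - 1) (by lia),
    smul_add, smul_add, smul_smul, smul_smul, smul_smul, smul_smul, ← Int.negOnePow_add,
    ← Int.negOnePow_add, ← Int.negOnePow_add, ← Int.negOnePow_add]
  -- the signs on the two sides agree
  rw [show q + m + (p + 1) * q = p * q + m + 2 * q by ring,
    show m + p * (q + 1) = p * q + (p + m) by ring,
    Int.negOnePow_add _ (2 * q), Int.negOnePow_two_mul, mul_one]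
  rw [show ((p * q).negOnePow • (C.d (s - 1) s) (eval₂ z p q (s - 1) (by lia) x y)) =
    C.d (s - 1) s ((p * q).negOnePow • (eval₂ z p q (s - 1) (by lia) x y)) by
      rw [Units.smul_def, Units.smul_def, map_zsmul]]
  abel

variable (P Q C : Cplx S) in
/-- The exchange of the two variables as a morphism of complexes. -/
noncomputable def swapHom : homCplx P (homCplx Q C) ⟶ homCplx Q (homCplx P C) where
  f n := ModuleCat.ofHom
    { toFun := fun z => swapCochain z
      map_add' := fun z z' => eval₂_ext fun q p s h y x => smul_add (p * q).negOnePow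
        (eval₂ z p q s (by lia) x y) (eval₂ z' p q s (by lia) x y)
      map_smul' := fun a z => eval₂_ext fun q p s h y x =>
        smul_comm (p * q).negOnePow a (eval₂ z p q s (by lia) x y) }
  comm' i j hij := by
    apply ConcreteCategory.hom_ext
    intro z
    exact δ_swapCochain hij z

variable (P Q C : Cplx S) in
/-- The symmetry isomorphism `Hom(P, Hom(Q, C)) ≅ Hom(Q, Hom(P, C))`. -/
noncomputable def swapIso : homCplx P (homCplx Q C) ≅ homCplx Q (homCplx P C) where
  hom := swapHom P Q C
  inv := swapHom Q P C
  hom_inv_id := by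
    ext n : 1
    apply ConcreteCategory.hom_ext
    intro z
    rw [comp_f, ConcreteCategory.comp_apply]
    exact swapCochain_swapCochain z
  inv_hom_id := by
    ext n : 1
    apply ConcreteCategory.hom_ext
    intro z
    rw [comp_f, ConcreteCategory.comp_apply]
    exact swapCochain_swapCochain z

theorem evalAt_homMap {Q C C' : Cplx S} (g : C ⟶ C') {q : ℤ} (y : Q.X q) (r s : ℤ)
    (h : q + r = s) (w : Cochain Q C r) : evalAt C' y r s h ((homMap (𝟙 Q) g).f r w) =
      g.f s (evalAt C y r s h w) := by
  rw [homMap_right_apply]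
  change (w.comp (Cochain.ofHom g) (add_zero r)).v q s h y = _
  rw [Cochain.comp_zero_cochain_v, Cochain.ofHom_v, ConcreteCategory.comp_apply]
  rfl

theorem swapHom_naturality (P Q : Cplx S) {C C' : Cplx S} (g : C ⟶ C') :
    homMap (𝟙 P) (homMap (𝟙 Q) g) ≫ swapHom P Q C' =
      swapHom P Q C ≫ homMap (𝟙 Q) (homMap (𝟙 P) g) := by
  have key (P Q : Cplx S) (n : ℤ) (z : Cochain P (homCplx Q C) n) (p q s : ℤ) (h) (x : P.X p)
      (y : Q.X q) : eval₂ (show Cochain P (homCplx Q C') n from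
        (homMap (𝟙 P) (homMap (𝟙 Q) g)).f n z) p q s h x y = g.f s (eval₂ z p q s h x y) := by
    rw [homMap_right_apply]
    change evalAt C' y (p + n) s (by lia) ((z.comp (Cochain.ofHom (homMap (𝟙 Q) g)) (add_zero n)).v p (p + n)
      rfl x) = _
    rw [Cochain.comp_zero_cochain_v, Cochain.ofHom_v, ConcreteCategory.comp_apply]
    exact evalAt_homMap g y (p + n) s (by lia) (z.v p (p + n) rfl x)
  ext n : 1
  apply ConcreteCategory.hom_ext
  intro z
  rw [comp_f, comp_f, ConcreteCategory.comp_apply, ConcreteCategory.comp_apply]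
  change Cochain P (homCplx Q C) n at z
  refine eval₂_ext fun q p s h y x => ?_
  refine Eq.trans ?_ (key Q P n (swapCochain z) q p s h y x).symm
  refine (congrArg ((p * q).negOnePow • ·) (key P Q n z p q s (by lia) x y)).trans ?_
  refine Eq.trans ?_ (congrArg (g.f s) (eval₂_swapCochain z p q s h x y)).symm
  rw [Units.smul_def, Units.smul_def, map_zsmul]

/-- If `g` induces a quasi-isomorphism on `Hom(P, -)`, then `Hom(Q, g)` does so too, for K-projective
`Q`: by symmetry the map in question is `Hom(Q, -)` of the given quasi-isomorphism. -/
theorem homMap_homMap_quasiIso (P Q : Cplx S) [Q.IsKProjective] {C C' : Cplx S} (g : C ⟶ C')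
    [QuasiIso (homMap (𝟙 P) g)] : QuasiIso (homMap (𝟙 P) (homMap (𝟙 Q) g)) := by
  have : QuasiIso (homMap (𝟙 P) (homMap (𝟙 Q) g) ≫ (swapIso P Q C').hom) := by
    change QuasiIso (_ ≫ swapHom P Q C')
    rw [swapHom_naturality]
    have := homMap_quasiIso_right Q (homMap (𝟙 P) g)
    have : IsIso (swapHom P Q C) := (swapIso P Q C).isIso_hom
    infer_instance
  exact quasiIso_of_comp_right _ (swapIso P Q C').hom

theorem acyclic_of_iso {K L : Cplx S} (e : K ≅ L) (hK : K.Acyclic) : L.Acyclic :=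
  fun n => (exactAt_iff_of_quasiIsoAt e.hom n).1 (hK n)

/-- If `P` is K-projective and `C` is K-injective then `Hom(P, C)` is K-injective, as `Hom(K, Hom(P, C))`
is isomorphic to `Hom(P, Hom(K, C))`. -/
theorem isKInjective_homCplx (P C : Cplx S) [P.IsKProjective] [C.IsKInjective] :
    (homCplx P C).IsKInjective :=
  isKInjective_of_homCplx_acyclic fun K hK => acyclic_of_iso (swapIso P K C)
    (homCplx_acyclic_of_isKProjective P (homCplx_acyclic_of_acyclic_left hK C))

end Swap

/-! ### The `k`-dual as `Hom(-, Hom_k(S, k))`, and the dual of a tensor product -/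

section DualHom
variable (k : Type u) {S : Type u} [Field k] [CommRing S] [Algebra k S]

theorem dualCplx_d_apply (M : Cplx S) (i j : ℤ) (φ : LinDual k (M.X (-i))) (x : M.X (-j)) :
    (show LinDual k (M.X (-j)) from ((dualCplx k S).obj (op M)).d i j φ) x =
      φ (M.d (-j) (-i) x) := rfl

theorem dualCplx_map_apply {M N : Cplx S} (f : M ⟶ N) (i : ℤ) (φ : LinDual k (N.X (-i)))
    (x : M.X (-i)) :
    (show LinDual k (M.X (-i)) from ((dualCplx k S).map f.op).f i φ) x = φ (f.f (-i) x) := rfl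

variable (S) in
/-- The module `Hom_k(S, k)`, placed in degree `0`. -/
noncomputable abbrev dualizer : Cplx S :=
  (CochainComplex.singleFunctor (ModuleCat.{u} S) 0).obj ((linDual k S).obj (op (ModuleCat.of S S)))

/-- The bijection `Hom_k(M, k) = Hom_S(M, Hom_k(S, k))`. -/
noncomputable def LinDual.curry {M : ModuleCat.{u} S} (φ : LinDual k M) :
    M ⟶ (linDual k S).obj (op (ModuleCat.of S S)) :=
  ModuleCat.ofHom (Y := ModuleCat.of S (LinDual k (ModuleCat.of S S)))
    { toFun := fun y => LinDual.mk (fun s : S => φ (s • y))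
        (fun s t => by rw [add_smul, LinDual.map_add])
        (fun a s => by rw [smul_eq_mul, mul_smul, LinDual.map_algebraMap_smul])
      map_add' := fun y y' => by
        apply LinDual.ext
        intro s
        change φ ((show S from s) • (y + y')) = φ ((show S from s) • y) + φ ((show S from s) • y')
        rw [smul_add, LinDual.map_add]
      map_smul' := fun a y => by
        apply LinDual.ext
        intro s
        change φ ((show S from s) • a • y) = φ ((a • (show S from s)) • y)
        rw [smul_smul, mul_comm, smul_eq_mul] }

/-- The transpose of a linear map. -/
noncomputable def LinDual.precomp {M N : ModuleCat.{u} S} (f : M ⟶ N) (φ : LinDual k N) :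
    LinDual k M :=
  (linDual k S).map f.op φ

theorem LinDual.curry_precomp {M N : ModuleCat.{u} S} (f : M ⟶ N) (φ : LinDual k N) :
    (φ.precomp k f).curry k = f ≫ φ.curry k := by
  ext y
  apply LinDual.ext
  intro s
  exact congrArg φ (map_smul f.hom (show S from s) y)

theorem toSingleMk_smul {K : Cplx S} {X : ModuleCat.{u} S} {p q n : ℤ} (a : S) (f : K.X p ⟶ X)
    (h : p + n = q) :
    Cochain.toSingleMk (a • f) h = a • Cochain.toSingleMk f h := by
  apply (Cochain.toSingleEquiv h).injective
  simp only [Cochain.toSingleEquiv, Cochain.toSingleMk_v, AddEquiv.coe_mk, Equiv.coe_fn_mk,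
    Cochain.smul_v, Linear.smul_comp]
  rfl

theorem fromSingleMk_smul {K : Cplx S} {X : ModuleCat.{u} S} {p q n : ℤ} (a : S) (f : X ⟶ K.X q)
    (h : p + n = q) :
    Cochain.fromSingleMk (a • f) h = a • Cochain.fromSingleMk f h := by
  apply (Cochain.fromSingleEquiv h).injective
  simp only [Cochain.fromSingleEquiv, Cochain.fromSingleMk_v, AddEquiv.coe_mk, Equiv.coe_fn_mk,
    Cochain.smul_v, Iso.inv_hom_id_assoc]
  exact (Iso.inv_hom_id_assoc (singleObjXSelf (ComplexShape.up ℤ) p X) (a • f)).symm.trans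
    (by rw [Linear.comp_smul]; rfl)

/-- The sign `(-1) ^ (n * (n + 1) / 2)`. The differential of the dual complex is the transpose,
without a sign, while the differential of the Hom complex carries a sign in each degree; the ratio
of consecutive values of `triangularSign` makes up for the difference. -/
def triangularSign (n : ℤ) : ℤˣ := (n * (n + 1) / 2).negOnePow

theorem triangularSign_succ (n : ℤ) :
    triangularSign (n + 1) = (n + 1).negOnePow * triangularSign n := by
  rw [triangularSign, triangularSign, ← Int.negOnePow_add,
    show (n + 1) * (n + 1 + 1) = n * (n + 1) + (n + 1) * 2 by ring,
    Int.add_mul_ediv_right _ _ two_ne_zero, add_comm]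

/-- The comparison of the `k`-dual of `Y` with the complex `Hom(Y, Hom_k(S, k))`. -/
noncomputable def dualToHom (Y : Cplx S) :
    (dualCplx k S).obj (op Y) ⟶ homCplx Y (dualizer k S) where
  f n := ModuleCat.ofHom (X := ModuleCat.of S (LinDual k (Y.X (-n))))
    { toFun := fun φ => triangularSign n • Cochain.toSingleMk (φ.curry k) (neg_add_cancel n)
      map_add' := fun φ ψ => by
        rw [← smul_add, ← Cochain.toSingleMk_add]
        rfl
      map_smul' := fun a φ => by
        rw [RingHom.id_apply, smul_comm, ← toSingleMk_smul]
        congr 2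
        ext y
        apply LinDual.ext
        intro s
        change φ (a • (show S from s) • y) = φ ((a • (show S from s)) • y)
        rw [smul_smul, smul_eq_mul] }
  comm' i j hij := by
    obtain rfl : i + 1 = j := hij
    apply ConcreteCategory.hom_ext
    intro φ
    change LinDual k (Y.X (-i)) at φ
    change δ i (i + 1) (triangularSign i • Cochain.toSingleMk (φ.curry k)
      (neg_add_cancel i)) = triangularSign (i + 1) • Cochain.toSingleMk
        ((φ.precomp k (Y.d (-(i + 1)) (-i))).curry k) (neg_add_cancel (i + 1))
    rw [δ_units_smul, Cochain.δ_toSingleMk _ _ (i + 1) (-(i + 1)) (by lia), smul_smul,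
      triangularSign_succ, mul_comm, LinDual.curry_precomp]

instance isIso_dualToHom (Y : Cplx S) : IsIso (dualToHom k Y) := by
  have (n : ℤ) : IsIso ((dualToHom k Y).f n) := by
    rw [ConcreteCategory.isIso_iff_bijective]
    constructor
    · rw [injective_iff_map_eq_zero]
      intro φ hφ
      have hφ : triangularSign n • Cochain.toSingleMk (LinDual.curry k φ) (neg_add_cancel n) = 0 := hφ
      rw [smul_eq_zero_iff_eq, ← Cochain.toSingleMk_zero _ _ _ _ _ (neg_add_cancel n)] at hφ
      have h := (Cochain.toSingleEquiv (neg_add_cancel n)).symm.injective hφ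
      apply LinDual.ext
      intro y
      have := DFunLike.congr_fun (F := LinDual k (ModuleCat.of S S)) (ConcreteCategory.congr_hom h y) (1 : S)
      rw [← one_smul S y]
      exact this
    · intro (z : Cochain Y (dualizer k S) n)
      obtain ⟨f, hf⟩ := Cochain.toSingleMk_surjective (triangularSign n • z) (-n) (neg_add_cancel n)
      let φ : LinDual k (Y.X (-n)) := LinDual.mk
        (fun y => (show LinDual k (ModuleCat.of S S) from f y) (1 : S))
        (fun y y' => by rw [map_add]; rfl)
        (fun a y => by
          rw [map_smul]
          exact (LinDual.map_algebraMap_smul (show LinDual k (ModuleCat.of S S) from f y) a (1 : S)))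
      have hφ : LinDual.curry k φ = f := by
        ext y
        apply LinDual.ext
        intro s
        change (show LinDual k (ModuleCat.of S S) from f ((show S from s) • y)) (1 : S) = _
        rw [map_smul]
        change (show LinDual k (ModuleCat.of S S) from f y) ((show S from s) • (1 : S)) = _
        rw [smul_eq_mul, mul_one]
      refine ⟨φ, ?_⟩
      change triangularSign n • Cochain.toSingleMk (LinDual.curry k φ) (neg_add_cancel n) = z
      rw [hφ, hf, smul_smul, Int.units_mul_self, one_smul]
  exact HomologicalComplex.Hom.isIso_of_components _

theorem dualToHom_naturality {Y Y' : Cplx S} (f : Y ⟶ Y') :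
    (dualCplx k S).map f.op ≫ dualToHom k Y = dualToHom k Y' ≫ homMap f (𝟙 _) := by
  ext n : 1
  apply ConcreteCategory.hom_ext
  intro φ
  rw [comp_f, comp_f, ConcreteCategory.comp_apply, ConcreteCategory.comp_apply]
  refine Eq.trans ?_ (homMap_left_apply f _ n _).symm
  change LinDual k (Y'.X (-n)) at φ
  change triangularSign n • Cochain.toSingleMk ((φ.precomp k (f.f (-n))).curry k)
    (neg_add_cancel n) = (Cochain.ofHom f).comp
      (triangularSign n • Cochain.toSingleMk (φ.curry k) (neg_add_cancel n)) _
  rw [Cochain.comp_units_smul, ← Cochain.toSingleMk_precomp, LinDual.curry_precomp]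

variable (S) in
/-- The comparison of the `k`-dual with `Hom(-, Hom_k(S, k))`. -/
noncomputable def dualIsoHom : dualCplx k S ≅ (homFunctor S).flip.obj (dualizer k S) :=
  NatIso.ofComponents (fun Y => @asIso _ _ _ _ (dualToHom k Y.unop) (isIso_dualToHom k Y.unop))
    (fun f => dualToHom_naturality k f.unop)

end DualHom

section DualTensor
open MonoidalCategory
variable (k : Type u) {S : Type u} [Field k] [CommRing S] [Algebra k S]

/-- The transpose `Hom_k(X ⊗ A, k) → Hom_S(A, Hom_k(X, k))`. -/
noncomputable def tensorTranspose {X A : ModuleCat.{u} S} (ψ : LinDual k (X ⊗ A)) :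
    A ⟶ (linDual k S).obj (op X) :=
  ModuleCat.ofHom (Y := ModuleCat.of S (LinDual k X))
    { toFun := fun a => LinDual.mk (fun x => ψ (x ⊗ₜ[S] a))
        (fun x x' => by rw [TensorProduct.add_tmul]; exact LinDual.map_add ψ _ _)
        (fun c x => by
          rw [← TensorProduct.smul_tmul']
          exact LinDual.map_algebraMap_smul ψ c _)
      map_add' := fun a a' => by
        apply LinDual.ext
        intro x
        exact (congrArg ψ (TensorProduct.tmul_add x a a')).trans (LinDual.map_add ψ _ _)
      map_smul' := fun s a => by
        apply LinDual.ext
        intro x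
        exact congrArg ψ (TensorProduct.smul_tmul s x a).symm }

theorem tensor_addHom_ext {S : Type u} [CommRing S] {X A : ModuleCat.{u} S} {f g : TensorProduct S X A →+ k}
    (h : ∀ x a, f (x ⊗ₜ[S] a) = g (x ⊗ₜ[S] a)) : f = g := by
  ext t
  induction t with
  | zero => rw [map_zero, map_zero]
  | tmul x a => exact h x a
  | add t t' ht ht' => rw [map_add, map_add, ht, ht']

theorem tensorTranspose_bijective (X A : ModuleCat.{u} S) :
    Function.Bijective (tensorTranspose k : LinDual k (X ⊗ A) → _) := by
  constructor
  · intro ψ ψ' h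
    let f (ψ : LinDual k (X ⊗ A)) : TensorProduct S X A →+ k :=
      { toFun := ψ, map_zero' := LinDual.map_zero ψ, map_add' := LinDual.map_add ψ }
    have : f ψ = f ψ' := tensor_addHom_ext k fun x a =>
      DFunLike.congr_fun (F := LinDual k X) (ConcreteCategory.congr_hom h a) x
    apply LinDual.ext
    exact fun m => DFunLike.congr_fun this m
  · intro f
    let g : X →+ A →+ k :=
      AddMonoidHom.mk' (fun x => AddMonoidHom.mk' (fun a => (show LinDual k X from f a) x)
        (fun a a' => by rw [map_add]; rfl)) (fun x x' => by
          ext a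
          exact LinDual.map_add (show LinDual k X from f a) x x')
    let ψ : TensorProduct S X A →+ k := TensorProduct.liftAddHom g (fun s x a => by
      exact (DFunLike.congr_fun (F := LinDual k X) (map_smul f.hom s a) x).symm)
    have hψ (x : X) (a : A) : ψ (x ⊗ₜ[S] a) = (show LinDual k X from f a) x :=
      TensorProduct.liftAddHom_tmul _ _ _ _
    refine ⟨LinDual.mk (M := X ⊗ A) ψ ψ.map_add (fun c m => ?_), ?_⟩
    · have : ψ.comp (DistribSMul.toAddMonoidHom (TensorProduct S X A) (algebraMap k S c)) =
          (AddMonoidHom.mulLeft c).comp ψ := by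
        refine tensor_addHom_ext k fun x a => ?_
        change ψ (algebraMap k S c • (x ⊗ₜ[S] a)) = c * ψ (x ⊗ₜ[S] a)
        rw [TensorProduct.smul_tmul', hψ, hψ]
        exact LinDual.map_algebraMap_smul (show LinDual k X from f a) c x
      exact DFunLike.congr_fun this m
    · ext a
      apply LinDual.ext
      intro x
      exact hψ x a

/-- The transpose of a functional, with values in a term of the dual complex. -/
noncomputable def transposeX {A : ModuleCat.{u} S} {N : Cplx S} {n : ℤ}
    (ψ : LinDual k (N.X (-n) ⊗ A)) : A ⟶ ((dualCplx k S).obj (op N)).X n :=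
  tensorTranspose k ψ

theorem transposeX_add {A : ModuleCat.{u} S} {N : Cplx S} {n : ℤ}
    (ψ ψ' : LinDual k (N.X (-n) ⊗ A)) : transposeX k (ψ + ψ') = transposeX k ψ + transposeX k ψ' :=
  rfl

theorem transposeX_smul {A : ModuleCat.{u} S} {N : Cplx S} {n : ℤ} (s : S)
    (ψ : LinDual k (N.X (-n) ⊗ A)) : transposeX k (s • ψ) = s • transposeX k ψ := by
  ext a
  apply LinDual.ext
  intro x
  rfl

theorem transposeX_d {A : ModuleCat.{u} S} {N : Cplx S} {i j : ℤ}
    (ψ : LinDual k (N.X (-i) ⊗ A)) : transposeX k ψ ≫ ((dualCplx k S).obj (op N)).d i j =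
      transposeX k (ψ.precomp k (N.d (-j) (-i) ▷ A)) := rfl

theorem transposeX_naturality {A A' : ModuleCat.{u} S} (a : A ⟶ A') {N N' : Cplx S}
    (f : N ⟶ N') {n : ℤ} (ψ : LinDual k (N'.X (-n) ⊗ A')) :
    a ≫ transposeX k ψ ≫ ((dualCplx k S).map f.op).f n =
      transposeX k (ψ.precomp k (N.X (-n) ◁ a ≫ f.f (-n) ▷ A')) := rfl

/-- The comparison of `(N ⊗ A)^∨` with `Hom(A, N^∨)`. -/
noncomputable def dualTensorToHom (A : ModuleCat.{u} S) (N : Cplx S) :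
    (dualCplx k S).obj (op (((tensorCplx S).obj A).obj N)) ⟶
      homCplx ((single (ModuleCat.{u} S) (ComplexShape.up ℤ) 0).obj A)
        ((dualCplx k S).obj (op N)) where
  f n := ModuleCat.ofHom (X := ModuleCat.of S (LinDual k (N.X (-n) ⊗ A)))
    (Y := ModuleCat.of S (Cochain ((single (ModuleCat.{u} S) (ComplexShape.up ℤ) 0).obj A)
      ((dualCplx k S).obj (op N)) n))
    { toFun := fun ψ => Cochain.fromSingleMk (transposeX k ψ) (zero_add n)
      map_add' := fun ψ ψ' => by
        rw [transposeX_add, Cochain.fromSingleMk_add]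
        rfl
      map_smul' := fun s ψ => by
        exact (congrArg (Cochain.fromSingleMk · (zero_add n)) (transposeX_smul k s ψ)).trans
          (fromSingleMk_smul s (transposeX k ψ) (zero_add n)) }
  comm' i j hij := by
    obtain rfl : i + 1 = j := hij
    apply ConcreteCategory.hom_ext
    intro ψ
    change LinDual k (N.X (-i) ⊗ A) at ψ
    change δ i (i + 1) (Cochain.fromSingleMk (transposeX k ψ) (zero_add i)) =
      Cochain.fromSingleMk (transposeX k (ψ.precomp k (N.d (-(i + 1)) (-i) ▷ A)))
        (zero_add (i + 1))
    rw [Cochain.δ_fromSingleMk _ _ (i + 1) (i + 1) (by lia), transposeX_d]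

instance isIso_dualTensorToHom (A : ModuleCat.{u} S) (N : Cplx S) :
    IsIso (dualTensorToHom k A N) := by
  have (n : ℤ) : IsIso ((dualTensorToHom k A N).f n) := by
    rw [ConcreteCategory.isIso_iff_bijective]
    exact (Cochain.fromSingleEquiv (K := (dualCplx k S).obj (op N)) (X := A)
      (zero_add n)).symm.bijective.comp (tensorTranspose_bijective k (N.X (-n)) A)
  exact HomologicalComplex.Hom.isIso_of_components _

theorem dualTensorToHom_naturality {A A' : ModuleCat.{u} S} (a : A ⟶ A') {N N' : Cplx S}
    (f : N ⟶ N') :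
    (dualCplx k S).map (((tensorCplx S).map a).app N ≫ ((tensorCplx S).obj A').map f).op ≫
      dualTensorToHom k A N = dualTensorToHom k A' N' ≫
        homMap ((single (ModuleCat.{u} S) (ComplexShape.up ℤ) 0).map a)
          ((dualCplx k S).map f.op) := by
  ext n : 1
  apply ConcreteCategory.hom_ext
  intro ψ
  rw [comp_f, comp_f, ConcreteCategory.comp_apply, ConcreteCategory.comp_apply]
  change LinDual k (N'.X (-n) ⊗ A') at ψ
  change Cochain.fromSingleMk (transposeX k (ψ.precomp k (N.X (-n) ◁ a ≫ f.f (-n) ▷ A')))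
    (zero_add n) = cochainMap ((singleFunctor (ModuleCat.{u} S) 0).map a)
      ((dualCplx k S).map f.op) n (Cochain.fromSingleMk (transposeX k ψ) (zero_add n))
  rw [cochainMap_apply, ← Cochain.fromSingleMk_postcomp, ← Cochain.fromSingleMk_precomp,
    transposeX_naturality]

variable (S) in
/-- The isomorphism `(N ⊗ A)^∨ ≅ Hom(A, N^∨)`, natural in the module `A` and the complex `N`. -/
noncomputable def dualTensorIso : (tensorCplx S).op ⋙ Functor.opHom _ _ ⋙
      (Functor.whiskeringRight _ _ _).obj (dualCplx k S) ≅
    (single (ModuleCat.{u} S) (ComplexShape.up ℤ) 0).op ⋙ homFunctor S ⋙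
      (Functor.whiskeringLeft _ _ _).obj (dualCplx k S) :=
  NatIso.ofComponents (fun A => NatIso.ofComponents
      (fun N => @asIso _ _ _ _ (dualTensorToHom k A.unop N.unop) (isIso_dualTensorToHom k _ _))
      (fun f => by
        have := dualTensorToHom_naturality k (𝟙 A.unop) f.unop
        rw [CategoryTheory.Functor.map_id, CategoryTheory.Functor.map_id, NatTrans.id_app, Category.id_comp] at this
        exact this))
    (fun a => by
      ext N : 2
      have := dualTensorToHom_naturality k a.unop (𝟙 N.unop)
      rw [CategoryTheory.Functor.map_id, op_id, CategoryTheory.Functor.map_id, Category.comp_id] at this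
      exact this)

end DualTensor

/-! ### Resolutions are termwise projective -/

section TermwiseProjective
open scoped ZeroObject
variable {S : Type u} [CommRing S]

/-- The morphisms with the right lifting property against the generating cofibrations are
termwise surjective: given `y`, first lift the cocycle `d y`, then `y` itself. -/
theorem surjective_of_rlp {X Y : Cplx S} (p : X ⟶ Y) (hp : (genCof S).rlp p) (n : ℤ) :
    Function.Surjective (p.f n) := by
  have key : ∀ (n m : ℤ), n + 1 = m → ∀ (x : X.X m) (y : Y.X n), X.d m (m + 1) x = 0 →
      p.f m x = Y.d n m y → ∃ z : X.X n, X.d n m z = x ∧ p.f n z = y := by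
    rintro n m rfl
    exact (mem_rlp_iff p).1 hp n
  intro y
  obtain ⟨x, hx, hxy⟩ := key (n + 1) (n + 1 + 1) rfl 0 (Y.d n (n + 1) y) (by simp)
    (by rw [map_zero, d_sq])
  obtain ⟨z, -, hz⟩ := key n (n + 1) rfl x y hx hxy
  exact ⟨z, hz⟩

theorem resπ_surjective (M : Cplx S) (n : ℤ) : Function.Surjective (((resπ S).app M).f n) :=
  surjective_of_rlp _ ((factorization S).hp (Arrow.mk (0 : 0 ⟶ M))) n

theorem mappingCone_map_surjective {K L : Cplx S} (f : K ⟶ L)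
    (hf : ∀ n, Function.Surjective (f.f n)) (n : ℤ) : Function.Surjective
      ((mappingCone.map (𝟙 K) (𝟙 L) f f (by simp)).f n) := by
  intro y
  have hy := ConcreteCategory.congr_hom (mappingCone.id_X (𝟙 L) n (n + 1) rfl) y
  obtain ⟨a, ha⟩ := hf (n + 1) ((mappingCone.fst (𝟙 L)).1.v n (n + 1) rfl y)
  obtain ⟨b, hb⟩ := hf n ((mappingCone.snd (𝟙 L)).v n n (add_zero n) y)
  refine ⟨(mappingCone.inl (𝟙 K)).v (n + 1) n (by lia) a + (mappingCone.inr (𝟙 K)).f n b, ?_⟩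
  have e₁ := ConcreteCategory.congr_hom (mappingCone.inl_v_desc_f (𝟙 K)
    ((Cochain.ofHom f).comp (mappingCone.inl (𝟙 L)) (zero_add _)) (f ≫ mappingCone.inr (𝟙 L))
    (by simp) (n + 1) n (by lia)) a
  have e₂ := ConcreteCategory.congr_hom (mappingCone.inr_f_desc_f (𝟙 K)
    ((Cochain.ofHom f).comp (mappingCone.inl (𝟙 L)) (zero_add _)) (f ≫ mappingCone.inr (𝟙 L))
    (by simp) n) b
  rw [map_add]
  refine (congr_arg₂ (· + ·) e₁ e₂).trans (Eq.trans ?_ hy)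
  simp [ha, hb]

/-- A complex with the left lifting property against acyclic fibrations is termwise projective:
lift a map into a contractible two-term complex. -/
theorem projective_of_llp {P Z : Cplx S} (hZ : IsZero Z) (i : Z ⟶ P)
    (hP : (genCof S).rlp.llp i) (n : ℤ) : Projective (P.X n) := by
  refine ⟨fun {B A} f p hp => ?_⟩
  let σ := CochainComplex.singleFunctor (ModuleCat.{u} S) n
  -- the cones of the identities of `B` and `A`, placed in degree `n`, are contractible, so that `p`
  -- induces an acyclic fibration between them
  let F : mappingCone (𝟙 (σ.obj B)) ⟶ mappingCone (𝟙 (σ.obj A)) :=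
    mappingCone.map (𝟙 (σ.obj B)) (𝟙 (σ.obj A)) (σ.map p) (σ.map p) (by simp)
  have hF : (genCof S).rlp F := by
    have : QuasiIso F := by
      rw [quasiIso_iff]
      intro j
      rw [quasiIsoAt_iff_exactAt _ _ (acyclic_mappingCone (𝟙 (σ.obj B)) j)]
      exact acyclic_mappingCone (𝟙 (σ.obj A)) j
    refine rlp_of_surjective F (mappingCone_map_surjective (σ.map p) fun j => ?_)
    rw [← ModuleCat.epi_iff_surjective]
    by_cases hj : j = n
    · subst hj
      rw [show (σ.map p).f j = _ from single_map_f_self (ComplexShape.up ℤ) j p]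
      have h₁ : Epi (singleObjXSelf (ComplexShape.up ℤ) j B).hom := IsIso.epi_of_iso _
      have : Epi (singleObjXSelf (ComplexShape.up ℤ) j A).inv := IsIso.epi_of_iso _
      have h₂ : Epi (p ≫ (singleObjXSelf (ComplexShape.up ℤ) j A).inv) := epi_comp _ _
      exact epi_comp' h₁ h₂
    · exact (isZero_single_obj_X (ComplexShape.up ℤ) n A j hj).epi _
  -- the map `f`, a cochain that need not be a cocycle, is one component of a morphism to the cone
  let β : Cochain P (σ.obj A) 0 := Cochain.toSingleMk f (add_zero n)
  let g : P ⟶ mappingCone (𝟙 (σ.obj A)) := mappingCone.lift _ (Cocycle.mk (-δ 0 1 β) 2 rfl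
    (by rw [δ_neg, δ_δ, neg_zero])) β (by simp)
  have sq : CommSq (0 : Z ⟶ _) i F g := ⟨hZ.eq_of_src _ _⟩
  have := hP _ hF
  refine ⟨sq.lift.f n ≫ (mappingCone.snd _).v n n (add_zero n) ≫
    (HomologicalComplex.singleObjXSelf (ComplexShape.up ℤ) n B).hom, ?_⟩
  have hβ : g.f n ≫ (mappingCone.snd _).v n n (add_zero n) = β.v n n (add_zero n) := by
    simp [g]
  have hs : F.f n ≫ (mappingCone.snd _).v n n (add_zero n) =
      (mappingCone.snd _).v n n (add_zero n) ≫ (σ.map p).f n := by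
    rw [mappingCone.ext_from_iff _ (n + 1) n rfl]
    simp [F, mappingCone.map]
  have h : (sq.lift ≫ F).f n ≫ (mappingCone.snd _).v n n (add_zero n) = β.v n n (add_zero n) := by
    rw [sq.fac_right, hβ]
  rw [comp_f, Category.assoc, hs] at h
  rw [← cancel_mono (HomologicalComplex.singleObjXSelf (ComplexShape.up ℤ) n A).inv]
  rw [show (σ.map p).f n = _ from single_map_f_self (ComplexShape.up ℤ) n p] at h
  simp only [β, Cochain.toSingleMk_v] at h
  simp only [Category.assoc]
  exact (congr_arg (sq.lift.f n ≫ ·) (Category.assoc _ _ _)).trans h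

instance (M : Cplx S) (n : ℤ) : Projective (((res S).obj M).X n) :=
  projective_of_llp (isZero_zero _) _ ((factorization S).hi (Arrow.mk (0 : 0 ⟶ M))) n

end TermwiseProjective

/-! ### Injectivity of duals, and the double dual -/

section DualInjective
variable (k : Type u) {S : Type u} [Field k] [CommRing S] [Algebra k S]

/-- The exchange of variables `Hom_S(X, Hom_k(A, k)) → Hom_S(A, Hom_k(X, k))`. -/
noncomputable def LinDual.flip {X A : ModuleCat.{u} S} (g : X →ₗ[S] LinDual k A) :
    A →ₗ[S] LinDual k X where
  toFun a := LinDual.mk (fun x => g x a)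
    (fun x y => by rw [_root_.map_add, LinDual.add_apply])
    (fun c x => by rw [_root_.map_smul, LinDual.smul_apply, LinDual.map_algebraMap_smul])
  map_add' a b := LinDual.ext fun x => LinDual.map_add (g x) a b
  map_smul' s a := LinDual.ext fun x => by
    change g x (s • a) = g (s • x) a
    rw [g.map_smul, LinDual.smul_apply]

/-- The `k`-dual of a projective module `A` is injective: maps `X → A^∨` are maps `A → X^∨`, and
`Y^∨ → X^∨` is surjective for `X ⊆ Y`. -/
instance injective_linDual (A : ModuleCat.{u} S) [Projective A] :
    Injective ((linDual k S).obj (op A)) := by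
  refine ⟨fun {X Y} g f hf => ?_⟩
  have hf' : Epi ((linDual k S).map f.op) := by
    rw [ModuleCat.epi_iff_surjective]
    intro (φ : LinDual k X)
    obtain ⟨ψ, hψ⟩ := exists_extension f φ fun x hx => by
      rw [(ModuleCat.mono_iff_injective f).1 hf (hx.trans (map_zero f.hom).symm)]
      exact φ.map_zero
    exact ⟨ψ, LinDual.ext hψ⟩
  let g' : A ⟶ (linDual k S).obj (op X) := ModuleCat.ofHom (LinDual.flip k g.hom)
  let l : A ⟶ (linDual k S).obj (op Y) := Projective.factorThru g' ((linDual k S).map f.op)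
  have hl : l ≫ (linDual k S).map f.op = g' := Projective.factorThru_comp _ _
  refine ⟨ModuleCat.ofHom (LinDual.flip k l.hom), ?_⟩
  ext x
  apply LinDual.ext
  intro a
  exact DFunLike.congr_fun (F := LinDual k X) (ConcreteCategory.congr_hom hl a) x

instance : Projective (ModuleCat.of S S) :=
  (IsProjective.iff_projective S).1 inferInstance

instance injective_dualizer_X (n : ℤ) : Injective ((dualizer k S).X n) := by
  by_cases hn : n = 0
  · subst hn
    exact Injective.of_iso (singleObjXSelf (ComplexShape.up ℤ) 0 _).symm
      (injective_linDual k (ModuleCat.of S S))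
  · exact (isZero_single_obj_X (ComplexShape.up ℤ) 0 _ n hn).injective

instance isKInjective_dualizer : (dualizer k S).IsKInjective :=
  isKInjective_of_injective _ 0

/-- The `k`-dual of a K-projective complex `P` is K-injective, being isomorphic to
`Hom(P, Hom_k(S, k))`. -/
instance isKInjective_dualCplx (P : Cplx S) [P.IsKProjective] :
    ((dualCplx k S).obj (op P)).IsKInjective :=
  have : (homCplx P (dualizer k S)).IsKInjective := isKInjective_homCplx P _
  isKInjective_of_iso (show homCplx P (dualizer k S) ≅ _ from ((dualIsoHom k S).app (op P)).symm)

theorem injective_dualCplx_X (P : Cplx S) (hP : ∀ n, Projective (P.X n)) (n : ℤ) :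
    Injective (((dualCplx k S).obj (op P)).X n) :=
  have := hP (-n)
  injective_linDual k (P.X (-n))

/-- A submodule and an element outside of it are separated by a `k`-linear functional. -/
theorem exists_linDual_ne_zero {M : ModuleCat.{u} S} (B : Submodule S M) (x : M) (hx : x ∉ B) :
    ∃ φ : LinDual k M, (∀ b ∈ B, φ b = 0) ∧ φ x ≠ 0 := by
  let Y := (ModuleCat.restrictScalars (algebraMap k S)).obj (ModuleCat.of S (M ⧸ B))
  have h : ∃ ψ : Module.Dual k Y, ψ (show Y from B.mkQ x) ≠ 0 := by
    by_contra! h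
    have := (Module.forall_dual_apply_eq_zero_iff k (show Y from B.mkQ x)).1 h
    exact hx ((Submodule.Quotient.mk_eq_zero B).1 this)
  obtain ⟨ψ, hψ⟩ := h
  refine ⟨LinDual.precomp k (N := ModuleCat.of S (M ⧸ B)) (ModuleCat.ofHom B.mkQ) ψ, ?_, hψ⟩
  intro b hb
  change ψ (show Y from B.mkQ b) = 0
  have : B.mkQ b = 0 := (Submodule.Quotient.mk_eq_zero B).2 hb
  rw [this]
  exact map_zero ψ

/-- The canonical map from a complex to its double dual. -/
noncomputable def toBidual (M : Cplx S) :
    M ⟶ (dualCplx k S).obj (op ((dualCplx k S).obj (op M))) where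
  f n := (M.XIsoOfEq (neg_neg n).symm).hom ≫
    ModuleCat.ofHom (LinDual.flip k (A := M.X (-(-n))) (X := (linDual k S).obj (op (M.X (-(-n)))))
      LinearMap.id)
  comm' i j _ := by
    ext x
    apply LinDual.ext
    intro (ψ : LinDual k (M.X (-(-j))))
    refine congrArg ψ ?_
    change ((M.XIsoOfEq (neg_neg i).symm).hom ≫ M.d (-(-i)) (-(-j))) x =
      (M.d i j ≫ (M.XIsoOfEq (neg_neg j).symm).hom) x
    rw [XIsoOfEq_hom_comp_d, d_comp_XIsoOfEq_hom]

/-- The complex `P^∨` with `P` a K-projective resolution of `M^∨`. -/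
noncomputable abbrev doubleDual (M : Cplx S) : Cplx S :=
  (dualCplx k S).obj (op ((res S).obj ((dualCplx k S).obj (op M))))

/-- The canonical map from `M` to a K-injective complex of injective modules. It is a
monomorphism and induces monomorphisms in cohomology. -/
noncomputable def toDoubleDual (M : Cplx S) : M ⟶ doubleDual k M :=
  toBidual k M ≫ (dualCplx k S).map ((resπ S).app ((dualCplx k S).obj (op M))).op

theorem XIsoOfEq_apply_injective (M : Cplx S) {i j : ℤ} (h : i = j) :
    Function.Injective (M.XIsoOfEq h).hom := by
  subst h
  intro x y hxy
  simpa using hxy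

theorem toDoubleDual_injective (M : Cplx S) (n : ℤ) :
    Function.Injective ((toDoubleDual k M).f n) := by
  rw [injective_iff_map_eq_zero]
  intro x hx
  by_contra hx0
  obtain ⟨φ, -, hφ⟩ := exists_linDual_ne_zero k (M := M.X (-(-n))) ⊥
    ((M.XIsoOfEq (neg_neg n).symm).hom x) (fun h => hx0
      (XIsoOfEq_apply_injective M (neg_neg n).symm (h.trans (map_zero _).symm)))
  obtain ⟨p, hp⟩ := resπ_surjective ((dualCplx k S).obj (op M)) (-n) φ
  refine hφ ?_
  have := DFunLike.congr_fun (F := LinDual k _) hx p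
  refine Eq.trans ?_ this
  refine Eq.trans ?_ (dualCplx_map_apply k ((resπ S).app ((dualCplx k S).obj (op M))) n
    ((toBidual k M).f n x) p).symm
  erw [hp]
  rfl

/-- The map to the double dual is a monomorphism in cohomology: an element that is not a boundary is
separated from the boundaries by a functional `φ`, which is a cocycle of the dual complex. -/
theorem exists_d_eq_of_toBidual (M : Cplx S) {n m : ℤ} (x : M.X n)
    (w : ((dualCplx k S).obj (op ((dualCplx k S).obj (op M)))).X m)
    (hw : (toBidual k M).f n x =
      ((dualCplx k S).obj (op ((dualCplx k S).obj (op M)))).d m n w) :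
    ∃ v : M.X m, M.d m n v = x := by
  by_contra! hv
  obtain ⟨φ, hφ, hφ'⟩ := exists_linDual_ne_zero k (M := M.X (-(-n)))
    (LinearMap.range (M.d (-(-m)) (-(-n))).hom) ((M.XIsoOfEq (neg_neg n).symm).hom x) (by
      rintro ⟨v, hv'⟩
      refine hv ((M.XIsoOfEq (neg_neg m)).hom v) ?_
      apply XIsoOfEq_apply_injective M (neg_neg n).symm
      rw [← hv']
      change ((M.XIsoOfEq (neg_neg m)).hom ≫ M.d m n ≫ (M.XIsoOfEq (neg_neg n).symm).hom) v = _
      rw [d_comp_XIsoOfEq_hom, XIsoOfEq_hom_comp_d])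
  have h₁ := DFunLike.congr_fun (F := LinDual k ((linDual k S).obj (op (M.X (-(-n)))))) hw φ
  refine hφ' (h₁.trans ?_)
  refine (dualCplx_d_apply k ((dualCplx k S).obj (op M)) m n w φ).trans ?_
  have : ((dualCplx k S).obj (op M)).d (-n) (-m) φ = 0 := by
    apply LinDual.ext
    intro y
    exact hφ _ ⟨y, rfl⟩
  rw [this]
  exact LinDual.map_zero (show LinDual k (((dualCplx k S).obj (op M)).X (-m)) from w)

theorem exists_d_eq_of_quasiIso {K L : Cplx S} (f : K ⟶ L) [hf : QuasiIso f] {n m : ℤ}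
    (h : m + 1 = n) (x : K.X n) (hx : K.d n (n + 1) x = 0) (w : L.X m)
    (hw : f.f n x = L.d m n w) : ∃ v : K.X m, K.d m n v = x := by
  obtain rfl : m = n - 1 := by lia
  exact ((quasiIso_iff_elements f).1 hf).2 n x w hx hw

/-- The map from `M` to `doubleDual k M` is a monomorphism in cohomology. -/
theorem exists_d_eq_of_toDoubleDual (M : Cplx S) {n m : ℤ} (h : m + 1 = n) (x : M.X n)
    (hx : M.d n (n + 1) x = 0) (w : (doubleDual k M).X m)
    (hw : (toDoubleDual k M).f n x = (doubleDual k M).d m n w) :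
    ∃ v : M.X m, M.d m n v = x := by
  have := dualCplx_quasiIso k ((resπ S).app ((dualCplx k S).obj (op M)))
  obtain ⟨v, hv⟩ := exists_d_eq_of_quasiIso
    ((dualCplx k S).map ((resπ S).app ((dualCplx k S).obj (op M))).op) h ((toBidual k M).f n x)
    (by rw [hom_d, hx, map_zero]) w hw
  exact exists_d_eq_of_toBidual k M x v hv.symm

end DualInjective

/-! ### Products, subcomplexes and quotients, elements of mapping cocones -/

section Constructions
variable {S : Type u} [CommRing S]

/-- The product of a family of complexes. -/
noncomputable def piCplx {ι : Type} (R : ι → Cplx S) : Cplx S where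
  X n := ModuleCat.of S (∀ s, (R s).X n)
  d i j := ModuleCat.ofHom (LinearMap.pi fun s => ((R s).d i j).hom ∘ₗ LinearMap.proj s)
  shape i j hij := by
    ext x s
    exact ConcreteCategory.congr_hom ((R s).shape i j hij) (x s)
  d_comp_d' i j l _ _ := by
    ext x s
    exact d_sq (x s)

/-- The projections from the product. -/
noncomputable def piCplx.π {ι : Type} (R : ι → Cplx S) (s : ι) : piCplx R ⟶ R s where
  f n := ModuleCat.ofHom (LinearMap.proj s)

/-- Maps into the product. -/
noncomputable def piCplx.lift {ι : Type} {R : ι → Cplx S} {M : Cplx S} (f : ∀ s, M ⟶ R s) :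
    M ⟶ piCplx R where
  f n := ModuleCat.ofHom (LinearMap.pi fun s => ((f s).f n).hom)
  comm' i j _ := by
    ext x
    funext s
    exact hom_d (f s) x

theorem piCplx.cochain_ext {ι : Type} {R : ι → Cplx S} {M : Cplx S} {n : ℤ}
    {z z' : Cochain M (piCplx R) n}
    (h : ∀ s, z.comp (Cochain.ofHom (piCplx.π R s)) (add_zero n) =
      z'.comp (Cochain.ofHom (piCplx.π R s)) (add_zero n)) : z = z' := by
  refine Cochain.ext _ _ fun p q hpq => ?_
  ext x
  funext s
  have := Cochain.congr_v (h s) p q hpq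
  simp only [Cochain.comp_zero_cochain_v, Cochain.ofHom_v] at this
  exact ConcreteCategory.congr_hom this x

/-- The cochain with given components. -/
noncomputable def piCplx.liftCochain {ι : Type} {R : ι → Cplx S} {M : Cplx S} {n : ℤ}
    (z : ∀ s, Cochain M (R s) n) : Cochain M (piCplx R) n :=
  Cochain.mk fun p q hpq => ModuleCat.ofHom (LinearMap.pi fun s => ((z s).v p q hpq).hom)

theorem piCplx.liftCochain_π {ι : Type} {R : ι → Cplx S} {M : Cplx S} {n : ℤ}
    (z : ∀ s, Cochain M (R s) n) (s : ι) :
    (piCplx.liftCochain z).comp (Cochain.ofHom (piCplx.π R s)) (add_zero n) = z s := by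
  refine Cochain.ext _ _ fun p q hpq => ?_
  simp only [Cochain.comp_zero_cochain_v, Cochain.ofHom_v]
  rfl

instance piCplx.isKInjective {ι : Type} (R : ι → Cplx S) [∀ s, (R s).IsKInjective] :
    (piCplx R).IsKInjective := by
  refine isKInjective_of_homCplx_acyclic fun K hK => (homCplx_acyclic_iff _ _).2 fun n z hz => ?_
  have h (s : ι) := exists_δ_eq (homCplx_acyclic_of_acyclic_left hK (R s))
    (z.comp (Cochain.ofHom (piCplx.π R s)) (add_zero n)) rfl
    (by rw [δ_comp_ofHom, hz, Cochain.zero_comp]) (n - 1) (by lia)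
  choose w hw using h
  refine ⟨piCplx.liftCochain w, piCplx.cochain_ext fun s => ?_⟩
  rw [← δ_comp_ofHom, piCplx.liftCochain_π, hw]

instance piCplx.injective_X {ι : Type} (R : ι → Cplx S) (n : ℤ) [∀ s, Injective ((R s).X n)] :
    Injective ((piCplx R).X n) := by
  refine ⟨fun {X Y} g f _ => ?_⟩
  refine ⟨ModuleCat.ofHom (LinearMap.pi fun s =>
    (Injective.factorThru (g ≫ (piCplx.π R s).f n) f).hom), ?_⟩
  ext x
  funext s
  exact ConcreteCategory.congr_hom (Injective.comp_factorThru (g ≫ (piCplx.π R s).f n) f) x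

section Quotient
variable (R : Cplx S) (p : ∀ n, Submodule S (R.X n))
  (hp : ∀ i j, ∀ x ∈ p i, R.d i j x ∈ p j)

/-- The subcomplex given by a family of submodules stable under the differential. -/
noncomputable def subCplx : Cplx S where
  X n := ModuleCat.of S (p n)
  d i j := ModuleCat.ofHom ((R.d i j).hom.restrict (hp i j))
  shape i j hij := by
    ext x
    exact ConcreteCategory.congr_hom (R.shape i j hij) x.1
  d_comp_d' i j l _ _ := by
    ext x
    exact d_sq x.1

/-- The quotient by a subcomplex. -/
noncomputable def quotCplx : Cplx S where
  X n := ModuleCat.of S (R.X n ⧸ p n)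
  d i j := ModuleCat.ofHom ((p i).mapQ (p j) (R.d i j).hom (hp i j))
  shape i j hij := by
    ext x
    refine congrArg (p j).mkQ (ConcreteCategory.congr_hom (R.shape i j hij) x)
  d_comp_d' i j l _ _ := by
    ext x
    exact congrArg (p l).mkQ (d_sq x)

/-- The inclusion of a subcomplex. -/
noncomputable def subCplx.ι : subCplx R p hp ⟶ R where
  f n := ModuleCat.ofHom (p n).subtype

/-- The projection to a quotient complex. -/
noncomputable def quotCplx.π : R ⟶ quotCplx R p hp where
  f n := ModuleCat.ofHom (p n).mkQ

theorem subCplx.ι_injective (n : ℤ) : Function.Injective ((subCplx.ι R p hp).f n) :=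
  Subtype.val_injective

theorem quotCplx.π_surjective (n : ℤ) : Function.Surjective ((quotCplx.π R p hp).f n) :=
  (p n).mkQ_surjective

theorem quotCplx.π_eq_zero_iff (n : ℤ) (x : R.X n) : (quotCplx.π R p hp).f n x = 0 ↔ x ∈ p n :=
  Submodule.Quotient.mk_eq_zero _

end Quotient

section Cocone
variable {L L' : Cplx S} (g : L ⟶ L')

/-- The element of a mapping cocone with given components. -/
noncomputable def coconeMk {p q : ℤ} (h : q + 1 = p) (a : L.X p) (b : L'.X q) :
    (mappingCocone g).X p :=
  (mappingCocone.inl g).v p p (add_zero p) a + (mappingCocone.inr g).1.v q p h b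

/-- The second component of an element of a mapping cocone. -/
noncomputable abbrev coconeSnd {p q : ℤ} (h : q + 1 = p) (y : (mappingCocone g).X p) : L'.X q :=
  (mappingCocone.snd g).v p q (by lia) y

theorem coconeSnd_zero {p q : ℤ} (h : q + 1 = p) : coconeSnd g h 0 = 0 :=
  map_zero ((mappingCocone.snd g).v p q (by lia)).hom

theorem coconeSnd_add {p q : ℤ} (h : q + 1 = p) (y y' : (mappingCocone g).X p) :
    coconeSnd g h (y + y') = coconeSnd g h y + coconeSnd g h y' :=
  map_add ((mappingCocone.snd g).v p q (by lia)).hom y y'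

variable {g}

@[simp]
theorem fst_coconeMk {p q : ℤ} (h : q + 1 = p) (a : L.X p) (b : L'.X q) :
    (mappingCocone.fst g).f p (coconeMk g h a b) = a := by
  have h₁ := ConcreteCategory.congr_hom (mappingCocone.inl_v_fst_f g p) a
  have h₂ := ConcreteCategory.congr_hom (mappingCocone.inr_v_fst_f g q p h) b
  rw [coconeMk, map_add]
  exact (congr_arg₂ (· + ·) h₁ h₂).trans (add_zero a)

@[simp]
theorem snd_coconeMk {p q : ℤ} (h : q + 1 = p) (a : L.X p) (b : L'.X q) :
    coconeSnd g h (coconeMk g h a b) = b := by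
  have h₁ := ConcreteCategory.congr_hom (mappingCocone.inl_v_snd_v g p q (by lia)) a
  have h₂ := ConcreteCategory.congr_hom (mappingCocone.inr_v_snd_v g q p h) b
  exact (map_add ((mappingCocone.snd g).v p q (by lia)).hom _ _).trans
    ((congr_arg₂ (· + ·) h₁ h₂).trans (zero_add b))

theorem coconeMk_eta {p q : ℤ} (h : q + 1 = p) (y : (mappingCocone g).X p) :
    coconeMk g h ((mappingCocone.fst g).f p y) (coconeSnd g h y) = y :=
  ConcreteCategory.congr_hom (mappingCocone.id_X g p q (by lia)) y

theorem cocone_elt_ext {p q : ℤ} (h : q + 1 = p) {y y' : (mappingCocone g).X p}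
    (h₁ : (mappingCocone.fst g).f p y = (mappingCocone.fst g).f p y')
    (h₂ : coconeSnd g h y = coconeSnd g h y') : y = y' := by
  rw [← coconeMk_eta h y, ← coconeMk_eta h y', h₁, h₂]

variable (g) in
theorem δ_cocone_snd : δ (-1) 0 (mappingCocone.snd g) =
    -(Cochain.ofHom (mappingCocone.fst g ≫ g)) := by
  have h : mappingCocone.liftCochain g (Cochain.ofHom (mappingCocone.fst g))
      (mappingCocone.snd g) (by lia) = Cochain.ofHom (𝟙 _) := by
    obtain ⟨a, b, hab⟩ := cocone_cochain_eq_lift g (show -1 + 1 = 0 by lia)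
      (Cochain.ofHom (𝟙 (mappingCocone g)))
    have h₁ := mappingCocone.liftCochain_comp_fst g a b (by lia)
    have h₂ := mappingCocone.liftCochain_comp_snd g a b (by lia)
    rw [← hab, Cochain.id_comp] at h₁ h₂
    rw [hab, ← h₁, ← h₂]
  have h' := congr_arg (δ 0 1) h
  rw [δ_cocone_lift _ _ (by lia), δ_ofHom, δ_ofHom, ← cocone_zero_lift g (show 0 + 1 = 1 by lia),
    lift_eq_lift_iff] at h'
  rw [eq_neg_iff_add_eq_zero, Cochain.ofHom_comp]
  exact neg_eq_zero.1 h'.2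

theorem coconeSnd_d {p q r : ℤ} (h : q + 1 = p) (h' : p + 1 = r) (y : (mappingCocone g).X p) :
    coconeSnd g h' ((mappingCocone g).d p r y) =
      -(g.f p ((mappingCocone.fst g).f p y) + L'.d q p (coconeSnd g h y)) := by
  have := ConcreteCategory.congr_hom (Cochain.congr_v (δ_cocone_snd g) p p (add_zero p)) y
  simp [δ_v (-1) 0 (by lia) (mappingCocone.snd g) p p (add_zero p) q r (by lia) (by lia)] at this
  rw [neg_add, ← sub_eq_add_neg, eq_sub_iff_add_eq, add_comm]
  exact this

theorem cocone_eq_add_d {p q r : ℤ} (hq : q + 1 = p) (hr : r + 1 = q)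
    (y y₀ : (mappingCocone g).X p) (a : L.X q) (b : L'.X r)
    (h₁ : (mappingCocone.fst g).f p y = (mappingCocone.fst g).f p y₀ + L.d q p a)
    (h₂ : coconeSnd g hq y = coconeSnd g hq y₀ + -(g.f q a + L'.d r q b)) :
    y = y₀ + (mappingCocone g).d q p (coconeMk g hr a b) := by
  refine cocone_elt_ext hq ?_ ?_
  · rw [map_add, ← hom_d, fst_coconeMk, h₁]
  · rw [coconeSnd_add, coconeSnd_d hr, fst_coconeMk, snd_coconeMk, h₂]

instance cocone_injective_X [∀ n, Injective (L.X n)] [∀ n, Injective (L'.X n)] (n : ℤ) :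
    Injective ((mappingCocone g).X n) := by
  refine ⟨fun {X Y} a f _ => ?_⟩
  have h : n - 1 + 1 = n := by lia
  refine ⟨Injective.factorThru (a ≫ (mappingCocone.fst g).f n) f ≫
      (mappingCocone.inl g).v n n (add_zero n) +
    Injective.factorThru (a ≫ (mappingCocone.snd g).v n (n - 1) (by lia)) f ≫
      (mappingCocone.inr g).1.v (n - 1) n h, ?_⟩
  apply cocone_hom_ext g (show n + -1 = n - 1 by lia) <;> simp

instance cocone_isKInjective [L.IsKInjective] [L'.IsKInjective] :
    (mappingCocone g).IsKInjective := by
  refine isKInjective_of_homCplx_acyclic fun K hK => ?_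
  rw [← quasiIso_homMap_right_iff_acyclic_cocone, quasiIso_iff]
  intro n
  rw [quasiIsoAt_iff_exactAt _ _ (homCplx_acyclic_of_acyclic_left hK L n)]
  exact homCplx_acyclic_of_acyclic_left hK L' n

end Cocone
end Constructions

/-! ### K-injective resolutions by complexes of injective modules -/

section Resolution
variable (k : Type u) {S : Type u} [Field k] [CommRing S] [Algebra k S]

/-- The cokernel of a morphism of complexes, as an explicit complex of quotient modules. -/
noncomputable def cokerCplx {M R : Cplx S} (i : M ⟶ R) : Cplx S :=
  quotCplx R (fun n => LinearMap.range (i.f n).hom) (by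
    rintro a b _ ⟨x, rfl⟩
    exact ⟨M.d a b x, (hom_d i x).symm⟩)

/-- The projection to the cokernel. -/
noncomputable def cokerCplx.π {M R : Cplx S} (i : M ⟶ R) : R ⟶ cokerCplx i :=
  quotCplx.π R _ _

theorem cokerCplx.π_surjective {M R : Cplx S} (i : M ⟶ R) (n : ℤ) :
    Function.Surjective ((cokerCplx.π i).f n) :=
  quotCplx.π_surjective R _ _ n

theorem cokerCplx.π_eq_zero_iff {M R : Cplx S} (i : M ⟶ R) (n : ℤ) (x : R.X n) :
    (cokerCplx.π i).f n x = 0 ↔ ∃ y, i.f n y = x :=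
  quotCplx.π_eq_zero_iff R _ _ n x

theorem cokerCplx.comp_π {M R : Cplx S} (i : M ⟶ R) : i ≫ cokerCplx.π i = 0 := by
  ext n x
  exact (cokerCplx.π_eq_zero_iff i n _).2 ⟨x, rfl⟩

/-- The composite `R → R/M → J⁰(R/M)`. -/
noncomputable def towerMap {M R : Cplx S} (i : M ⟶ R) : R ⟶ doubleDual k (cokerCplx i) :=
  cokerCplx.π i ≫ toDoubleDual k (cokerCplx i)

theorem comp_towerMap {M R : Cplx S} (i : M ⟶ R) : i ≫ towerMap k i = 0 := by
  rw [towerMap, ← Category.assoc, cokerCplx.comp_π, zero_comp]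

/-- A stage of the tower of approximations of `M`: a K-injective complex of injective modules
containing `M`, so that `M` is a subobject also in cohomology. -/
structure TowerStage (M : Cplx S) where
  /-- the complex -/
  R : Cplx S
  /-- the inclusion -/
  i : M ⟶ R
  isKInjective : R.IsKInjective
  injective (n : ℤ) : Injective (R.X n)
  i_injective (n : ℤ) : Function.Injective (i.f n)
  exists_d_eq {m n : ℤ} (h : m + 1 = n) (x : M.X n) (hx : M.d n (n + 1) x = 0) (w : R.X m)
    (hw : i.f n x = R.d m n w) : ∃ v : M.X m, M.d m n v = x

attribute [instance] TowerStage.isKInjective TowerStage.injective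

instance isKInjective_doubleDual (M : Cplx S) : (doubleDual k M).IsKInjective :=
  isKInjective_dualCplx k _

instance injective_doubleDual_X (M : Cplx S) (n : ℤ) : Injective ((doubleDual k M).X n) :=
  injective_dualCplx_X k _ (fun _ => inferInstance) n

variable {k}

/-- The inclusion of `M` in the next stage. -/
noncomputable abbrev TowerStage.nextι {M : Cplx S} (T : TowerStage M) :
    M ⟶ mappingCocone (towerMap k T.i) :=
  mappingCocone.lift _ T.i 0 (by simp [comp_towerMap])

theorem TowerStage.nextι_fst {M : Cplx S} (T : TowerStage M) (n : ℤ) (x : M.X n) :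
    (mappingCocone.fst (towerMap k T.i)).f n (T.nextι.f n x) = T.i.f n x :=
  ConcreteCategory.congr_hom (mappingCocone.lift_f_fst_f _ _ _ _ n) x

variable (k) in
/-- The next stage of the tower. -/
noncomputable def TowerStage.next {M : Cplx S} (T : TowerStage M) : TowerStage M where
  R := mappingCocone (towerMap k T.i)
  i := T.nextι (k := k)
  isKInjective := inferInstance
  injective n := inferInstance
  i_injective n := fun x y h => T.i_injective n (by rw [← nextι_fst (k := k), ← nextι_fst (k := k), h])
  exists_d_eq h x hx w hw := T.exists_d_eq h x hx
    ((mappingCocone.fst (towerMap k T.i)).f _ w) (by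
    rw [← nextι_fst (k := k), hw, hom_d])

variable (k) in
/-- The tower of approximations of `M`. -/
noncomputable def tower (M : Cplx S) : ℕ → TowerStage M
  | 0 =>
    { R := doubleDual k M
      i := toDoubleDual k M
      isKInjective := inferInstance
      injective := inferInstance
      i_injective := toDoubleDual_injective k M
      exists_d_eq := exists_d_eq_of_toDoubleDual k M }
  | s + 1 => (tower M s).next k

variable (k) in
/-- The transition maps of the tower. -/
noncomputable def towerTr (M : Cplx S) (s : ℕ) : (tower k M (s + 1)).R ⟶ (tower k M s).R :=
  mappingCocone.fst (towerMap k (tower k M s).i)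

theorem towerTr_i (M : Cplx S) (s : ℕ) {n : ℤ} (x : M.X n) :
    (towerTr k M s).f n ((tower k M (s + 1)).i.f n x) = (tower k M s).i.f n x :=
  TowerStage.nextι_fst (tower k M s) n x

/-- In cohomology the image of a transition map of the tower is that of `M`. -/
theorem towerTr_cocycle (M : Cplx S) (s : ℕ) {m n : ℤ} (h : m + 1 = n)
    (r : (tower k M (s + 1)).R.X n) (hr : (tower k M (s + 1)).R.d n (n + 1) r = 0) :
    ∃ (x : M.X n) (w : (tower k M s).R.X m), M.d n (n + 1) x = 0 ∧
      (towerTr k M s).f n r = (tower k M s).i.f n x + (tower k M s).R.d m n w := by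
  set T := tower k M s
  set g := towerMap k T.i
  change (mappingCocone g).X n at r
  change (mappingCocone g).d n (n + 1) r = 0 at hr
  let a : T.R.X n := (mappingCocone.fst g).f n r
  have ha : T.R.d n (n + 1) a = 0 := by rw [hom_d, hr, map_zero]
  have hb := coconeSnd_d (g := g) h rfl r
  rw [hr, coconeSnd_zero, zero_eq_neg, add_eq_zero_iff_eq_neg, ← map_neg] at hb
  -- the image of `a` in the cokernel is a boundary in the double dual, hence a boundary
  obtain ⟨v, hv⟩ := exists_d_eq_of_toDoubleDual k (cokerCplx T.i) h ((cokerCplx.π T.i).f n a)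
    (by rw [hom_d, ha, map_zero]) (-coconeSnd g h r) hb
  obtain ⟨w, rfl⟩ := cokerCplx.π_surjective T.i m v
  rw [hom_d] at hv
  obtain ⟨x, hx⟩ := (cokerCplx.π_eq_zero_iff T.i n (a - T.R.d m n w)).1
    (by rw [map_sub, hv, sub_self])
  refine ⟨x, w, ?_, ?_⟩
  · apply T.i_injective
    rw [← hom_d, hx, map_sub, ha, d_sq, sub_zero, map_zero]
  · rw [hx, sub_add_cancel]
    rfl

variable (k) in
/-- The difference of the identity and the shift on the product of the tower. -/
noncomputable def towerShift (M : Cplx S) :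
    piCplx (fun s => (tower k M s).R) ⟶ piCplx (fun s => (tower k M s).R) :=
  piCplx.lift fun s => piCplx.π _ s - piCplx.π _ (s + 1) ≫ towerTr k M s

variable (k) in
/-- A K-injective resolution of an unbounded complex by a complex of injective modules: the
homotopy limit of the tower. -/
noncomputable def injRes (M : Cplx S) : Cplx S := mappingCocone (towerShift k M)

instance (M : Cplx S) : (injRes k M).IsKInjective :=
  inferInstanceAs (mappingCocone (towerShift k M)).IsKInjective

instance (M : Cplx S) (n : ℤ) : Injective ((injRes k M).X n) :=
  inferInstanceAs (Injective ((mappingCocone (towerShift k M)).X n))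

variable (k) in
/-- The map from `M` to its K-injective resolution. -/
noncomputable def injResι (M : Cplx S) : M ⟶ injRes k M :=
  mappingCocone.lift (towerShift k M) (piCplx.lift fun s => (tower k M s).i) 0 (by
    have : (piCplx.lift fun s => (tower k M s).i) ≫ towerShift k M = 0 := by
      ext n x
      funext s
      exact sub_eq_zero.2 (towerTr_i M s x).symm
    simp [this])

theorem injResι_fst (M : Cplx S) (n : ℤ) (x : M.X n) (s : ℕ) :
    (mappingCocone.fst (towerShift k M)).f n ((injResι k M).f n x) s = (tower k M s).i.f n x :=
  congr_fun (ConcreteCategory.congr_hom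
    (mappingCocone.lift_f_fst_f (towerShift k M) _ _ _ n) x) s

theorem injResι_snd (M : Cplx S) {m n : ℤ} (h : m + 1 = n) (x : M.X n) :
    coconeSnd (towerShift k M) h ((injResι k M).f n x) = 0 :=
  ConcreteCategory.congr_hom (mappingCocone.lift_f_snd_v (towerShift k M) _ _ _ n m (by lia)) x

theorem exists_partialSum {A : Type*} [AddCommGroup A] (a : ℕ → A) :
    ∃ c : ℕ → A, c 0 = 0 ∧ ∀ s, c (s + 1) = c s + a s :=
  ⟨fun s => ∑ i ∈ Finset.range s, a i, by simp, fun s => Finset.sum_range_succ a s⟩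

/-- The map from `M` to the homotopy limit of its tower is a quasi-isomorphism. It is a monomorphism
in cohomology as this holds for the first stage. The transition maps of the tower have the image of
the cohomology of `M` as their image in cohomology, so that the limit of the cohomology of the tower
is the cohomology of `M`, and its derived limit vanishes. On elements: a cocycle of the homotopy limit
is a family of cocycles `r s`, compatible up to the boundaries of elements `t s`. -/
instance quasiIso_injResι (M : Cplx S) : QuasiIso (injResι k M) := by
  refine (quasiIso_iff_elements _).2 ⟨fun n y hy => ?_, fun n x w hx hw => ?_⟩
  · have hn : n - 1 + 1 = n := by lia
    let g := towerShift k M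
    change (mappingCocone g).X n at y
    change (mappingCocone g).d n (n + 1) y = 0 at hy
    let r (s : ℕ) : (tower k M s).R.X n := (mappingCocone.fst g).f n y s
    let t (s : ℕ) : (tower k M s).R.X (n - 1) := coconeSnd g hn y s
    have hr (s : ℕ) : (tower k M s).R.d n (n + 1) (r s) = 0 := by
      have := hom_d (mappingCocone.fst g) y (j := n + 1)
      rw [hy, map_zero] at this
      exact congr_fun this s
    have ht (s : ℕ) : r s - (towerTr k M s).f n (r (s + 1)) =
        -(tower k M s).R.d (n - 1) n (t s) := by
      have := coconeSnd_d (g := g) hn rfl y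
      rw [hy, coconeSnd_zero, zero_eq_neg, add_eq_zero_iff_eq_neg] at this
      exact congr_fun this s
    -- `r s` is cohomologous to the image of a cocycle `m s` of `M`
    choose m w hm hw using fun s => towerTr_cocycle M s hn (r (s + 1)) (hr (s + 1))
    obtain ⟨u, hu⟩ : ∃ u : ∀ s, (tower k M s).R.X (n - 1), ∀ s, r s =
        (tower k M s).i.f n (m s) + (tower k M s).R.d (n - 1) n (u s) :=
      ⟨fun s => w s - t s, fun s => by
        rw [map_sub, ← add_sub_assoc, ← hw, sub_eq_add_neg, ← ht, add_sub_cancel]⟩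
    -- the cocycles `m s` are cohomologous to each other; the partial sums `c` of the elements that
    -- relate them allow to replace all of them by `m 0`
    have ha (s : ℕ) : ∃ a : M.X (n - 1), M.d (n - 1) n a = m (s + 1) - m s := by
      refine (tower k M s).exists_d_eq hn _ (by rw [map_sub, hm, hm, sub_zero])
        (w s - (towerTr k M s).f (n - 1) (u (s + 1))) ?_
      have h₁ := hw s
      rw [hu (s + 1), map_add, towerTr_i, ← hom_d] at h₁
      rw [map_sub, map_sub, sub_eq_sub_iff_add_eq_add, h₁, add_comm]
    choose a ha using ha
    obtain ⟨c, hc₀, hc⟩ := exists_partialSum a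
    have hmc (s : ℕ) : m s = m 0 + M.d (n - 1) n (c s) := by
      induction s with
      | zero => rw [hc₀, map_zero, add_zero]
      | succ s ih => rw [hc, map_add, ha, ← add_assoc, ← ih, add_sub_cancel]
    obtain ⟨v, hv⟩ : ∃ v : ∀ s, (tower k M s).R.X (n - 1), ∀ s, r s =
        (tower k M s).i.f n (m 0) + (tower k M s).R.d (n - 1) n (v s) :=
      ⟨fun s => u s + (tower k M s).i.f (n - 1) (c s), fun s => by
        rw [map_add, hom_d, add_left_comm, ← map_add, ← hmc, add_comm, ← hu]⟩
    -- the remaining defect of compatibility is a family of cocycles `t'` of degree `n - 1`. It is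
    -- removed in the same way: `t' (s + 1)` maps to a cocycle `x s` of `M`, up to a boundary, and the
    -- partial sums `c'` of the `x s` telescope
    obtain ⟨t', ht'⟩ : ∃ t' : ∀ s, (tower k M s).R.X (n - 1), ∀ s,
      t' s = t s + (v s - (towerTr k M s).f (n - 1) (v (s + 1))) := ⟨_, fun _ => rfl⟩
    have ht'' (s : ℕ) : (tower k M s).R.d (n - 1) (n - 1 + 1) (t' s) = 0 := by
      have : ∀ l, l = n → (tower k M s).R.d (n - 1) l (t' s) = 0 := by
        rintro l rfl
        have h₁ := ht s
        rw [hv s, hv (s + 1), map_add, towerTr_i, ← hom_d, add_sub_add_left_eq_sub] at h₁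
        rw [ht', map_add, map_sub, h₁, add_neg_cancel]
      exact this _ hn
    choose x e hx he using fun s =>
      towerTr_cocycle M s (show n - 1 - 1 + 1 = n - 1 by lia) (t' (s + 1)) (ht'' (s + 1))
    obtain ⟨c', hc₀', hc'⟩ := exists_partialSum x
    obtain ⟨v', hv'⟩ : ∃ v' : ∀ s, (tower k M s).R.X (n - 1), ∀ s,
      v' s = v s - t' s + (tower k M s).i.f (n - 1) (c' s) := ⟨_, fun _ => rfl⟩
    refine ⟨m 0, coconeMk g (show n - 1 - 1 + 1 = n - 1 by lia) v' (fun s => -e s), hm 0,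
      cocone_eq_add_d hn _ _ _ _ _ ?_ ?_⟩
    · funext s
      have h₁ : (tower k M s).R.d (n - 1) n (v' s) = (tower k M s).R.d (n - 1) n (v s) := by
        have h₂ : M.d (n - 1) n (c' s) = 0 := by
          have : ∀ l, n - 1 + 1 = l → M.d (n - 1) l (c' s) = 0 := by
            rintro l rfl
            induction s with
            | zero => rw [hc₀', map_zero]
            | succ s ih => rw [hc', map_add, ih, hx, add_zero]
          exact this n hn
        have h₃ : (tower k M s).R.d (n - 1) n (t' s) = 0 := by
          have : ∀ l, n - 1 + 1 = l → (tower k M s).R.d (n - 1) l (t' s) = 0 := by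
            rintro l rfl
            exact ht'' s
          exact this n hn
        rw [hv', map_add, map_sub, hom_d, h₂, h₃, map_zero, sub_zero, add_zero]
      exact (hv s).trans (congr_arg₂ (· + ·) (injResι_fst M n (m 0) s).symm h₁.symm)
    · rw [injResι_snd, zero_add]
      funext s
      change t s = -((v' s - (towerTr k M s).f (n - 1) (v' (s + 1))) +
        (tower k M s).R.d (n - 1 - 1) (n - 1) (-e s))
      rw [hv', hv', map_add, map_sub, he, towerTr_i, hc', map_add, ht', map_neg]
      abel
  · refine (tower k M 0).exists_d_eq (by lia) x hx ((mappingCocone.fst (towerShift k M)).f _ w 0) ?_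
    have := congr_arg ((mappingCocone.fst (towerShift k M)).f n) hw
    rw [← injResι_fst, this]
    exact (congr_fun (hom_d (mappingCocone.fst (towerShift k M)) w) 0).symm

end Resolution

/-! ### Torsion submodules of injective modules -/

section Torsion
variable {S : Type u} [CommRing S]

/-- The submodule of elements killed by a power of the ideal `a`. -/
def powTorsion (a : Ideal S) (M : Type*) [AddCommGroup M] [Module S M] : Submodule S M where
  carrier := {x | ∃ n : ℕ, ∀ s ∈ a ^ n, s • x = 0}
  zero_mem' := ⟨0, fun s _ => smul_zero s⟩
  add_mem' := by
    rintro x y ⟨n, hn⟩ ⟨m, hm⟩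
    exact ⟨n + m, fun s hs => by
      rw [smul_add, hn s (Ideal.pow_le_pow_right (Nat.le_add_right n m) hs),
        hm s (Ideal.pow_le_pow_right (Nat.le_add_left m n) hs), add_zero]⟩
  smul_mem' := by
    rintro c x ⟨n, hn⟩
    exact ⟨n, fun s hs => by rw [smul_comm, hn s hs, smul_zero]⟩

section
variable {M N : Type*} [AddCommGroup M] [Module S M] [AddCommGroup N] [Module S N]

theorem map_mem_powTorsion {a : Ideal S} (f : M →ₗ[S] N) {x : M} (hx : x ∈ powTorsion a M) :
    f x ∈ powTorsion a N := by
  obtain ⟨n, hn⟩ := hx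
  exact ⟨n, fun s hs => by rw [← map_smul, hn s hs, map_zero]⟩

theorem map_mem_powTorsion_iff {a : Ideal S} (f : M →ₗ[S] N) (hf : Function.Injective f) {x : M} :
    f x ∈ powTorsion a N ↔ x ∈ powTorsion a M := by
  refine ⟨?_, map_mem_powTorsion f⟩
  rintro ⟨n, hn⟩
  exact ⟨n, fun s hs => hf (by rw [map_smul, hn s hs, map_zero])⟩

theorem mem_powTorsion_sup {a b : Ideal S} {x : M} :
    x ∈ powTorsion (a ⊔ b) M ↔ x ∈ powTorsion a M ∧ x ∈ powTorsion b M := by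
  constructor
  · rintro ⟨n, hn⟩
    exact ⟨⟨n, fun s hs => hn s (Ideal.pow_right_mono le_sup_left n hs)⟩,
      ⟨n, fun s hs => hn s (Ideal.pow_right_mono le_sup_right n hs)⟩⟩
  · rintro ⟨⟨n, hn⟩, ⟨m, hm⟩⟩
    refine ⟨n + m, fun s hs => ?_⟩
    obtain ⟨u, hu, v, hv, rfl⟩ := Submodule.mem_sup.1 (Ideal.sup_pow_add_le_pow_sup_pow hs)
    rw [add_smul, hn u hu, hm v hv, add_zero]

theorem mem_powTorsion_span_singleton {c : S} {x : M} :
    x ∈ powTorsion (Ideal.span {c}) M ↔ ∃ n : ℕ, c ^ n • x = 0 := by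
  refine exists_congr fun n => ⟨fun h => h _ (Ideal.pow_mem_pow (Ideal.mem_span_singleton_self c) n),
    fun h s hs => ?_⟩
  rw [Ideal.span_singleton_pow, Ideal.mem_span_singleton'] at hs
  obtain ⟨t, rfl⟩ := hs
  rw [mul_smul, h, smul_zero]

end

/-- The subcomplex of elements killed by a power of the ideal `a`. -/
noncomputable def torsionSub (a : Ideal S) (K : Cplx S) : Cplx S :=
  subCplx K (fun n => powTorsion a (K.X n)) fun i j _ hx => map_mem_powTorsion (K.d i j).hom hx

/-- The inclusion of the torsion subcomplex. -/
noncomputable def torsionSub.ι (a : Ideal S) (K : Cplx S) : torsionSub a K ⟶ K :=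
  subCplx.ι _ _ _

theorem torsionSub.ι_injective (a : Ideal S) (K : Cplx S) (n : ℤ) :
    Function.Injective ((torsionSub.ι a K).f n) :=
  subCplx.ι_injective _ _ _ n

theorem torsionSub.mem_range_iff (a : Ideal S) (K : Cplx S) (n : ℤ) (x : K.X n) :
    (∃ y, (torsionSub.ι a K).f n y = x) ↔ x ∈ powTorsion a (K.X n) :=
  ⟨fun ⟨y, hy⟩ => hy ▸ y.2, fun h => ⟨⟨x, h⟩, rfl⟩⟩

/-- Maps to an injective module extend along a map that need not be injective, provided that they
vanish on its kernel. -/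
theorem exists_linearMap_of_ker_le {A B : Type u} [AddCommGroup A] [Module S A] [AddCommGroup B]
    [Module S B] {X : ModuleCat.{u} S} [Injective X] (f : A →ₗ[S] B) (g : A →ₗ[S] X)
    (h : ∀ a, f a = 0 → g a = 0) : ∃ e : B →ₗ[S] X, ∀ a, e (f a) = g a := by
  let p := LinearMap.ker f
  let f' : ModuleCat.of S (A ⧸ p) ⟶ ModuleCat.of S B := ModuleCat.ofHom (p.liftQ f le_rfl)
  let g' : ModuleCat.of S (A ⧸ p) ⟶ X := ModuleCat.ofHom (p.liftQ g fun a ha => h a ha)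
  have : Mono f' := by
    rw [ModuleCat.mono_iff_injective]
    exact LinearMap.ker_eq_bot.1 (Submodule.ker_liftQ_eq_bot' _ _ rfl)
  exact ⟨(Injective.factorThru g' f').hom, fun a =>
    ConcreteCategory.congr_hom (Injective.comp_factorThru g' f') (p.mkQ a)⟩

/-- A map from a finitely generated module with torsion values is killed by a single power of the
ideal. -/
theorem exists_pow_smul_eq_zero {a : Ideal S} {A M : Type*} [AddCommGroup A] [Module S A]
    [AddCommGroup M] [Module S M] [Module.Finite S A] (g : A →ₗ[S] M)
    (hg : ∀ x, g x ∈ powTorsion a M) : ∃ n : ℕ, ∀ s ∈ a ^ n, ∀ x, s • g x = 0 := by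
  suffices h : ∀ P : Submodule S A, P.FG → ∃ n : ℕ, ∀ s ∈ a ^ n, ∀ x ∈ P, s • g x = 0 by
    obtain ⟨n, hn⟩ := h ⊤ Module.Finite.fg_top
    exact ⟨n, fun s hs x => hn s hs x trivial⟩
  intro P hP
  induction P, hP using Submodule.fg_induction with
  | singleton x =>
    obtain ⟨n, hn⟩ := hg x
    refine ⟨n, fun s hs y hy => ?_⟩
    obtain ⟨t, rfl⟩ := Submodule.mem_span_singleton.1 hy
    rw [map_smul, smul_comm, hn s hs, smul_zero]
  | sup N₁ N₂ _ _ h₁ h₂ =>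
    obtain ⟨n, hn⟩ := h₁
    obtain ⟨m, hm⟩ := h₂
    refine ⟨n + m, fun s hs x hx => ?_⟩
    obtain ⟨y, hy, z, hz, rfl⟩ := Submodule.mem_sup.1 hx
    rw [map_add, smul_add, hn s (Ideal.pow_le_pow_right (Nat.le_add_right n m) hs) y hy,
      hm s (Ideal.pow_le_pow_right (Nat.le_add_left m n) hs) z hz, add_zero]

variable [IsNoetherianRing S]

/-- Over a noetherian ring the torsion submodule of an injective module is injective. By the
Artin-Rees lemma a map from an ideal `J` to it kills `J ∩ aᵐ` for some `m`, so that it extends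
to a map that vanishes on `aᵐ`. -/
theorem injective_powTorsion (a : Ideal S) (X : ModuleCat.{u} S) [Injective X] :
    Injective (ModuleCat.of S (powTorsion a X)) := by
  have : Module.Baer S (powTorsion a X) := by
    intro J g
    obtain ⟨n, hn⟩ := exists_pow_smul_eq_zero (a := a) ((powTorsion a X).subtype ∘ₗ g)
      fun j => (g j).2
    obtain ⟨m, hm⟩ : ∃ m, a ^ m ⊓ J ≤ a ^ n * J := by
      obtain ⟨l, hl⟩ := Ideal.exists_pow_inf_eq_pow_smul a (M := S) J
      refine ⟨n + l, ?_⟩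
      have := hl (n + l) (Nat.le_add_left l n)
      simp only [smul_eq_mul, Ideal.mul_top, Nat.add_sub_cancel] at this
      rw [this]
      exact Ideal.mul_mono_right inf_le_right
    have hg (j : J) (hj : (j : S) ∈ a ^ m) : g j = 0 := by
      suffices h : ∀ s ∈ a ^ n * J, ∀ hs : s ∈ J, g ⟨s, hs⟩ = 0 from h j (hm ⟨hj, j.2⟩) j.2
      have hJ : a ^ n * J ≤ J := Ideal.mul_le_right
      intro s hs
      induction hs using Submodule.mul_induction_on' with
      | mem_mul_mem s hs t ht =>
        intro h
        refine Subtype.ext ?_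
        have : (⟨s * t, h⟩ : J) = s • ⟨t, ht⟩ := rfl
        rw [this, map_smul]
        exact hn s hs ⟨t, ht⟩
      | add x hx y hy h₁ h₂ =>
        intro h
        have hx' : x ∈ J := hJ hx
        have hy' : y ∈ J := hJ hy
        have : (⟨x + y, h⟩ : J) = ⟨x, hx'⟩ + ⟨y, hy'⟩ := rfl
        rw [this, map_add, h₁ hx', h₂ hy', add_zero]
    obtain ⟨e, he⟩ := exists_linearMap_of_ker_le (X := X) ((a ^ m).mkQ ∘ₗ J.subtype)
      ((powTorsion a X).subtype ∘ₗ g) (fun j hj =>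
        congr_arg Subtype.val (hg j ((Submodule.Quotient.mk_eq_zero _).1 hj)))
    have he' (s : S) : s • e ((a ^ m).mkQ 1) = e ((a ^ m).mkQ s) := by
      rw [← map_smul, ← map_smul, smul_eq_mul, mul_one]
    -- the extension is the composite of `S → S ⧸ aᵐ` with `e`, so that it has torsion values
    refine ⟨LinearMap.toSpanSingleton S _ ⟨e ((a ^ m).mkQ 1), m, fun s hs => ?_⟩,
      fun x hx => Subtype.ext ?_⟩
    · rw [he', show (a ^ m).mkQ s = 0 from (Submodule.Quotient.mk_eq_zero _).2 hs, map_zero]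
    · exact (he' x).trans (he ⟨x, hx⟩)
  have := Module.Baer.injective this
  exact Module.injective_object_of_injective_module S _

instance (a : Ideal S) (K : Cplx S) (n : ℤ) [Injective (K.X n)] :
    Injective ((torsionSub a K).X n) :=
  injective_powTorsion a (K.X n)

/-- If `X` is injective then `c` is surjective on the quotient of `X` by its `c`-torsion: for `n` such
that the annihilators of `cⁿ` and `cⁿ⁺¹` agree, `cⁿ⁺¹ ↦ cⁿ y` is well-defined on the ideal
generated by `cⁿ⁺¹` and extends to `S`. -/
theorem exists_smul_sub_mem_powTorsion (c : S) (X : ModuleCat.{u} S) [Injective X] (y : X) :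
    ∃ z : X, c • z - y ∈ powTorsion (Ideal.span {c}) X := by
  obtain ⟨n, hn⟩ := monotone_stabilizes_iff_noetherian.2 ‹IsNoetherianRing S›
    ⟨fun n => LinearMap.ker (LinearMap.lsmul S S (c ^ n)), by
      intro n m h s hs
      obtain ⟨l, rfl⟩ := Nat.exists_eq_add_of_le h
      have hs : c ^ n * s = 0 := hs
      change c ^ (n + l) * s = 0
      rw [pow_add, mul_right_comm, hs, zero_mul]⟩
  obtain ⟨e, he⟩ := exists_linearMap_of_ker_le (X := X)
    (LinearMap.lsmul S S (c ^ (n + 1))) (LinearMap.toSpanSingleton S X (c ^ n • y)) (fun s hs => by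
      have hs' : s ∈ LinearMap.ker (LinearMap.lsmul S S (c ^ n)) := by
        have := hn (n + 1) (Nat.le_succ n)
        exact (SetLike.ext_iff.1 this s).2 hs
      have hs' : c ^ n * s = 0 := hs'
      change s • c ^ n • y = 0
      rw [smul_smul, mul_comm, hs', zero_smul])
  refine ⟨e (1 : S), mem_powTorsion_span_singleton.2 ⟨n, ?_⟩⟩
  have h₁ : e (c ^ (n + 1) • 1) = (1 : S) • c ^ n • y := he 1
  rw [smul_sub, smul_smul, ← pow_succ, ← map_smul, h₁, one_smul, sub_self]

end Torsion

/-! ### Vanishing of `Hom` by completeness -/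

section Short
variable {S : Type u} [CommRing S]

theorem exists_factor_of_surjective {A B X : ModuleCat.{u} S} (p : A ⟶ B)
    (hp : Function.Surjective p) (g : A ⟶ X) (h : ∀ a, p a = 0 → g a = 0) :
    ∃ e : B ⟶ X, p ≫ e = g := by
  let K := LinearMap.ker p.hom
  refine ⟨ModuleCat.ofHom ((K.liftQ g.hom fun a ha => h a ha) ∘ₗ
    (p.hom.quotKerEquivOfSurjective hp).symm.toLinearMap), ?_⟩
  ext a
  have : (p.hom.quotKerEquivOfSurjective hp).symm (p a) = K.mkQ a := by
    rw [LinearEquiv.symm_apply_eq]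
    rfl
  change (K.liftQ g.hom fun a ha => h a ha)
    ((p.hom.quotKerEquivOfSurjective hp).symm (p a)) = g a
  rw [this]
  rfl

variable {N' N N'' : Cplx S} {i : N' ⟶ N} {π : N ⟶ N''}

theorem cochain_epi_cancel {X : Cplx S} (hπ : ∀ n, Function.Surjective (π.f n)) {n : ℤ}
    {z z' : Cochain N'' X n} (h : (Cochain.ofHom π).comp z (zero_add n) =
      (Cochain.ofHom π).comp z' (zero_add n)) : z = z' := by
  refine Cochain.ext _ _ fun p q hpq => ?_
  have h' := Cochain.congr_v h p q hpq
  simp only [Cochain.zero_cochain_comp_v, Cochain.ofHom_v] at h'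
  have := (ModuleCat.epi_iff_surjective (π.f p)).2 (hπ p)
  exact (cancel_epi (π.f p)).1 h'

theorem exists_cochain_extension {X : Cplx S} (hi : ∀ n, Function.Injective (i.f n))
    [∀ n, Injective (X.X n)] {n : ℤ} (z : Cochain N' X n) :
    ∃ w : Cochain N X n, (Cochain.ofHom i).comp w (zero_add n) = z := by
  have hm (p : ℤ) : Mono (i.f p) := (ModuleCat.mono_iff_injective (i.f p)).2 (hi p)
  refine ⟨Cochain.mk fun p q hpq => Injective.factorThru (z.v p q hpq) (i.f p), ?_⟩
  refine Cochain.ext _ _ fun p q hpq => ?_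
  simp

theorem exists_cochain_factor {X : Cplx S} (hπ : ∀ n, Function.Surjective (π.f n))
    (hex : ∀ n x, π.f n x = 0 → ∃ y, i.f n y = x) {n : ℤ} (z : Cochain N X n)
    (hz : (Cochain.ofHom i).comp z (zero_add n) = 0) :
    ∃ w : Cochain N'' X n, (Cochain.ofHom π).comp w (zero_add n) = z := by
  have h (p q : ℤ) (hpq : p + n = q) : ∃ e : N''.X p ⟶ X.X q, π.f p ≫ e = z.v p q hpq := by
    refine exists_factor_of_surjective _ (hπ p) _ fun a ha => ?_
    obtain ⟨y, rfl⟩ := hex p a ha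
    have h' := Cochain.congr_v hz p q hpq
    simp only [Cochain.zero_cochain_comp_v, Cochain.ofHom_v] at h'
    exact ConcreteCategory.congr_hom h' y
  choose e he using h
  refine ⟨Cochain.mk e, Cochain.ext _ _ fun p q hpq => ?_⟩
  simp [he]

/-- For a short exact sequence `N' → N → N''` and a complex of injectives `X` such that
`Hom(N'', X)` is acyclic, `Hom(N, X) → Hom(N', X)` is a quasi-isomorphism. -/
theorem homMap_quasiIso_of_acyclic_quotient {X : Cplx S} (hi : ∀ n, Function.Injective (i.f n))
    (hπ : ∀ n, Function.Surjective (π.f n)) (hex : ∀ n x, π.f n x = 0 ↔ ∃ y, i.f n y = x)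
    [∀ n, Injective (X.X n)] (hX : (homCplx N'' X).Acyclic) : QuasiIso (homMap i (𝟙 X)) := by
  have hcomp : i ≫ π = 0 := by
    ext n x
    exact (hex n _).2 ⟨x, rfl⟩
  have hcomp' {n : ℤ} (z : Cochain N'' X n) : (Cochain.ofHom i).comp
      ((Cochain.ofHom π).comp z (zero_add n)) (zero_add n) = 0 := by
    rw [← Cochain.comp_assoc_of_first_is_zero_cochain, ← Cochain.ofHom_comp, hcomp,
      Cochain.ofHom_zero, Cochain.zero_comp]
  refine (quasiIso_homMap_left_iff i X).2 ⟨fun m n hm y hy => ?_, fun m n hm x w hx hw => ?_⟩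
  · obtain ⟨y', rfl⟩ := exists_cochain_extension hi y
    rw [δ_ofHom_comp] at hy
    obtain ⟨u, hu⟩ := exists_cochain_factor hπ (fun n x => (hex n x).1) _ hy
    obtain ⟨v, rfl⟩ := exists_δ_eq hX u rfl (cochain_epi_cancel hπ (by
      rw [← δ_ofHom_comp, hu, δ_δ, Cochain.comp_zero])) n rfl
    refine ⟨y' - (Cochain.ofHom π).comp v (zero_add n), 0, ?_, ?_⟩
    · rw [δ_sub, ← hu, δ_ofHom_comp, sub_self]
    · rw [Cochain.comp_sub, hcomp', δ_zero, sub_zero, add_zero]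
  · obtain ⟨w', rfl⟩ := exists_cochain_extension hi w
    obtain ⟨u, hu⟩ := exists_cochain_factor hπ (fun n x => (hex n x).1) (x - δ m n w') (by
      rw [Cochain.comp_sub, hw, δ_ofHom_comp, sub_self])
    obtain ⟨v, rfl⟩ := exists_δ_eq hX u rfl (cochain_epi_cancel hπ (by
      rw [← δ_ofHom_comp, hu, δ_sub, hx, δ_δ, sub_zero, Cochain.comp_zero])) m hm
    refine ⟨w' + (Cochain.ofHom π).comp v (zero_add m), ?_⟩
    rw [δ_add, δ_ofHom_comp, hu, add_sub_cancel]

end Short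

section Complete
variable {S : Type u} [CommRing S]

theorem exists_shortComplex_class (T : ShortComplex (ModuleCat.{u} S)) :
    ∃ π : LinearMap.ker T.g.hom →ₗ[S] T.homology, Function.Surjective π ∧
      ∀ x, π x = 0 ↔ ∃ w, T.f w = x.1 := by
  let e : (LinearMap.ker T.g.hom ⧸ LinearMap.range T.moduleCatToCycles) ≃ₗ[S] T.homology :=
    T.moduleCatHomologyIso.symm.toLinearEquiv
  refine ⟨e.toLinearMap ∘ₗ (LinearMap.range T.moduleCatToCycles).mkQ,
    e.surjective.comp (Submodule.mkQ_surjective _), fun x => ?_⟩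
  refine (LinearEquiv.map_eq_zero_iff e).trans
    ((Submodule.Quotient.mk_eq_zero _).trans ⟨?_, ?_⟩)
  · rintro ⟨w, hw⟩
    exact ⟨w, congr_arg Subtype.val hw⟩
  · rintro ⟨w, hw⟩
    exact ⟨w, Subtype.ext hw⟩

/-- The cohomology module as the quotient of the cocycles by the boundaries. -/
theorem exists_cocycle_class (K : Cplx S) {m n l : ℤ} (hm : m + 1 = n) (hl : n + 1 = l) :
    ∃ π : LinearMap.ker (K.d n l).hom →ₗ[S] K.homology n, Function.Surjective π ∧
      ∀ x, π x = 0 ↔ ∃ w, K.d m n w = x.1 := by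
  obtain ⟨π, h₁, h₂⟩ := exists_shortComplex_class (K.sc' m n l)
  let e := (ShortComplex.homologyMapIso
    (K.isoSc' m n l (by simp [← hm]) (by simp [← hl]))).symm.toLinearEquiv
  exact ⟨e.toLinearMap ∘ₗ π, e.surjective.comp h₁, fun x =>
    (LinearEquiv.map_eq_zero_iff e).trans (h₂ x)⟩

/-- The limit of a tower of copies of `H` with `x` as transition maps vanishes if `H` is separated. -/
theorem eq_zero_of_isHausdorff {I : Ideal S} {H : Type*} [AddCommGroup H] [Module S H]
    [IsHausdorff I H] {x : S} (hx : x ∈ I) (y : ℕ → H) (hy : ∀ s, y s = x • y (s + 1)) (s : ℕ) :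
    y s = 0 := by
  refine IsHausdorff.haus ‹_› _ fun n => ?_
  rw [SModEq.zero]
  have h : y s = x ^ n • y (s + n) := by
    induction n with
    | zero => simp
    | succ n ih => rw [ih, hy, smul_smul, ← pow_succ, add_assoc]
  rw [h]
  exact Submodule.smul_mem_smul (Ideal.pow_mem_pow hx n) trivial

/-- The derived limit of the tower of copies of `S` with `x` as transition maps vanishes if `S` is
complete: the solution is `y s = ∑ xⁱ h (s + i)`. -/
theorem exists_solution_self {I : Ideal S} [IsAdicComplete I S] {x : S} (hx : x ∈ I) (h : ℕ → S) :
    ∃ y : ℕ → S, ∀ s, y s - x * y (s + 1) = h s := by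
  let f (s n : ℕ) : S := ∑ i ∈ Finset.range n, x ^ i * h (s + i)
  have hf (s n : ℕ) : f s (n + 1) = h s + x * f (s + 1) n := by
    simp only [f]
    rw [Finset.sum_range_succ', Finset.mul_sum, add_comm]
    congr 1
    · simp
    · exact Finset.sum_congr rfl fun i _ => by rw [pow_succ', mul_assoc, add_right_comm, add_assoc]
  have hc (s : ℕ) : ∃ L : S, ∀ n, f s n ≡ L [SMOD (I ^ n • ⊤ : Submodule S S)] := by
    refine IsPrecomplete.prec' _ fun {m n} hmn => ?_
    rw [SModEq.sub_mem]
    obtain ⟨l, rfl⟩ := Nat.exists_eq_add_of_le hmn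
    have : f s m - f s (m + l) = -∑ i ∈ Finset.range l, x ^ (m + i) * h (s + (m + i)) := by
      simp only [f, Finset.sum_range_add]
      abel
    rw [this, smul_eq_mul, Ideal.mul_top]
    refine neg_mem (Ideal.sum_mem _ fun i _ => Ideal.mul_mem_right _ _ ?_)
    exact Ideal.pow_le_pow_right (Nat.le_add_right m i) (Ideal.pow_mem_pow hx _)
  choose y hy using hc
  refine ⟨y, fun s => ?_⟩
  rw [← sub_eq_zero]
  refine IsHausdorff.haus (I := I) inferInstance _ fun n => ?_
  rw [SModEq.zero]
  have h₁ := SModEq.sub_mem.1 (hy s (n + 1))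
  have h₂ := SModEq.sub_mem.1 (hy (s + 1) n)
  simp only [smul_eq_mul, Ideal.mul_top] at h₁ h₂ ⊢
  have h₃ := Ideal.add_mem _ (Ideal.neg_mem_iff _ |>.2 (Ideal.pow_le_pow_right (Nat.le_succ n) h₁))
    (Ideal.mul_mem_left _ x h₂)
  rw [hf] at h₃
  convert h₃ using 1
  ring

/-- The derived limit of a tower of copies of a finitely generated module with `x` as transition maps
vanishes if `S` is complete. -/
theorem exists_solution_of_isAdicComplete {I : Ideal S} [IsAdicComplete I S] {H : Type*}
    [AddCommGroup H] [Module S H] [Module.Finite S H] {x : S} (hx : x ∈ I) (h : ℕ → H) :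
    ∃ y : ℕ → H, ∀ s, y s - x • y (s + 1) = h s := by
  obtain ⟨n, p, hp⟩ := Module.Finite.exists_fin' S H
  choose h' hh' using fun s => hp (h s)
  choose y hy using fun i => exists_solution_self hx (fun s => h' s i)
  refine ⟨fun s => p (fun i => y i s), fun s => ?_⟩
  rw [← map_smul, ← map_sub, ← hh']
  exact congr_arg p (funext fun i => hy i s)

/-- The map `1 - x · shift` on a countable power of a complex. -/
noncomputable def smulShift (x : S) (I : Cplx S) :
    piCplx (fun _ : ℕ => I) ⟶ piCplx (fun _ : ℕ => I) :=
  piCplx.lift fun s => piCplx.π _ s - x • piCplx.π _ (s + 1)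

variable [IsLocalRing S] [IsNoetherianRing S] [IsAdicComplete (IsLocalRing.maximalIdeal S) S]

/-- If `I` has finitely generated cohomology, over a complete ring, then the homotopy limit of the tower
of copies of `I` with `x` as transition maps is acyclic, for `x` in the maximal ideal. -/
theorem acyclic_cocone_smulShift {x : S} (hx : x ∈ IsLocalRing.maximalIdeal S) (I : Cplx S)
    (hI : ∀ n, Module.Finite S (I.homology n)) : (mappingCocone (smulShift x I)).Acyclic := by
  intro n
  rw [exactAt_iff_elements]
  intro y hy
  have hn : n - 1 + 1 = n := by lia
  let r (s : ℕ) : I.X n := (mappingCocone.fst (smulShift x I)).f n y s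
  let t (s : ℕ) : I.X (n - 1) := coconeSnd (smulShift x I) hn y s
  have hr (s : ℕ) : I.d n (n + 1) (r s) = 0 := by
    have := hom_d (mappingCocone.fst (smulShift x I)) y (j := n + 1)
    rw [hy, map_zero] at this
    exact congr_fun this s
  have ht (s : ℕ) : r s - x • r (s + 1) = -I.d (n - 1) n (t s) := by
    have := coconeSnd_d (g := smulShift x I) hn rfl y
    rw [hy, coconeSnd_zero, zero_eq_neg, add_eq_zero_iff_eq_neg] at this
    exact congr_fun this s
  -- the classes of the `r s` form an element of the limit, which vanishes
  have hv (s : ℕ) : ∃ v, I.d (n - 1) n v = r s := by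
    obtain ⟨π, -, hπ⟩ := exists_cocycle_class I hn (rfl : n + 1 = n + 1)
    have := hI n
    refine (hπ ⟨r s, hr s⟩).1 (eq_zero_of_isHausdorff hx (fun s => π ⟨r s, hr s⟩) (fun s => ?_) s)
    rw [← map_smul, ← sub_eq_zero, ← map_sub, hπ]
    exact ⟨-t s, by rw [map_neg]; exact (ht s).symm⟩
  choose v hv using hv
  obtain ⟨t', ht'⟩ : ∃ t' : ℕ → I.X (n - 1), ∀ s, t' s = t s + (v s - x • v (s + 1)) :=
    ⟨_, fun _ => rfl⟩
  have ht'' (s : ℕ) : I.d (n - 1) n (t' s) = 0 := by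
    have h₁ := ht s
    rw [← hv, ← hv] at h₁
    rw [ht', map_add, map_sub, map_smul, h₁, add_neg_cancel]
  -- the classes of the `t' s` form an element of the derived limit, which vanishes
  obtain ⟨c, e, hc, hce⟩ : ∃ (c : ℕ → I.X (n - 1)) (e : ℕ → I.X (n - 1 - 1)),
      (∀ s, I.d (n - 1) n (c s) = 0) ∧
      ∀ s, c s - x • c (s + 1) = -t' s + I.d (n - 1 - 1) (n - 1) (e s) := by
    obtain ⟨π, hπ, hπ'⟩ := exists_cocycle_class I (show n - 1 - 1 + 1 = n - 1 by lia) hn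
    have := hI (n - 1)
    obtain ⟨Y, hY⟩ := exists_solution_of_isAdicComplete hx (fun s => π (-⟨t' s, ht'' s⟩))
    choose c hc using fun s => hπ (Y s)
    have h (s : ℕ) : ∃ e, I.d (n - 1 - 1) (n - 1) e =
        (c s - x • c (s + 1) - -⟨t' s, ht'' s⟩ : LinearMap.ker (I.d (n - 1) n).hom).1 := by
      rw [← hπ', map_sub, map_sub, map_smul, hc, hc, hY, sub_self]
    choose e he using h
    refine ⟨fun s => (c s).1, e, fun s => (c s).2, fun s => ?_⟩
    rw [he]
    change (c s).1 - x • (c (s + 1)).1 = -t' s + ((c s).1 - x • (c (s + 1)).1 - -t' s)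
    abel
  refine ⟨coconeMk (smulShift x I) (show n - 1 - 1 + 1 = n - 1 by lia) (fun s => v s + c s)
    (fun s => -e s), ?_⟩
  refine Eq.symm (Eq.trans (cocone_eq_add_d hn _ y 0 _ _ ?_ ?_) (zero_add _))
  · rw [map_zero, zero_add]
    funext s
    change r s = I.d (n - 1) n (v s + c s)
    rw [map_add, hv, hc, add_zero]
  · rw [coconeSnd_zero, zero_add]
    funext s
    change t s = -((v s + c s - x • (v (s + 1) + c (s + 1))) + I.d (n - 1 - 1) (n - 1) (-e s))
    have h₁ := hce s
    rw [ht', sub_eq_iff_eq_add] at h₁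
    rw [h₁, map_neg, smul_add]
    abel

/-- If `x` in the maximal ideal acts bijectively on `N` then `Hom(N, I)` is acyclic for every
K-injective complex `I` with finitely generated cohomology: with `θ` the inverse of `x`, a cocycle
`z` is the first member of the compatible family `z θˢ`, a cochain with values in the homotopy limit
of the tower of copies of `I` with `x` as transition maps, which is acyclic. -/
theorem homCplx_acyclic_of_smul {x : S} (hx : x ∈ IsLocalRing.maximalIdeal S) {N : Cplx S}
    (θ : N ⟶ N) (hθ : x • θ = 𝟙 N) (I : Cplx S) [I.IsKInjective]
    (hI : ∀ n, Module.Finite S (I.homology n)) : (homCplx N I).Acyclic := by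
  have hC := homCplx_acyclic_of_acyclic_right N (acyclic_cocone_smulShift hx I hI)
  refine (homCplx_acyclic_iff _ _).2 fun n z hz => ?_
  let e (s : ℕ) : N ⟶ N := Nat.rec (𝟙 N) (fun _ f => f ≫ θ) s
  have he (s : ℕ) : x • e (s + 1) = e s := by
    change x • (e s ≫ θ) = e s
    rw [← Linear.comp_smul, hθ, Category.comp_id]
  let ζ : Cochain N (piCplx (fun _ : ℕ => I)) n :=
    piCplx.liftCochain fun s => (Cochain.ofHom (e s)).comp z (zero_add n)
  have h₁ : δ n (n + 1) ζ = 0 := piCplx.cochain_ext fun s => by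
    rw [← δ_comp_ofHom, piCplx.liftCochain_π, δ_ofHom_comp, hz, Cochain.comp_zero,
      Cochain.zero_comp]
  have h₂ : ζ.comp (Cochain.ofHom (smulShift x I)) (add_zero n) = 0 := by
    refine piCplx.cochain_ext fun s => Cochain.ext _ _ fun p q hpq => ?_
    ext a
    have h : z.v p q hpq ((e s).f p a) - x • z.v p q hpq ((e (s + 1)).f p a) = 0 := by
      have h₀ : (e s).f p a = x • (e (s + 1)).f p a :=
        (ConcreteCategory.congr_hom (congr_arg (fun f => HomologicalComplex.Hom.f f p) (he s))
          a).symm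
      rw [h₀, map_smul, sub_self]
    simp only [Cochain.comp_zero_cochain_v, Cochain.ofHom_v, Cochain.zero_v, zero_comp]
    refine Eq.trans ?_ h
    simp only [ζ, piCplx.liftCochain, Cochain.zero_cochain_comp_v, Cochain.ofHom_v]
    rfl
  obtain ⟨w, hw⟩ := exists_δ_eq hC (mappingCocone.liftCochain (smulShift x I) ζ
    (0 : Cochain N _ (n - 1)) (by lia)) rfl (by
      rw [δ_cocone_lift _ _ rfl, h₁, h₂, δ_zero, add_zero, neg_zero, cocone_zero_lift])
    (n - 1) (by lia)
  obtain ⟨α, β, rfl⟩ := cocone_cochain_eq_lift _ (show n - 1 - 1 + 1 = n - 1 by lia) w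
  rw [δ_cocone_lift _ _ (by lia), lift_eq_lift_iff] at hw
  refine ⟨α.comp (Cochain.ofHom (piCplx.π _ 0)) (add_zero _), ?_⟩
  rw [δ_comp_ofHom, hw.1, piCplx.liftCochain_π]
  exact Cochain.id_comp z

end Complete

/-! ### Homomorphisms out of torsion subcomplexes -/

section HomTorsion
variable {S : Type u} [CommRing S]

/-- The lift of a morphism with torsion values to the torsion subcomplex. -/
noncomputable def torsionSub.lift (a : Ideal S) {K K' : Cplx S} (f : K' ⟶ K)
    (hf : ∀ n x, f.f n x ∈ powTorsion a (K.X n)) : K' ⟶ torsionSub a K where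
  f n := ModuleCat.ofHom ((f.f n).hom.codRestrict _ (hf n))
  comm' i j _ := by
    ext x
    exact Subtype.ext (hom_d f x)

@[simp]
theorem torsionSub.lift_ι (a : Ideal S) {K K' : Cplx S} (f : K' ⟶ K)
    (hf : ∀ n x, f.f n x ∈ powTorsion a (K.X n)) :
    torsionSub.lift a f hf ≫ torsionSub.ι a K = f := rfl

theorem torsionSub.ι_mem (a : Ideal S) (K : Cplx S) (n : ℤ) (x : (torsionSub a K).X n) :
    (torsionSub.ι a K).f n x ∈ powTorsion a (K.X n) := x.2

/-- The quotient of a complex by its torsion subcomplex. -/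
noncomputable def torsionQuot (a : Ideal S) (K : Cplx S) : Cplx S :=
  quotCplx K (fun n => powTorsion a (K.X n)) fun i j _ hx => map_mem_powTorsion (K.d i j).hom hx

/-- The projection to the quotient by the torsion subcomplex. -/
noncomputable def torsionQuot.π (a : Ideal S) (K : Cplx S) : K ⟶ torsionQuot a K :=
  quotCplx.π _ _ _

theorem torsionQuot.π_surjective (a : Ideal S) (K : Cplx S) (n : ℤ) :
    Function.Surjective ((torsionQuot.π a K).f n) :=
  quotCplx.π_surjective _ _ _ n

theorem torsionQuot.π_eq_zero_iff (a : Ideal S) (K : Cplx S) (n : ℤ) (x : K.X n) :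
    (torsionQuot.π a K).f n x = 0 ↔ x ∈ powTorsion a (K.X n) :=
  quotCplx.π_eq_zero_iff _ _ _ n x

theorem isIso_of_bijective {K L : Cplx S} (f : K ⟶ L) (hf : ∀ n, Function.Bijective (f.f n)) :
    IsIso f := by
  have (n : ℤ) : IsIso (f.f n) := (ConcreteCategory.isIso_iff_bijective (f.f n)).2 (hf n)
  exact HomologicalComplex.Hom.isIso_of_components f

theorem quasiIso_homMap_of_isIso {K K' : Cplx S} (f : K' ⟶ K) [IsIso f] (L : Cplx S) :
    QuasiIso (homMap f (𝟙 L)) := by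
  have : IsIso (homMap f (𝟙 L)) := ⟨homMap (inv f) (𝟙 L), by
    rw [← homMap_comp, IsIso.inv_hom_id, Category.comp_id, homMap_id], by
    rw [← homMap_comp, IsIso.hom_inv_id, Category.comp_id, homMap_id]⟩
  infer_instance

variable [IsNoetherianRing S]

/-- On the quotient of a complex of injectives by its `x`-torsion, `x` acts bijectively. -/
theorem exists_smul_eq_id (x : S) (J : Cplx S) [∀ n, Injective (J.X n)] :
    ∃ θ : torsionQuot (Ideal.span {x}) J ⟶ torsionQuot (Ideal.span {x}) J,
      x • θ = 𝟙 (torsionQuot (Ideal.span {x}) J) := by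
  have : IsIso (x • 𝟙 (torsionQuot (Ideal.span {x}) J)) := by
    refine isIso_of_bijective _ fun n => ⟨?_, ?_⟩
    · rw [injective_iff_map_eq_zero]
      intro y hy
      obtain ⟨y, rfl⟩ := torsionQuot.π_surjective _ J n y
      have hy : x • (torsionQuot.π _ J).f n y = 0 := hy
      rw [← map_smul, torsionQuot.π_eq_zero_iff, mem_powTorsion_span_singleton] at hy
      obtain ⟨m, hm⟩ := hy
      rw [torsionQuot.π_eq_zero_iff, mem_powTorsion_span_singleton]
      exact ⟨m + 1, by rw [pow_succ, mul_smul, hm]⟩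
    · intro y
      obtain ⟨y, rfl⟩ := torsionQuot.π_surjective _ J n y
      obtain ⟨z, hz⟩ := exists_smul_sub_mem_powTorsion x (J.X n) y
      refine ⟨(torsionQuot.π _ J).f n z, ?_⟩
      change x • (torsionQuot.π _ J).f n z = _
      rw [← sub_eq_zero, ← map_smul, ← map_sub, torsionQuot.π_eq_zero_iff]
      exact hz
  refine ⟨inv (x • 𝟙 (torsionQuot (Ideal.span {x}) J)), ?_⟩
  have := IsIso.hom_inv_id (x • 𝟙 (torsionQuot (Ideal.span {x}) J))
  rwa [Linear.smul_comp, Category.id_comp] at this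

variable [IsLocalRing S] [IsAdicComplete (IsLocalRing.maximalIdeal S) S]

/-- For a complex of injectives `J` with torsion subcomplex `J'`, the map
`Hom(J, I) → Hom(J', I)` is a quasi-isomorphism if `I` has finitely generated cohomology. The proof
is by induction on the number of generators of the ideal; for one generator `x` the quotient `J / J'`
is a complex on which `x` acts bijectively. -/
theorem homMap_torsion_quasiIso (I : Cplx S) [I.IsKInjective] [∀ n, Injective (I.X n)]
    (hI : ∀ n, Module.Finite S (I.homology n)) (a : Ideal S) (ha : a ≤ IsLocalRing.maximalIdeal S)
    {J J' : Cplx S} [∀ n, Injective (J.X n)] (i : J' ⟶ J) (hi : ∀ n, Function.Injective (i.f n))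
    (hi' : ∀ n x, (∃ y, i.f n y = x) ↔ x ∈ powTorsion a (J.X n)) : QuasiIso (homMap i (𝟙 I)) := by
  have haf : a.FG := IsNoetherian.noetherian a
  induction a, haf using Submodule.fg_induction generalizing J J' with
  | singleton x =>
    obtain ⟨θ, hθ⟩ := exists_smul_eq_id x J
    have hx : x ∈ IsLocalRing.maximalIdeal S := ha (Ideal.mem_span_singleton_self x)
    exact homMap_quasiIso_of_acyclic_quotient hi (torsionQuot.π_surjective (Ideal.span {x}) J)
      (fun n y => (torsionQuot.π_eq_zero_iff _ J n y).trans (hi' n y).symm)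
      (homCplx_acyclic_of_smul hx θ hθ I hI)
  | sup a b _ _ h₁ h₂ =>
    -- the torsion of `J` for `a ⊔ b` is the `a`-torsion of the `b`-torsion, and the latter is again a
    -- complex of injectives
    have hb (n : ℤ) (y : J'.X n) := mem_powTorsion_sup.1 ((hi' n _).1 ⟨y, rfl⟩)
    let l := torsionSub.lift b i fun n y => (hb n y).2
    have q₁ : QuasiIso (homMap (torsionSub.ι b J) (𝟙 I)) :=
      h₂ (le_sup_right.trans ha) _ (torsionSub.ι_injective b J) (torsionSub.mem_range_iff b J)
    have q₂ : QuasiIso (homMap l (𝟙 I)) := by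
      refine h₁ (le_sup_left.trans ha) l (fun n y y' h => hi n (congr_arg Subtype.val h))
        fun n y => ?_
      rw [← map_mem_powTorsion_iff ((torsionSub.ι b J).f n).hom (torsionSub.ι_injective b J n)]
      constructor
      · rintro ⟨z, rfl⟩
        exact (hb n z).1
      · intro h
        obtain ⟨z, hz⟩ := (hi' n _).2 (mem_powTorsion_sup.2 ⟨h, torsionSub.ι_mem b J n y⟩)
        exact ⟨z, torsionSub.ι_injective b J n hz⟩
    have : homMap i (𝟙 I) = homMap (torsionSub.ι b J) (𝟙 I) ≫ homMap l (𝟙 I) := by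
      rw [← homMap_comp, Category.comp_id, torsionSub.lift_ι]
    rw [this]
    infer_instance

end HomTorsion

/-! ### Dévissage from the residue field to torsion complexes -/

section Devissage
variable {S : Type u} [CommRing S] [IsLocalRing S]

open IsLocalRing

/-- Every cocycle of degree `i` killed by the maximal ideal is the boundary of an element killed
by the maximal ideal: `Ext`-vanishing for the residue field. -/
def SocleExact (C : Cplx S) (i : ℤ) : Prop :=
  ∀ x : C.X i, (∀ s ∈ maximalIdeal S, s • x = 0) → C.d i (i + 1) x = 0 →
    ∃ w : C.X (i - 1), (∀ s ∈ maximalIdeal S, s • w = 0) ∧ C.d (i - 1) i w = x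

theorem isFiniteLength_quotient_pow [IsNoetherianRing S] (n : ℕ) :
    IsFiniteLength S (S ⧸ maximalIdeal S ^ n) := by
  rcases Nat.eq_zero_or_pos n with rfl | hn
  · have : Subsingleton (S ⧸ maximalIdeal S ^ 0) := by
      rw [Submodule.Quotient.subsingleton_iff, pow_zero, Ideal.one_eq_top]
    exact .of_subsingleton
  · rw [isFiniteLength_iff_isNoetherian_isArtinian]
    have : IsArtinianRing (S ⧸ maximalIdeal S ^ n) :=
      quotient_artinian_of_mem_minimalPrimes_of_isLocalRing _
        ⟨⟨inferInstance, Ideal.pow_le_self hn.ne'⟩, fun q hq _ =>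
          have := hq.1
          (Ideal.IsPrime.pow_le_iff hn.ne').1 hq.2⟩
    exact ⟨inferInstance,
      isArtinian_of_surjective_algebraMap (Ideal.Quotient.mk_surjective (I := maximalIdeal S ^ n))⟩

theorem exists_lift_of_simple {C : Cplx S} {i : ℤ} (hC : SocleExact C i) {A : Type u}
    [AddCommGroup A] [Module S A] [IsSimpleModule S A] (f : A →ₗ[S] C.X i)
    (hf : ∀ a, C.d i (i + 1) (f a) = 0) : ∃ g : A →ₗ[S] C.X (i - 1), ∀ a, C.d (i - 1) i (g a) = f a := by
  obtain ⟨I, hI, ⟨e⟩⟩ := isSimpleModule_iff_quot_maximal.1 ‹IsSimpleModule S A›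
  obtain rfl := eq_maximalIdeal hI
  obtain ⟨w, hw, hw'⟩ := hC (f (e.symm ((maximalIdeal S).mkQ 1))) (fun s hs => by
    rw [← map_smul, ← map_smul, ← map_smul, smul_eq_mul, mul_one,
      show (maximalIdeal S).mkQ s = 0 from (Submodule.Quotient.mk_eq_zero _).2 hs, map_zero,
      map_zero]) (hf _)
  refine ⟨(maximalIdeal S).liftQ (LinearMap.toSpanSingleton S _ w) hw ∘ₗ e.toLinearMap, fun a => ?_⟩
  obtain ⟨s, hs⟩ := (maximalIdeal S).mkQ_surjective (e a)
  have ha : a = s • e.symm ((maximalIdeal S).mkQ 1) := by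
    rw [← map_smul, ← map_smul, smul_eq_mul, mul_one, hs, LinearEquiv.symm_apply_apply]
  have : ((maximalIdeal S).liftQ (LinearMap.toSpanSingleton S _ w) hw ∘ₗ e.toLinearMap) a =
      s • w := by
    rw [LinearMap.comp_apply, LinearEquiv.coe_coe, ← hs]
    rfl
  rw [this, map_smul, hw', ← map_smul, ← ha]

/-- Dévissage: `Ext`-vanishing for the residue field implies it for modules of finite length. -/
theorem exists_lift_of_isFiniteLength {C : Cplx S} {i : ℤ} [Injective (C.X (i - 1))]
    (hC : SocleExact C i) {A : Type u} [AddCommGroup A] [Module S A] (hA : IsFiniteLength S A)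
    (f : A →ₗ[S] C.X i) (hf : ∀ a, C.d i (i + 1) (f a) = 0) :
    ∃ g : A →ₗ[S] C.X (i - 1), ∀ a, C.d (i - 1) i (g a) = f a := by
  induction hA with
  | of_subsingleton => exact ⟨0, fun a => by rw [Subsingleton.elim a 0, map_zero, map_zero, map_zero]⟩
  | @of_simple_quotient A _ _ N _ hN ih =>
    obtain ⟨g, hg⟩ := ih (f ∘ₗ N.subtype) fun a => hf a
    obtain ⟨g', hg'⟩ := exists_linearMap_of_ker_le (X := C.X (i - 1)) N.subtype g fun a ha => by
      rw [show a = 0 from Subtype.ext ha, map_zero]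
    obtain ⟨h, hh⟩ := exists_lift_of_simple hC
      (N.liftQ (f - (C.d (i - 1) i).hom ∘ₗ g') fun a ha => by
        change f a - C.d (i - 1) i (g' a) = 0
        rw [show g' a = g ⟨a, ha⟩ from hg' ⟨a, ha⟩, hg]
        exact sub_self _) (fun a => by
        obtain ⟨a, rfl⟩ := N.mkQ_surjective a
        change C.d i (i + 1) (f a - C.d (i - 1) i (g' a)) = 0
        rw [map_sub, hf, d_sq, sub_zero])
    refine ⟨g' + h ∘ₗ N.mkQ, fun a => ?_⟩
    change C.d (i - 1) i (g' a + h (N.mkQ a)) = f a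
    rw [map_add, hh]
    change C.d (i - 1) i (g' a) + (f a - C.d (i - 1) i (g' a)) = f a
    rw [add_sub_cancel]

variable [IsNoetherianRing S]

/-- `Ext`-vanishing for the residue field implies it for torsion elements, which are values of maps from
`S ⧸ mⁿ`. -/
theorem exists_torsion_lift {C : Cplx S} {i : ℤ} [Injective (C.X (i - 1))] (hC : SocleExact C i)
    (x : C.X i) (hx : x ∈ powTorsion (maximalIdeal S) (C.X i)) (hd : C.d i (i + 1) x = 0) :
    ∃ w ∈ powTorsion (maximalIdeal S) (C.X (i - 1)), C.d (i - 1) i w = x := by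
  obtain ⟨n, hn⟩ := hx
  obtain ⟨g, hg⟩ := exists_lift_of_isFiniteLength hC (isFiniteLength_quotient_pow n)
    ((maximalIdeal S ^ n).liftQ (LinearMap.toSpanSingleton S _ x) hn) (fun a => by
      obtain ⟨s, rfl⟩ := (maximalIdeal S ^ n).mkQ_surjective a
      change C.d i (i + 1) (s • x) = 0
      rw [map_smul, hd, smul_zero])
  refine ⟨g ((maximalIdeal S ^ n).mkQ 1), ⟨n, fun s hs => ?_⟩, ?_⟩
  · rw [← map_smul, ← map_smul, smul_eq_mul, mul_one,
      show (maximalIdeal S ^ n).mkQ s = 0 from (Submodule.Quotient.mk_eq_zero _).2 hs, map_zero]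
  · rw [hg]
    exact one_smul S x

/-- If `C` is a bounded below complex of injectives and the cohomology of `Hom(κ, C)` vanishes then
`Hom(Y, C)` is acyclic for every complex `Y` of torsion modules: cochains on `Y` have values in the
torsion subcomplex of `C`, which is a bounded below complex of injectives, and acyclic. -/
theorem homCplx_acyclic_of_socleExact {C : Cplx S} (d : ℤ) [C.IsStrictlyGE d]
    [∀ n, Injective (C.X n)] (hC : ∀ i, SocleExact C i) {Y : Cplx S}
    (hY : ∀ n y, y ∈ powTorsion (maximalIdeal S) (Y.X n)) : (homCplx Y C).Acyclic := by
  let Γ := torsionSub (maximalIdeal S) C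
  let ι := torsionSub.ι (maximalIdeal S) C
  have hι := torsionSub.ι_injective (maximalIdeal S) C
  have : Γ.IsStrictlyGE d := by
    rw [CochainComplex.isStrictlyGE_iff]
    intro i hi
    have h := C.isZero_of_isStrictlyGE d i hi
    have : Mono (ι.f i) := (ModuleCat.mono_iff_injective _).2 (hι i)
    exact IsZero.of_mono (ι.f i) h
  have : Γ.IsKInjective := isKInjective_of_injective Γ d
  have hΓ : Γ.Acyclic := fun n => (exactAt_iff_elements Γ n).2 fun x hx => by
    obtain ⟨w, hw, hwx⟩ := exists_torsion_lift (hC n) (ι.f n x) (torsionSub.ι_mem _ C n x)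
      (by rw [hom_d, hx, map_zero])
    obtain ⟨v, rfl⟩ := (torsionSub.mem_range_iff _ C _ w).2 hw
    exact ⟨v, hι n (by rw [← hom_d]; exact hwx)⟩
  refine (homCplx_acyclic_iff _ _).2 fun n z hz => ?_
  let ζ : Cochain Y Γ n := Cochain.mk fun p q hpq =>
    ModuleCat.ofHom ((z.v p q hpq).hom.codRestrict (powTorsion (maximalIdeal S) (C.X q)) fun y =>
      map_mem_powTorsion _ (hY p y))
  have hζ : ζ.comp (Cochain.ofHom ι) (add_zero n) = z := by
    refine Cochain.ext _ _ fun p q hpq => ?_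
    rw [Cochain.comp_zero_cochain_v, Cochain.ofHom_v]
    rfl
  have hδ : δ n (n + 1) ζ = 0 := by
    refine Cochain.ext _ _ fun p q hpq => ?_
    have h : (δ n (n + 1) ζ).comp (Cochain.ofHom ι) (add_zero _) = 0 := by
      rw [← δ_comp_ofHom, hζ, hz]
    have : Mono (ι.f q) := (ModuleCat.mono_iff_injective _).2 (hι q)
    rw [← cancel_mono (ι.f q)]
    simpa using Cochain.congr_v h p q hpq
  obtain ⟨w, hw⟩ := exists_δ_eq (homCplx_acyclic_of_acyclic_right Y hΓ) ζ rfl hδ (n - 1) (by lia)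
  exact ⟨w.comp (Cochain.ofHom ι) (add_zero _), by rw [δ_comp_ofHom, hw, hζ]⟩

end Devissage

/-! ### Cochains on the residue field -/

section ResidueField
variable {S : Type u} [CommRing S] [IsLocalRing S]

open IsLocalRing

variable (S) in
/-- The residue field as an `S`-module. -/
noncomputable abbrev residueModule : ModuleCat.{u} S := ModuleCat.of S (ResidueField S)

theorem smul_residueModule (s : S) (hs : s ∈ maximalIdeal S) (y : residueModule S) : s • y = 0 := by
  obtain ⟨t, rfl⟩ := residue_surjective (R := S) y
  change s • residue S t = 0
  rw [Algebra.smul_def, ← ResidueField.algebraMap_eq, ← map_mul, ResidueField.algebraMap_eq,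
    residue_eq_zero_iff]
  exact Ideal.mul_mem_right t _ hs

theorem exists_smul_one_eq (y : residueModule S) : ∃ s : S, s • (1 : ResidueField S) = y := by
  obtain ⟨t, rfl⟩ := residue_surjective (R := S) y
  exact ⟨t, by rw [Algebra.smul_def, mul_one]; rfl⟩

theorem residueModule_hom_ext {X : ModuleCat.{u} S} {f g : residueModule S ⟶ X}
    (h : f (1 : ResidueField S) = g (1 : ResidueField S)) : f = g := by
  ext y
  obtain ⟨s, rfl⟩ := exists_smul_one_eq y
  exact (map_smul f.hom s _).trans ((congrArg (s • ·) h).trans (map_smul g.hom s _).symm)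

theorem exists_residueModule_hom {X : ModuleCat.{u} S} (x : X)
    (hx : ∀ s ∈ maximalIdeal S, s • x = 0) :
    ∃ f : residueModule S ⟶ X, f (1 : ResidueField S) = x := by
  obtain ⟨f, hf⟩ : ∃ f : (S ⧸ maximalIdeal S) →ₗ[S] X, f ((maximalIdeal S).mkQ 1) = x :=
    ⟨(maximalIdeal S).liftQ (LinearMap.toSpanSingleton S _ x) hx, one_smul S x⟩
  exact ⟨ModuleCat.ofHom (X := residueModule S) f, hf⟩

variable (S) in
/-- The residue field as a complex concentrated in degree `0`. -/
noncomputable abbrev residueCplx : Cplx S :=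
  (CochainComplex.singleFunctor (ModuleCat.{u} S) 0).obj (residueModule S)

/-- Elements of `C` killed by the maximal ideal are values of cochains on the residue field. -/
theorem exists_residue_cochain (C : Cplx S) {n : ℤ} (x : C.X n)
    (hx : ∀ s ∈ maximalIdeal S, s • x = 0) (hd : C.d n (n + 1) x = 0) :
    ∃ f : residueModule S ⟶ C.X n, f (1 : ResidueField S) = x ∧
      δ n (n + 1) (Cochain.fromSingleMk f (zero_add n)) = 0 := by
  obtain ⟨f, rfl⟩ := exists_residueModule_hom x hx
  refine ⟨f, rfl, ?_⟩
  rw [Cochain.δ_fromSingleMk _ _ (n + 1) (n + 1) (by lia), show f ≫ C.d n (n + 1) = 0 from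
    residueModule_hom_ext hd, Cochain.fromSingleMk_zero]

theorem exists_d_eq_of_residue_cochain (C : Cplx S) {m n : ℤ}
    (f : residueModule S ⟶ C.X n) (w : Cochain (residueCplx S) C m)
    (hw : δ m n w = Cochain.fromSingleMk f (zero_add n)) :
    ∃ y : C.X m, (∀ s ∈ maximalIdeal S, s • y = 0) ∧ C.d m n y = f (1 : ResidueField S) := by
  obtain ⟨g, rfl⟩ := Cochain.fromSingleMk_surjective w m (zero_add m)
  rw [Cochain.δ_fromSingleMk _ _ n n (by lia)] at hw
  have h := (Cochain.fromSingleEquiv (zero_add n)).symm.injective hw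
  refine ⟨g (1 : ResidueField S), fun s hs => ?_, ConcreteCategory.congr_hom h (1 : ResidueField S)⟩
  exact (map_smul g.hom s (1 : ResidueField S)).symm.trans
    ((congrArg g (smul_residueModule s hs _)).trans (map_zero g.hom))

theorem socleExact_of_isZero_homology {C : Cplx S} {n : ℤ}
    (h : IsZero ((homCplx (residueCplx S) C).homology n)) : SocleExact C n := by
  intro x hx hd
  obtain ⟨f, rfl, hf⟩ := exists_residue_cochain C x hx hd
  have := ModuleCat.subsingleton_of_isZero h
  obtain ⟨π, -, hπ⟩ := exists_cocycle_class (homCplx (residueCplx S) C)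
    (show n - 1 + 1 = n by lia) (rfl : n + 1 = n + 1)
  obtain ⟨w, hw⟩ := (hπ ⟨Cochain.fromSingleMk f (zero_add n), hf⟩).1 (Subsingleton.elim _ _)
  exact exists_d_eq_of_residue_cochain C f w hw

/-- If `Ext^n(κ, C)` is isomorphic to the residue field `κ` then it is generated by the class of
an element `x₀` of `C` killed by the maximal ideal. -/
theorem exists_socle_generator {C : Cplx S} {m n : ℤ} (hm : m + 1 = n)
    (e : (homCplx (residueCplx S) C).homology n ≅ residueModule S) :
    ∃ x₀ : C.X n, (∀ s ∈ maximalIdeal S, s • x₀ = 0) ∧ C.d n (n + 1) x₀ = 0 ∧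
      (∀ w : C.X m, (∀ s ∈ maximalIdeal S, s • w = 0) → C.d m n w ≠ x₀) ∧
      ∀ x : C.X n, (∀ s ∈ maximalIdeal S, s • x = 0) → C.d n (n + 1) x = 0 →
        ∃ (t : S) (w : C.X m), (∀ s ∈ maximalIdeal S, s • w = 0) ∧ x = t • x₀ + C.d m n w := by
  obtain ⟨π, hπ, hπ'⟩ := exists_cocycle_class (homCplx (residueCplx S) C) hm (rfl : n + 1 = n + 1)
  obtain ⟨e⟩ : Nonempty ((homCplx (residueCplx S) C).homology n ≃ₗ[S] residueModule S) :=
    ⟨e.toLinearEquiv⟩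
  -- the generator is the value at `1` of a cocycle whose class corresponds to `1`
  obtain ⟨⟨z₀, hz₀⟩, hz₀'⟩ := hπ (e.symm (1 : ResidueField S))
  obtain ⟨f₀, rfl⟩ := Cochain.fromSingleMk_surjective (p := 0) z₀ n (zero_add n)
  have hz₀ : δ n (n + 1) (Cochain.fromSingleMk f₀ (zero_add n)) = 0 := hz₀
  have hf₀ (s : S) (hs : s ∈ maximalIdeal S) : s • f₀ (1 : ResidueField S) = 0 :=
    (map_smul f₀.hom s (1 : ResidueField S)).symm.trans
      ((congrArg f₀ (smul_residueModule s hs _)).trans (map_zero f₀.hom))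
  have hd : C.d n (n + 1) (f₀ (1 : ResidueField S)) = 0 := by
    rw [Cochain.δ_fromSingleMk _ _ (n + 1) (n + 1) (by lia),
      ← Cochain.fromSingleMk_zero _ _ _ _ _ (zero_add (n + 1))] at hz₀
    exact ConcreteCategory.congr_hom ((Cochain.fromSingleEquiv (zero_add (n + 1))).symm.injective hz₀)
      (1 : ResidueField S)
  refine ⟨f₀ (1 : ResidueField S), hf₀, hd, fun w hw hdw => ?_, fun x hx hdx => ?_⟩
  · obtain ⟨g, rfl⟩ := exists_residueModule_hom w hw
    have h := (hπ' ⟨Cochain.fromSingleMk f₀ (zero_add n), hz₀⟩).2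
      ⟨Cochain.fromSingleMk g (zero_add m), by
        change δ m n _ = _
        rw [Cochain.δ_fromSingleMk _ _ n n (by lia), show g ≫ C.d m n = f₀ from
          residueModule_hom_ext hdw]⟩
    rw [h] at hz₀'
    have h1 := congrArg e hz₀'
    rw [map_zero, LinearEquiv.apply_symm_apply] at h1
    exact zero_ne_one (α := ResidueField S) h1
  · obtain ⟨f, rfl, hf⟩ := exists_residue_cochain C x hx hdx
    obtain ⟨t, ht⟩ := exists_smul_one_eq (e (π ⟨Cochain.fromSingleMk f (zero_add n), hf⟩))
    have h : π (⟨Cochain.fromSingleMk f (zero_add n), hf⟩ -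
        t • ⟨Cochain.fromSingleMk f₀ (zero_add n), hz₀⟩) = 0 := by
      rw [map_sub, map_smul, hz₀', sub_eq_zero]
      apply e.injective
      rw [map_smul, LinearEquiv.apply_symm_apply]
      exact ht.symm
    obtain ⟨w, hw⟩ := (hπ' _).1 h
    obtain ⟨y, hy, hy'⟩ := exists_d_eq_of_residue_cochain C (f - t • f₀) w (by
      refine Eq.trans hw ?_
      change Cochain.fromSingleMk f (zero_add n) - t • Cochain.fromSingleMk f₀ (zero_add n) = _
      rw [← fromSingleMk_smul, ← Cochain.fromSingleMk_sub])
    refine ⟨t, y, hy, ?_⟩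
    rw [hy']
    change _ = t • f₀ (1 : ResidueField S) + (f (1 : ResidueField S) - t • f₀ (1 : ResidueField S))
    rw [add_sub_cancel]

/-- A generator of `Ext^n(κ, C)` does not become a boundary among the torsion elements if
`Ext^{n-1}(κ, C)` vanishes. If it is the boundary of a torsion element `w` then the maximal ideal of
`S ⧸ mᵃ` maps to cocycles by `s ↦ s w`, and dévissage shows that this is a boundary. -/
theorem d_ne_of_mem_powTorsion [IsNoetherianRing S] {C : Cplx S} {l m n : ℤ} (hl : l + 1 = m)
    (hm : m + 1 = n) [Injective (C.X l)] (hC : SocleExact C m) {x₀ : C.X n}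
    (hx₀ : ∀ s ∈ maximalIdeal S, s • x₀ = 0)
    (hx₀' : ∀ w : C.X m, (∀ s ∈ maximalIdeal S, s • w = 0) → C.d m n w ≠ x₀) (w : C.X m)
    (hw : w ∈ powTorsion (maximalIdeal S) (C.X m)) : C.d m n w ≠ x₀ := by
  rintro rfl
  obtain rfl : l = m - 1 := by lia
  subst hm
  obtain ⟨a, ha⟩ := hw
  let A := S ⧸ maximalIdeal S ^ a
  let f : A →ₗ[S] C.X m := (maximalIdeal S ^ a).liftQ (LinearMap.toSpanSingleton S _ w) ha
  have hf (s : S) : f ((maximalIdeal S ^ a).mkQ s) = s • w := rfl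
  -- the maximal ideal of `S ⧸ m ^ a`
  let N : Submodule S A := Submodule.map (maximalIdeal S ^ a).mkQ (maximalIdeal S)
  obtain ⟨g, hg⟩ := exists_lift_of_isFiniteLength hC
    (IsFiniteLength.of_injective (f := N.subtype) (isFiniteLength_quotient_pow a)
      N.injective_subtype) (f ∘ₗ N.subtype) (by
      rintro ⟨_, s, hs, rfl⟩
      change C.d m (m + 1) (f ((maximalIdeal S ^ a).mkQ s)) = 0
      rw [hf, map_smul, hx₀ s hs])
  obtain ⟨e, he⟩ := exists_linearMap_of_ker_le (X := C.X (m - 1)) N.subtype g fun x hx => by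
    rw [show x = 0 from Subtype.ext hx, map_zero]
  -- corrected by a boundary, `w` is killed by the maximal ideal
  refine hx₀' (w - C.d (m - 1) m (e ((maximalIdeal S ^ a).mkQ 1))) (fun s hs => ?_) ?_
  · have h := hg ⟨(maximalIdeal S ^ a).mkQ s, s, hs, rfl⟩
    rw [← he] at h
    rw [smul_sub, ← map_smul, ← map_smul, ← map_smul, smul_eq_mul, mul_one, sub_eq_zero, ← hf]
    exact h.symm
  · rw [map_sub, d_sq, sub_zero]

/-- The criterion for `Ext(κ, -)` of a morphism `φ : X ⟶ E` to be an isomorphism, when `Ext(κ, X)` is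
concentrated in degree `0` and generated there by the class of `x₀`, when `E` is a module, placed in
degree `0`, and when the socle of `E` is generated by the nonzero element `φ x₀`. -/
theorem socleExact_mappingCocone {X E : Cplx S} (φ : X ⟶ E) (hX : ∀ i, i ≠ 0 → SocleExact X i)
    (x₀ : X.X 0) (hx₀ : ∀ s ∈ maximalIdeal S, s • x₀ = 0) (hd : X.d 0 1 x₀ = 0)
    (hgen : ∀ x : X.X 0, (∀ s ∈ maximalIdeal S, s • x = 0) → X.d 0 1 x = 0 →
      ∃ (t : S) (w : X.X (-1)), (∀ s ∈ maximalIdeal S, s • w = 0) ∧ x = t • x₀ + X.d (-1) 0 w)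
    (hE : ∀ n, n ≠ 0 → ∀ y : E.X n, y = 0) (hφ : φ.f 0 x₀ ≠ 0)
    (hφ' : ∀ y : E.X 0, (∀ s ∈ maximalIdeal S, s • y = 0) → ∃ t : S, y = t • φ.f 0 x₀) (i : ℤ) :
    SocleExact (mappingCocone φ) i := by
  intro z hz hdz
  obtain ⟨x, hx⟩ : ∃ x, x = (mappingCocone.fst φ).f i z := ⟨_, rfl⟩
  obtain ⟨y, hy⟩ : ∃ y, y = coconeSnd φ (show i - 1 + 1 = i by lia) z := ⟨_, rfl⟩
  have hxs (s : S) (hs : s ∈ maximalIdeal S) : s • x = 0 := by rw [hx, ← map_smul, hz s hs, map_zero]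
  have hys (s : S) (hs : s ∈ maximalIdeal S) : s • y = 0 := by
    rw [hy]
    exact (map_smul ((mappingCocone.snd φ).v i (i - 1) (by lia)).hom s z).symm.trans
      ((congrArg _ (hz s hs)).trans (map_zero _))
  have hxd : X.d i (i + 1) x = 0 := by rw [hx, hom_d, hdz, map_zero]
  have hyd : φ.f i x + E.d (i - 1) i y = 0 := by
    have := coconeSnd_d (show i - 1 + 1 = i by lia) rfl z
    rw [hdz, coconeSnd_zero, eq_comm, neg_eq_zero] at this
    rw [hx, hy, this]
  -- it suffices to lift both components
  suffices ∃ w : X.X (i - 1), (∀ s ∈ maximalIdeal S, s • w = 0) ∧ X.d (i - 1) i w = x ∧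
      φ.f (i - 1) w = -y by
    obtain ⟨w, hw, hw', hw''⟩ := this
    refine ⟨coconeMk φ (show i - 1 - 1 + 1 = i - 1 by lia) w 0, fun s hs => ?_, ?_⟩
    · refine cocone_elt_ext (show i - 1 - 1 + 1 = i - 1 by lia) ?_ ?_
      · rw [map_smul, fst_coconeMk, hw s hs, map_zero]
      · refine (map_smul ((mappingCocone.snd φ).v (i - 1) (i - 1 - 1) (by lia)).hom s _).trans ?_
        rw [coconeSnd_zero]
        exact (congrArg (s • ·) (snd_coconeMk (show i - 1 - 1 + 1 = i - 1 by lia) w 0)).trans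
          (smul_zero s)
    · refine cocone_elt_ext (show i - 1 + 1 = i by lia) ?_ ?_
      · rw [← hom_d, fst_coconeMk, hw', hx]
      · rw [coconeSnd_d (show i - 1 - 1 + 1 = i - 1 by lia), fst_coconeMk, snd_coconeMk, hw'',
          map_zero, add_zero, neg_neg, hy]
  -- an element of degree `0` can be corrected by multiples of `x₀`
  have key (y : E.X 0) (w : X.X 0) (hy : ∀ s ∈ maximalIdeal S, s • y = 0)
      (hw : ∀ s ∈ maximalIdeal S, s • w = 0) : ∃ w' : X.X 0,
        (∀ s ∈ maximalIdeal S, s • w' = 0) ∧ X.d 0 1 w' = X.d 0 1 w ∧ φ.f 0 w' = -y := by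
    obtain ⟨t, ht⟩ := hφ' (-y - φ.f 0 w) fun s hs => by
      rw [smul_sub, smul_neg, hy s hs, ← map_smul, hw s hs, map_zero, neg_zero, sub_zero]
    refine ⟨w + t • x₀, fun s hs => ?_, ?_, ?_⟩
    · rw [smul_add, hw s hs, smul_comm, hx₀ s hs, smul_zero, add_zero]
    · rw [map_add, map_smul, hd, smul_zero, add_zero]
    · rw [map_add, map_smul, ← ht, add_sub_cancel]
  by_cases h0 : i = 0
  · subst h0
    obtain ⟨t, w, hw, rfl⟩ := hgen x hxs hxd
    have ht : t ∈ maximalIdeal S := by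
      by_contra ht
      rw [mem_maximalIdeal, mem_nonunits_iff, not_not] at ht
      rw [show y = 0 from hE _ (by lia) y, map_zero, add_zero, map_add, map_smul, ← hom_d,
        show φ.f (-1) w = 0 from hE _ (by lia) _, map_zero, add_zero] at hyd
      exact hφ ((ht.smul_eq_zero).1 hyd)
    exact ⟨w, hw, by rw [hx₀ t ht, zero_add]; rfl,
      (hE _ (by lia) _).trans (hE _ (by lia) _).symm⟩
  · obtain ⟨w, hw, hw'⟩ := hX i h0 x hxs hxd
    by_cases h1 : i = 1
    · subst h1
      obtain ⟨w', h₁, h₂, h₃⟩ := key y w hys hw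
      exact ⟨w', h₁, h₂.trans hw', h₃⟩
    · exact ⟨w, hw, hw', (hE _ (by lia) _).trans (hE _ (by lia) _).symm⟩

end ResidueField

/-! ### Comparison of an injective complex with `Hom_k(S, k)` -/

section ComparisonMorphisms
variable {S : Type u} [CommRing S]

theorem quasiIso_homMap_right_iff_of_quasiIso {Y Y' L L' : Cplx S} (f : Y ⟶ Y') [QuasiIso f]
    [L.IsKInjective] [L'.IsKInjective] (g : L ⟶ L') :
    QuasiIso (homMap (𝟙 Y) g) ↔ QuasiIso (homMap (𝟙 Y') g) := by
  have h₁ := homMap_quasiIso_left_of_isKInjective f L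
  have h₂ := homMap_quasiIso_left_of_isKInjective f L'
  have h : homMap f (𝟙 L) ≫ homMap (𝟙 Y) g = homMap (𝟙 Y') g ≫ homMap f (𝟙 L') := by
    rw [← homMap_comp, ← homMap_comp]
    simp
  rw [← quasiIso_iff_comp_left (homMap f (𝟙 L)), h, quasiIso_iff_comp_right]

theorem mappingCocone_isStrictlyGE {L L' : Cplx S} (g : L ⟶ L') (a b : ℤ) [L.IsStrictlyGE a]
    [L'.IsStrictlyGE b] : (mappingCocone g).IsStrictlyGE (min a b) := by
  rw [CochainComplex.isStrictlyGE_iff]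
  intro i hi
  have h₁ := ModuleCat.subsingleton_of_isZero
    (L.isZero_of_isStrictlyGE a i (hi.trans_le (min_le_left _ _)))
  have h₂ := ModuleCat.subsingleton_of_isZero
    (L'.isZero_of_isStrictlyGE b (i - 1) (by have := min_le_right a b; lia))
  have : Subsingleton ((mappingCocone g).X i) :=
    ⟨fun x y => cocone_elt_ext (show i - 1 + 1 = i by lia) (Subsingleton.elim _ _)
      (Subsingleton.elim _ _)⟩
  exact ModuleCat.isZero_of_subsingleton _

variable (k : Type u) [Field k] [Algebra k S]

/-- Morphisms `X ⟶ Hom_k(S, k)` are `k`-linear functionals on `X⁰` that vanish on the boundaries,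
so that there is one which does not vanish on a given element that is not a boundary. -/
theorem exists_hom_dualizer {X : Cplx S} (x₀ : X.X 0) (hx₀ : ∀ w : X.X (-1), X.d (-1) 0 w ≠ x₀) :
    ∃ φ : X ⟶ dualizer k S, φ.f 0 x₀ ≠ 0 := by
  obtain ⟨f, hf, hf'⟩ := exists_linDual_ne_zero k (LinearMap.range (X.d (-1) 0).hom) x₀ (by
    rintro ⟨w, hw⟩
    exact hx₀ w hw)
  refine ⟨HomologicalComplex.mkHomToSingle (f.curry k) fun i hi => ?_, fun h => hf' ?_⟩
  · obtain rfl : i = -1 := by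
      have : i + 1 = 0 := hi
      lia
    ext y
    apply LinDual.ext
    intro (s : S)
    exact (congrArg f (map_smul (X.d (-1) 0).hom s y).symm).trans (hf _ ⟨s • y, rfl⟩)
  · rw [HomologicalComplex.mkHomToSingle_f] at h
    have h1 : f.curry k x₀ = 0 := by
      have := congrArg (singleObjXSelf (ComplexShape.up ℤ) 0
        ((linDual k S).obj (op (ModuleCat.of S S)))).hom h
      refine Eq.trans ?_ (this.trans (map_zero _))
      refine (ConcreteCategory.congr_hom (show (f.curry k ≫ (singleObjXSelf (ComplexShape.up ℤ) 0
        ((linDual k S).obj (op (ModuleCat.of S S)))).inv) ≫ (singleObjXSelf (ComplexShape.up ℤ) 0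
        ((linDual k S).obj (op (ModuleCat.of S S)))).hom = f.curry k from ?_) x₀).symm
      rw [Category.assoc, Iso.inv_hom_id, Category.comp_id]
    have h2 := DFunLike.congr_fun (F := LinDual k (ModuleCat.of S S)) h1 (1 : S)
    rw [← one_smul S x₀]
    exact h2

end ComparisonMorphisms

section Comparison
variable (k : Type u) {S : Type u} [Field k] [CommRing S] [Algebra k S] [IsLocalRing S]

open IsLocalRing

variable {k} in
theorem exists_sub_algebraMap_mem (hk : Function.Bijective (algebraMap k (ResidueField S)))
    (s : S) : ∃ c : k, s - algebraMap k S c ∈ maximalIdeal S := by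
  obtain ⟨c, hc⟩ := hk.2 (residue S s)
  refine ⟨c, ?_⟩
  rw [← residue_eq_zero_iff, map_sub, sub_eq_zero, ← hc,
    IsScalarTower.algebraMap_apply k S (ResidueField S)]
  rfl

variable {k} in
/-- The socle of `Hom_k(S, k)` is one-dimensional: its elements are determined by their value
at `1`. -/
theorem exists_smul_eq_linDual (hk : Function.Bijective (algebraMap k (ResidueField S)))
    {g g' : LinDual k (ModuleCat.of S S)} (hg : ∀ s ∈ maximalIdeal S, s • g = 0)
    (hg' : ∀ s ∈ maximalIdeal S, s • g' = 0) (h0 : g' ≠ 0) : ∃ t : S, g = t • g' := by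
  -- `s` is congruent to a scalar `c` modulo the maximal ideal
  have key (s : S) : ∃ c : k, ∀ f : LinDual k (ModuleCat.of S S), (∀ s ∈ maximalIdeal S, s • f = 0) →
        f s = c * f (1 : S) := by
    obtain ⟨c, hc⟩ := exists_sub_algebraMap_mem hk s
    refine ⟨c, fun f hf => ?_⟩
    have h : f (s - algebraMap k S c : S) = 0 := by
      have := DFunLike.congr_fun (hf _ hc) (1 : S)
      rw [LinDual.smul_apply, smul_eq_mul, mul_one] at this
      exact this
    have h' : f (algebraMap k S c : S) = c * f (1 : S) := by
      rw [← LinDual.map_algebraMap_smul, smul_eq_mul, mul_one]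
    have h'' := LinDual.map_add f (s - algebraMap k S c : S) (algebraMap k S c : S)
    rw [h, h', zero_add] at h''
    exact (congrArg f (sub_add_cancel s (algebraMap k S c)).symm).trans h''
  have h1 : g' (1 : S) ≠ 0 := fun h => h0 (LinDual.ext fun s => by
    obtain ⟨c, hc⟩ := key s
    rw [hc g' hg', h, mul_zero]
    rfl)
  refine ⟨algebraMap k S (g (1 : S) / g' (1 : S)), LinDual.ext fun s => ?_⟩
  obtain ⟨c, hc⟩ := key s
  rw [LinDual.smul_apply, LinDual.map_algebraMap_smul, hc g hg, hc g' hg']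
  field_simp

variable [IsNoetherianRing S]

variable {k} in
/-- If `I` is a bounded below complex of injectives with `Ext(κ, I) = κ`, placed in degree `0`,
then `I` and `Hom_k(S, k)` are joined by morphisms from a third complex, which induce
isomorphisms on `Hom(Y, -)` for torsion complexes `Y`. The third complex is the torsion subcomplex
of `I`; its map to `Hom_k(S, k)` is given by a functional that does not vanish on a generator of
`Ext⁰(κ, I)`. -/
theorem exists_dualizer_comparison (hk : Function.Bijective (algebraMap k (ResidueField S)))
    (I : Cplx S) (a : ℤ) [I.IsStrictlyGE a] [∀ n, Injective (I.X n)]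
    (h0 : ∀ n, n ≠ 0 → IsZero ((homCplx (residueCplx S) I).homology n))
    (e : (homCplx (residueCplx S) I).homology 0 ≅ residueModule S) :
    ∃ (X : Cplx S) (ι : X ⟶ I) (φ : X ⟶ dualizer k S), X.IsKInjective ∧
      ∀ Y : Cplx S, (∀ n y, y ∈ powTorsion (maximalIdeal S) (Y.X n)) →
        QuasiIso (homMap (𝟙 Y) ι) ∧ QuasiIso (homMap (𝟙 Y) φ) := by
  let X := torsionSub (maximalIdeal S) I
  let ι := torsionSub.ι (maximalIdeal S) I
  have hι := torsionSub.ι_injective (maximalIdeal S) I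
  have hinj (n : ℤ) : Injective (X.X n) := inferInstanceAs (Injective ((torsionSub _ I).X n))
  have : X.IsStrictlyGE a := by
    rw [CochainComplex.isStrictlyGE_iff]
    intro i hi
    have h := I.isZero_of_isStrictlyGE a i hi
    have : Mono (ι.f i) := (ModuleCat.mono_iff_injective _).2 (hι i)
    exact IsZero.of_mono (ι.f i) h
  -- elements killed by the maximal ideal are torsion
  have hlift (n : ℤ) (x : I.X n) (hx : ∀ s ∈ maximalIdeal S, s • x = 0) :
      ∃ y : X.X n, (∀ s ∈ maximalIdeal S, s • y = 0) ∧ ι.f n y = x := by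
    obtain ⟨y, rfl⟩ := (torsionSub.mem_range_iff (maximalIdeal S) I n x).2
      ⟨1, fun s hs => hx s (by rwa [pow_one] at hs)⟩
    exact ⟨y, fun s hs => hι n (by rw [map_smul, map_zero]; exact hx s hs), rfl⟩
  have hI (n : ℤ) (hn : n ≠ 0) : SocleExact I n := socleExact_of_isZero_homology (h0 n hn)
  have hX (n : ℤ) (hn : n ≠ 0) : SocleExact X n := fun x hx hdx => by
    obtain ⟨w, hw, hw'⟩ := hI n hn (ι.f n x) (fun s hs => by rw [← map_smul, hx s hs, map_zero])
      (by rw [hom_d, hdx, map_zero])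
    obtain ⟨v, hv, rfl⟩ := hlift _ w hw
    exact ⟨v, hv, hι n (by rw [← hom_d]; exact hw')⟩
  obtain ⟨i₀, hi₀, hdi₀, hi₀', hgen⟩ := exists_socle_generator (show (-1 : ℤ) + 1 = 0 by lia) e
  obtain ⟨x₀, hx₀, rfl⟩ := hlift 0 i₀ hi₀
  obtain ⟨φ, hφ⟩ := exists_hom_dualizer k x₀ fun w hw =>
    d_ne_of_mem_powTorsion (show (-2 : ℤ) + 1 = -1 by lia) (show (-1 : ℤ) + 1 = 0 by lia)
      (hI (-1) (by lia)) hi₀ hi₀' (ι.f (-1) w) (torsionSub.ι_mem _ I (-1) w) (by rw [hom_d, hw])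
  refine ⟨X, ι, φ, isKInjective_of_injective X a, fun Y hY => ⟨?_, ?_⟩⟩
  · rw [quasiIso_homMap_right_iff_acyclic_cocone]
    have := mappingCocone_isStrictlyGE ι a a
    refine homCplx_acyclic_of_socleExact (min a a) (fun i z hz hdz => ?_) hY
    -- a cocycle `(x, y)` killed by the maximal ideal is the boundary of `(-y, 0)`, as `y` is torsion
    obtain ⟨v, hv, hv'⟩ := hlift (i - 1) (coconeSnd ι (show i - 1 + 1 = i by lia) z) fun s hs =>
      (map_smul ((mappingCocone.snd ι).v i (i - 1) (by lia)).hom s z).symm.trans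
        ((congrArg _ (hz s hs)).trans (map_zero _))
    have hd := coconeSnd_d (show i - 1 + 1 = i by lia) rfl z
    rw [hdz, coconeSnd_zero, eq_comm, neg_eq_zero, ← hv', hom_d, ← map_add] at hd
    have hd' := hι i (hd.trans (map_zero _).symm)
    refine ⟨coconeMk ι (show i - 1 - 1 + 1 = i - 1 by lia) (-v) 0, fun s hs => ?_, ?_⟩
    · refine cocone_elt_ext (show i - 1 - 1 + 1 = i - 1 by lia) ?_ ?_
      · rw [map_smul, fst_coconeMk, smul_neg, hv s hs, neg_zero, map_zero]
      · refine (map_smul ((mappingCocone.snd ι).v (i - 1) (i - 1 - 1) (by lia)).hom s _).trans ?_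
        rw [coconeSnd_zero]
        exact (congrArg (s • ·) (snd_coconeMk (show i - 1 - 1 + 1 = i - 1 by lia) (-v) 0)).trans
          (smul_zero s)
    · refine cocone_elt_ext (show i - 1 + 1 = i by lia) ?_ ?_
      · rw [← hom_d, fst_coconeMk, map_neg]
        exact (eq_neg_of_add_eq_zero_left hd').symm
      · rw [coconeSnd_d (show i - 1 - 1 + 1 = i - 1 by lia), fst_coconeMk, snd_coconeMk, map_neg,
          hv', map_zero, add_zero, neg_neg]
  · rw [quasiIso_homMap_right_iff_acyclic_cocone]
    have := mappingCocone_isStrictlyGE φ a 0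
    have hφs (s : S) (hs : s ∈ maximalIdeal S) : s • φ.f 0 x₀ = 0 := by
      rw [← map_smul, hx₀ s hs, map_zero]
    refine homCplx_acyclic_of_socleExact (min a 0) (socleExact_mappingCocone φ hX x₀ hx₀
      (hι 1 (by rw [← hom_d, map_zero]; exact hdi₀)) (fun x hx hdx => ?_) (fun n hn y => ?_) hφ
      fun y hy => ?_) hY
    · obtain ⟨t, w, hw, hw'⟩ := hgen (ι.f 0 x) (fun s hs => by rw [← map_smul, hx s hs, map_zero])
        (by
          change I.d 0 1 _ = 0
          rw [hom_d, hdx, map_zero])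
      obtain ⟨v, hv, rfl⟩ := hlift _ w hw
      exact ⟨t, v, hv, hι 0 (by rw [hw', map_add, map_smul, hom_d])⟩
    · have := ModuleCat.subsingleton_of_isZero (isZero_single_obj_X (ComplexShape.up ℤ) 0
        ((linDual k S).obj (op (ModuleCat.of S S))) n hn)
      exact this.elim y 0
    · let e := (singleObjXSelf (ComplexShape.up ℤ) 0
        ((linDual k S).obj (op (ModuleCat.of S S)))).toLinearEquiv
      obtain ⟨t, ht⟩ := exists_smul_eq_linDual hk (g := e y) (g' := e (φ.f 0 x₀))
        (fun s hs => (e.map_smul s y).symm.trans ((congrArg e (hy s hs)).trans e.map_zero))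
        (fun s hs => (e.map_smul s _).symm.trans ((congrArg e (hφs s hs)).trans e.map_zero))
        (fun h => hφ ((LinearEquiv.map_eq_zero_iff e).1 h))
      exact ⟨t, e.injective (ht.trans (e.map_smul t _).symm)⟩

end Comparison

/-! ### Colimits of Hom complexes and the torsion functor -/

section HomColim
variable {S : Type u} [CommRing S]

variable (S) in
/-- The complex `S`, placed in degree `0`. -/
noncomputable abbrev unitCplx : Cplx S :=
  (CochainComplex.singleFunctor (ModuleCat.{u} S) 0).obj (ModuleCat.of S S)

instance : (unitCplx S).IsKProjective := by
  have (n : ℤ) : Projective ((unitCplx S).X n) := by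
    by_cases hn : n = 0
    · subst hn
      exact Projective.of_iso (singleObjXSelf (ComplexShape.up ℤ) 0 (ModuleCat.of S S)).symm
        inferInstance
    · exact (isZero_single_obj_X (ComplexShape.up ℤ) 0 _ n hn).projective
  exact isKProjective_of_projective _ 0

theorem toSpanSingleton_hom_ext {X : ModuleCat.{u} S} {f g : ModuleCat.of S S ⟶ X}
    (h : f (1 : S) = g (1 : S)) : f = g := by
  ext
  exact h

/-- The cochain `S → M` with a given value at `1`. -/
noncomputable def unitCochain {M : Cplx S} {n : ℤ} (x : M.X n) : Cochain (unitCplx S) M n :=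
  Cochain.fromSingleMk (ModuleCat.ofHom (X := ModuleCat.of S S) (LinearMap.toSpanSingleton S _ x))
    (zero_add n)

theorem unitCochain_eq {M : Cplx S} {n : ℤ} {x : M.X n} {f : ModuleCat.of S S ⟶ M.X n}
    (h : f (1 : S) = x) : unitCochain x = Cochain.fromSingleMk f (zero_add n) := by
  rw [unitCochain]
  congr 1
  exact toSpanSingleton_hom_ext ((one_smul S x).trans h.symm)

/-- The map `M → Hom(S, M)` that sends an element `x` to the cochain with value `x` at `1`. -/
noncomputable def toHomUnit (M : Cplx S) : M ⟶ homCplx (unitCplx S) M where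
  f n := ModuleCat.ofHom (Y := ModuleCat.of S (Cochain (unitCplx S) M n))
    { toFun := unitCochain
      map_add' := fun x y => by
        rw [unitCochain.eq_def x, unitCochain.eq_def y, ← Cochain.fromSingleMk_add]
        exact unitCochain_eq (congr_arg₂ (· + ·) (one_smul S x) (one_smul S y))
      map_smul' := fun s x => by
        rw [RingHom.id_apply, unitCochain, unitCochain, ← fromSingleMk_smul]
        exact unitCochain_eq (congrArg (s • ·) (one_smul S x)) }
  comm' i j hij := by
    obtain rfl : i + 1 = j := hij
    ext x
    change δ i (i + 1) (unitCochain x) = unitCochain (M.d i (i + 1) x)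
    rw [unitCochain, Cochain.δ_fromSingleMk _ _ (i + 1) (i + 1) (by lia)]
    exact (unitCochain_eq (congrArg (M.d i (i + 1)) (one_smul S x))).symm

theorem toHomUnit_bijective (M : Cplx S) (n : ℤ) : Function.Bijective ((toHomUnit M).f n) := by
  constructor
  · intro x y h
    have h' := (Cochain.fromSingleEquiv (K := M) (X := ModuleCat.of S S) (zero_add n)).symm.injective h
    have := ConcreteCategory.congr_hom h' (1 : S)
    exact (one_smul S x).symm.trans (this.trans (one_smul S y))
  · intro (z : Cochain (unitCplx S) M n)
    obtain ⟨f, rfl⟩ := Cochain.fromSingleMk_surjective z n (zero_add n)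
    exact ⟨f (1 : S), unitCochain_eq rfl⟩

instance isIso_toHomUnit (M : Cplx S) : IsIso (toHomUnit M) := isIso_of_bijective _ (toHomUnit_bijective M)

theorem toHomUnit_naturality {M N : Cplx S} (f : M ⟶ N) :
    f ≫ toHomUnit N = toHomUnit M ≫ homMap (𝟙 _) f := by
  ext n : 1
  ext x
  refine Eq.trans ?_ (homMap_right_apply (unitCplx S) f n (unitCochain x)).symm
  change unitCochain (f.f n x) = _
  rw [unitCochain.eq_def x, ← Cochain.fromSingleMk_postcomp]
  exact unitCochain_eq (congrArg (f.f n) (one_smul S x))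

variable (S) in
/-- The isomorphism `M = Hom(S, M)`, natural in `M`. -/
noncomputable def homUnitIso : 𝟭 (Cplx S) ≅ (homFunctor S).obj (op (unitCplx S)) :=
  NatIso.ofComponents (fun M => @asIso _ _ _ _ (toHomUnit M) (isIso_toHomUnit M)) (fun f => toHomUnit_naturality f)

/-- The functor `colim_n Hom(Fₙ, -)` of an inverse system of complexes `F`. -/
noncomputable def homColim (F : ℕᵒᵖ ⥤ Cplx S) : Cplx S ⥤ Cplx S :=
  (F.rightOp ⋙ homFunctor S).flip ⋙ seqColim S

/-- The structure maps of `colim_n Hom(Fₙ, J)`. -/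
noncomputable def homColim.ι (F : ℕᵒᵖ ⥤ Cplx S) (J : Cplx S) (n : ℕ) :
    homCplx (F.obj (op n)) J ⟶ (homColim F).obj J :=
  colimit.ι ((F.rightOp ⋙ homFunctor S).flip.obj J) n

theorem homColim.exists_rep {F : ℕᵒᵖ ⥤ Cplx S} {J : Cplx S} {i : ℤ} (x : ((homColim F).obj J).X i) :
    ∃ (n : ℕ) (z : Cochain (F.obj (op n)) J i), (homColim.ι F J n).f i z = x :=
  GrothendieckDuality.exists_rep (colimit.isColimit ((F.rightOp ⋙ homFunctor S).flip.obj J)) i x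

theorem homColim.ι_map (F : ℕᵒᵖ ⥤ Cplx S) {J J' : Cplx S} (f : J ⟶ J') (n : ℕ) :
    homColim.ι F J n ≫ (homColim F).map f = homMap (𝟙 _) f ≫ homColim.ι F J' n :=
  colimit.ι_map _ _

theorem homColim.hom_ext {F : ℕᵒᵖ ⥤ Cplx S} {J C : Cplx S} {f g : (homColim F).obj J ⟶ C}
    (h : ∀ n, homColim.ι F J n ≫ f = homColim.ι F J n ≫ g) : f = g :=
  colimit.hom_ext h

/-- Functoriality of `colim_n Hom(Fₙ, -)` in the inverse system. -/
noncomputable def homColim.precomp {F G : ℕᵒᵖ ⥤ Cplx S} (α : F ⟶ G) : homColim G ⟶ homColim F :=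
  Functor.whiskerRight ((flipFunctor _ _ _).map
    (Functor.whiskerRight (NatTrans.rightOp α) (homFunctor S))) (seqColim S)

theorem homColim.ι_precomp {F G : ℕᵒᵖ ⥤ Cplx S} (α : F ⟶ G) (J : Cplx S) (n : ℕ) :
    homColim.ι G J n ≫ (homColim.precomp α).app J =
      homMap (α.app (op n)) (𝟙 J) ≫ homColim.ι F J n :=
  colimit.ι_map _ _

/-- The components of `homColim.desc`. -/
noncomputable def homColim.descApp {F : ℕᵒᵖ ⥤ Cplx S} {Z : Cplx S}
    (β : (Functor.const _).obj Z ⟶ F) (J : Cplx S) : (homColim F).obj J ⟶ homCplx Z J :=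
  colimit.desc ((F.rightOp ⋙ homFunctor S).flip.obj J)
    { pt := homCplx Z J
      ι :=
        { app := fun n => homMap (β.app (op n)) (𝟙 J)
          naturality := fun m n f => by
            have := β.naturality f.op
            change homMap (F.map f.op) (𝟙 J) ≫ homMap (β.app (op n)) (𝟙 J) =
              homMap (β.app (op m)) (𝟙 J) ≫ 𝟙 _
            rw [← homMap_comp, ← this]
            simp } }

theorem homColim.ι_descApp {F : ℕᵒᵖ ⥤ Cplx S} {Z : Cplx S} (β : (Functor.const _).obj Z ⟶ F)
    (J : Cplx S) (n : ℕ) :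
    homColim.ι F J n ≫ homColim.descApp β J = homMap (K' := Z) (β.app (op n)) (𝟙 J) :=
  colimit.ι_desc _ _

/-- The map `colim_n Hom(Fₙ, -) → Hom(Z, -)` given by compatible maps `Z → Fₙ`. -/
noncomputable def homColim.desc {F : ℕᵒᵖ ⥤ Cplx S} {Z : Cplx S}
    (β : (Functor.const _).obj Z ⟶ F) : homColim F ⟶ (homFunctor S).obj (op Z) where
  app J := homColim.descApp β J
  naturality J J' f := by
    refine homColim.hom_ext fun n => ?_
    change homColim.ι F J n ≫ (homColim F).map f ≫ homColim.descApp β J' =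
      homColim.ι F J n ≫ homColim.descApp β J ≫ homMap (𝟙 Z) f
    rw [← Category.assoc, homColim.ι_map, Category.assoc, homColim.ι_descApp, ← Category.assoc,
      homColim.ι_descApp, ← homMap_comp, ← homMap_comp]
    simp

theorem homColim.precomp_quasiIso {F G : ℕᵒᵖ ⥤ Cplx S} (α : F ⟶ G) [∀ n, QuasiIso (α.app n)]
    (J : Cplx S) [J.IsKInjective] : QuasiIso ((homColim.precomp α).app J) :=
  seqColim_quasiIso _ fun n => homMap_quasiIso_left_of_isKInjective (α.app (op n)) J

theorem homColim.precomp_desc {F G : ℕᵒᵖ ⥤ Cplx S} (α : F ⟶ G) {Z Z' : Cplx S}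
    (β : (Functor.const _).obj Z ⟶ F) (β' : (Functor.const _).obj Z' ⟶ G) (f : Z ⟶ Z')
    (h : ∀ n, β.app n ≫ α.app n = f ≫ β'.app n) (J : Cplx S) :
    (homColim.precomp α).app J ≫ homColim.descApp β J = homColim.descApp β' J ≫ homMap f (𝟙 J) := by
  refine homColim.hom_ext fun n => ?_
  rw [← Category.assoc, homColim.ι_precomp, Category.assoc, homColim.ι_descApp, ← Category.assoc,
    homColim.ι_descApp, ← homMap_comp, ← homMap_comp, ← h]

end HomColim

section TorsionCplx
variable {S : Type u} [CommRing S] (a : Ideal S)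

/-- The inverse system of the modules `S ⧸ aⁿ`, placed in degree `0`. -/
noncomputable abbrev quotientPowersCplx : ℕᵒᵖ ⥤ Cplx S :=
  quotientPowers a ⋙ CochainComplex.singleFunctor (ModuleCat.{u} S) 0

/-- The projections `S → S ⧸ aⁿ`. -/
noncomputable def toQuotientPowers :
    (Functor.const _).obj (ModuleCat.of S S) ⟶ quotientPowers a where
  app n := ModuleCat.ofHom (Submodule.mkQ (a ^ n.unop))
  naturality _ _ _ := rfl

/-- The projections `S → S ⧸ aⁿ` on complexes. -/
noncomputable def toQuotientPowersCplx : (Functor.const _).obj (unitCplx S) ⟶ quotientPowersCplx a where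
  app n := (CochainComplex.singleFunctor (ModuleCat.{u} S) 0).map ((toQuotientPowers a).app n)
  naturality m n f := by
    have := (toQuotientPowers a).naturality f
    change 𝟙 _ ≫ _ = _ ≫ (CochainComplex.singleFunctor (ModuleCat.{u} S) 0).map _
    rw [Category.id_comp, ← Functor.map_comp, ← this]
    change _ = (CochainComplex.singleFunctor (ModuleCat.{u} S) 0).map (𝟙 _ ≫ _)
    rw [Category.id_comp]

/-- The projections `S → S ⧸ aⁿ` on resolutions. -/
noncomputable def toResQuotientPowers :
    (Functor.const _).obj ((res S).obj (unitCplx S)) ⟶ quotientPowersCplx a ⋙ res S where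
  app n := (res S).map ((toQuotientPowersCplx a).app n)
  naturality m n f := by
    have := (toQuotientPowersCplx a).naturality f
    change 𝟙 _ ≫ _ = _ ≫ (res S).map _
    rw [Category.id_comp, ← Functor.map_comp, ← this]
    change _ = (res S).map (𝟙 _ ≫ _)
    rw [Category.id_comp]

/-- The natural map `RΓ_a → RHom(S, -)`, induced by the projections `S → S ⧸ aⁿ`. -/
noncomputable def torsionToHom : torsionCplx a ⟶ (homFunctor S).obj (op ((res S).obj (unitCplx S))) :=
  homColim.desc (toResQuotientPowers a)

/-- The augmentations of the resolutions of `S ⧸ aⁿ`. -/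
noncomputable def resQuotientPowersπ : quotientPowersCplx a ⋙ res S ⟶ quotientPowersCplx a :=
  Functor.whiskerLeft (quotientPowersCplx a) (resπ S)

instance (n : ℕᵒᵖ) : QuasiIso ((resQuotientPowersπ a).app n) :=
  inferInstanceAs (QuasiIso ((resπ S).app _))

/-- The comparison of the functor `colim_n Hom(S ⧸ aⁿ, -)` with the derived torsion functor, in which
the modules `S ⧸ aⁿ` are replaced by resolutions. -/
noncomputable def homColimToTorsion : homColim (quotientPowersCplx a) ⟶ torsionCplx a :=
  homColim.precomp (resQuotientPowersπ a)

instance (J : Cplx S) [J.IsKInjective] : QuasiIso ((homColimToTorsion a).app J) :=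
  homColim.precomp_quasiIso (resQuotientPowersπ a) J

theorem homColimToTorsion_torsionToHom (J : Cplx S) :
    (homColimToTorsion a).app J ≫ (torsionToHom a).app J =
      homColim.descApp (toQuotientPowersCplx a) J ≫ homMap ((resπ S).app (unitCplx S)) (𝟙 J) :=
  homColim.precomp_desc _ _ _ _ (fun n => (resπ S).naturality ((toQuotientPowersCplx a).app n)) J

theorem quotientPowersCplx_mem_powTorsion (n : ℕᵒᵖ) (i : ℤ) (y : ((quotientPowersCplx a).obj n).X i) :
    y ∈ powTorsion a (((quotientPowersCplx a).obj n).X i) := by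
  by_cases hi : i = 0
  · subst hi
    refine ⟨n.unop, fun s hs => ?_⟩
    let e := (singleObjXSelf (ComplexShape.up ℤ) 0 ((quotientPowers a).obj n)).toLinearEquiv
    apply e.injective
    refine (e.map_smul s y).trans (Eq.trans ?_ (map_zero e).symm)
    obtain ⟨t, ht⟩ := (a ^ n.unop).mkQ_surjective (e y)
    rw [← ht]
    refine ((a ^ n.unop).mkQ.map_smul s t).symm.trans ((Submodule.Quotient.mk_eq_zero _).2 ?_)
    exact Ideal.mul_mem_right t _ hs
  · have := ModuleCat.subsingleton_of_isZero
      (isZero_single_obj_X (ComplexShape.up ℤ) 0 ((quotientPowers a).obj n) i hi)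
    rw [this.elim y 0]
    exact zero_mem _

/-- The values of the functor `colim_n Hom(S ⧸ aⁿ, -)` are torsion. -/
theorem homColim_mem_powTorsion (J : Cplx S) (i : ℤ)
    (x : ((homColim (quotientPowersCplx a)).obj J).X i) :
    x ∈ powTorsion a (((homColim (quotientPowersCplx a)).obj J).X i) := by
  obtain ⟨n, z, rfl⟩ := homColim.exists_rep x
  refine map_mem_powTorsion ((homColim.ι (quotientPowersCplx a) J n).f i).hom
    (show z ∈ powTorsion a (Cochain ((quotientPowersCplx a).obj (op n)) J i) from ⟨n, fun s hs => ?_⟩)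
  obtain ⟨f, rfl⟩ := Cochain.fromSingleMk_surjective (p := 0) z i (zero_add i)
  rw [← fromSingleMk_smul, show s • f = 0 from ?_, Cochain.fromSingleMk_zero]
  ext y
  obtain ⟨t, rfl⟩ := (a ^ n).mkQ_surjective y
  refine (map_smul f.hom s _).symm.trans (Eq.trans (congrArg f ?_) (map_zero f.hom))
  exact (Submodule.Quotient.mk_eq_zero _).2 (Ideal.mul_mem_right t _ hs)

/-- The map `colim_n Hom(S ⧸ aⁿ, J) → Hom(S, J)` is injective: its image is the torsion subcomplex. -/
theorem homColim_desc_injective (J : Cplx S) (i : ℤ) :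
    Function.Injective ((homColim.descApp (toQuotientPowersCplx a) J).f i) := by
  rw [injective_iff_map_eq_zero]
  intro x hx
  obtain ⟨n, z, rfl⟩ := homColim.exists_rep x
  obtain ⟨f, rfl⟩ := Cochain.fromSingleMk_surjective (p := 0) z i (zero_add i)
  have h := ConcreteCategory.congr_hom (congrArg (fun φ => HomologicalComplex.Hom.f φ i)
    (homColim.ι_descApp (toQuotientPowersCplx a) J n)) (Cochain.fromSingleMk f (zero_add i))
  have h' := h.symm.trans hx
  replace h' := (homMap_left_apply ((toQuotientPowersCplx a).app (op n)) J i _).symm.trans h'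
  replace h' := (Cochain.fromSingleMk_precomp _ _ _).trans h'
  have h'' := (Cochain.fromSingleEquiv (K := J) (X := ModuleCat.of S S) (zero_add i)).symm.injective
    (h'.trans (Cochain.fromSingleMk_zero _ _ _ _ _ (zero_add i)).symm)
  have hf : f = 0 := by
    ext y
    obtain ⟨t, rfl⟩ := (a ^ n).mkQ_surjective y
    exact ConcreteCategory.congr_hom h'' t
  rw [hf, Cochain.fromSingleMk_zero]
  exact map_zero ((homColim.ι (quotientPowersCplx a) J n).f i).hom

/-- The image of the map `colim_n Hom(S ⧸ aⁿ, J) → Hom(S, J)` is the torsion subcomplex. -/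
theorem homColim_desc_range (J : Cplx S) (i : ℤ) (x : (homCplx (unitCplx S) J).X i) :
    (∃ y, (homColim.descApp (toQuotientPowersCplx a) J).f i y = x) ↔
      x ∈ powTorsion a ((homCplx (unitCplx S) J).X i) := by
  constructor
  · rintro ⟨y, rfl⟩
    exact map_mem_powTorsion ((homColim.descApp (toQuotientPowersCplx a) J).f i).hom
      (homColim_mem_powTorsion a J i y)
  · rintro ⟨n, hn⟩
    obtain ⟨g, rfl⟩ := Cochain.fromSingleMk_surjective (K := J) (p := 0) x i (zero_add i)
    have hg (s : S) (hs : s ∈ a ^ n) : g s = 0 := by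
      have h := hn s hs
      replace h := (fromSingleMk_smul s g (zero_add i)).trans h
      have h' := (Cochain.fromSingleEquiv (K := J) (X := ModuleCat.of S S) (zero_add i)).symm.injective
        (h.trans (Cochain.fromSingleMk_zero _ _ _ _ _ (zero_add i)).symm)
      refine Eq.trans ?_ (ConcreteCategory.congr_hom h' (1 : S))
      refine Eq.trans (congrArg g ?_) (map_smul g.hom s (1 : S))
      exact (mul_one s).symm
    obtain ⟨f, hf⟩ : ∃ f : (quotientPowers a).obj (op n) ⟶ J.X i,
        (toQuotientPowers a).app (op n) ≫ f = g :=
      ⟨ModuleCat.ofHom ((a ^ n).liftQ g.hom hg), rfl⟩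
    refine ⟨(homColim.ι _ J n).f i (Cochain.fromSingleMk f (zero_add i)), ?_⟩
    refine (ConcreteCategory.congr_hom (congrArg (fun φ => HomologicalComplex.Hom.f φ i)
      (homColim.ι_descApp (toQuotientPowersCplx a) J n)) (Cochain.fromSingleMk f (zero_add i))).trans ?_
    refine (homMap_left_apply ((toQuotientPowersCplx a).app (op n)) J i _).trans ?_
    rw [← hf]
    exact (Cochain.fromSingleMk_precomp _ _ _).symm

theorem injective_homCplx_unitCplx (J : Cplx S) (n : ℤ) [Injective (J.X n)] :
    Injective ((homCplx (unitCplx S) J).X n) :=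
  Injective.of_iso ((HomologicalComplex.eval _ _ n).mapIso (asIso (toHomUnit J))) ‹_›

end TorsionCplx

/-! ### Homomorphisms from local cohomology to a complex with finitely generated cohomology -/

section TorsionDuality
variable {S : Type u} [CommRing S]

theorem quasiIso_homMap_left_iff_of_square {K K' L L' I : Cplx S} [I.IsKInjective] {f : K ⟶ K'}
    {g : L ⟶ L'} (e : K ⟶ L) (e' : K' ⟶ L') [QuasiIso e] [QuasiIso e'] (h : e ≫ g = f ≫ e') :
    QuasiIso (homMap f (𝟙 I)) ↔ QuasiIso (homMap g (𝟙 I)) := by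
  have h₁ := homMap_quasiIso_left_of_isKInjective e I
  have h₂ := homMap_quasiIso_left_of_isKInjective e' I
  have : homMap g (𝟙 I) ≫ homMap e (𝟙 I) = homMap e' (𝟙 I) ≫ homMap f (𝟙 I) := by
    rw [← homMap_comp, ← homMap_comp, h]
  rw [← quasiIso_iff_comp_right (homMap g (𝟙 I)) (homMap e (𝟙 I)), this, quasiIso_iff_comp_left]

theorem torsionCplx_quasiIso (a : Ideal S) {M N : Cplx S} (f : M ⟶ N) [QuasiIso f] :
    QuasiIso ((torsionCplx a).map f) :=
  seqColim_quasiIso _ fun n => homMap_quasiIso_right ((res S).obj ((quotientPowersCplx a).obj (op n))) f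

open IsLocalRing

/-- The map `Hom(RHom(S, M), I) → Hom(RΓ M, I)` is a quasi-isomorphism if `I` has finitely
generated cohomology. Replacing `M` by a resolution `J` by injectives, `RΓ M → RHom(S, M)` becomes
the inclusion of the torsion subcomplex of `Hom(S, J)`. -/
theorem homMap_torsionToHom_quasiIso (k : Type u) [Field k] [Algebra k S] [IsLocalRing S]
    [IsNoetherianRing S] [IsAdicComplete (maximalIdeal S) S] (I : Cplx S)
    [I.IsKInjective] [∀ n, Injective (I.X n)] (hI : ∀ n, Module.Finite S (I.homology n))
    (M : Cplx S) : QuasiIso (homMap ((torsionToHom (maximalIdeal S)).app M) (𝟙 I)) := by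
  have h₁ := torsionCplx_quasiIso (maximalIdeal S) (injResι k M)
  have h₂ : QuasiIso (((homFunctor S).obj (op ((res S).obj (unitCplx S)))).map (injResι k M)) :=
    homMap_quasiIso_right _ _
  refine (quasiIso_homMap_left_iff_of_square _ _
    ((torsionToHom (maximalIdeal S)).naturality (injResι k M))).2 ?_
  obtain ⟨e, he⟩ : ∃ e : homCplx (unitCplx S) (injRes k M) ⟶
      homCplx ((res S).obj (unitCplx S)) (injRes k M),
        e = homMap ((resπ S).app (unitCplx S)) (𝟙 (injRes k M)) := ⟨_, rfl⟩
  have h₃ : QuasiIso e := by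
    rw [he]
    exact homMap_quasiIso_left_of_isKInjective ((resπ S).app (unitCplx S)) _
  refine (quasiIso_homMap_left_iff_of_square
    (f := homColim.descApp (toQuotientPowersCplx (maximalIdeal S)) (injRes k M)) _ e
    ((homColimToTorsion_torsionToHom (maximalIdeal S) (injRes k M)).trans (by rw [he]))).1 ?_
  have := injective_homCplx_unitCplx (injRes k M)
  exact homMap_torsion_quasiIso I hI (maximalIdeal S) le_rfl _
    (homColim_desc_injective (maximalIdeal S) (injRes k M))
    (homColim_desc_range (maximalIdeal S) (injRes k M))

end TorsionDuality

/-! ### Isomorphisms of functors on the derived category -/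

section TorsionComparison
variable {S : Type u} [CommRing S] {a : Ideal S} {X E : Cplx S} [X.IsKInjective] [E.IsKInjective]
  {g : X ⟶ E}

/-- A morphism of K-injective complexes that induces quasi-isomorphisms on `Hom(Y, -)` for torsion
complexes `Y` does so for `RΓ_a M`, which is quasi-isomorphic to the torsion complex
`colim_n Hom(S ⧸ aⁿ, J)` for a resolution `J` of `M`. -/
theorem homMap_torsionCplx_quasiIso (k : Type u) [Field k] [Algebra k S]
    (hg : ∀ Y : Cplx S, (∀ n y, y ∈ powTorsion a (Y.X n)) → QuasiIso (homMap (𝟙 Y) g)) (M : Cplx S) :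
    QuasiIso (homMap (𝟙 ((torsionCplx a).obj M)) g) := by
  have h₁ := torsionCplx_quasiIso a (injResι k M)
  rw [quasiIso_homMap_right_iff_of_quasiIso ((torsionCplx a).map (injResι k M)),
    ← quasiIso_homMap_right_iff_of_quasiIso ((homColimToTorsion a).app (injRes k M))]
  exact hg _ (homColim_mem_powTorsion a (injRes k M))

/-- If `g` induces quasi-isomorphisms on `Hom(Y, -)` for torsion complexes `Y` then
`RΓ_a Hom(Q, g)` is a quasi-isomorphism, by the symmetry of `Hom(S ⧸ aⁿ, Hom(Q, -))`. -/
theorem torsionCplx_map_homMap_quasiIso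
    (hg : ∀ Y : Cplx S, (∀ n y, y ∈ powTorsion a (Y.X n)) → QuasiIso (homMap (𝟙 Y) g))
    (Q : Cplx S) [Q.IsKProjective] : QuasiIso ((torsionCplx a).map (homMap (𝟙 Q) g)) := by
  refine seqColim_quasiIso _ fun n => ?_
  have : QuasiIso (homMap (𝟙 ((res S).obj ((quotientPowersCplx a).obj (op n)))) g) := by
    rw [quasiIso_homMap_right_iff_of_quasiIso ((resπ S).app ((quotientPowersCplx a).obj (op n)))]
    exact hg _ (quotientPowersCplx_mem_powTorsion a (op n))
  exact homMap_homMap_quasiIso ((res S).obj ((quotientPowersCplx a).obj (op n))) Q g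

end TorsionComparison

section Derived
variable (S : Type u) [CommRing S] [HasDerivedCategory.{w} (ModuleCat.{u} S)]

variable {S} in
/-- A natural quasi-isomorphism of functors to complexes is an isomorphism of functors to the
derived category. -/
noncomputable def isoOfQuasiIso {C : Type*} [Category* C] {F G : C ⥤ Cplx S} (τ : F ⟶ G)
    (h : ∀ X, QuasiIso (τ.app X)) :
    F ⋙ (DerivedCategory.Q : Cplx S ⥤ D S) ≅ G ⋙ DerivedCategory.Q :=
  NatIso.ofComponents (fun X => @asIso _ _ _ _ (DerivedCategory.Q.map (τ.app X))
    (have := h X; inferInstance)) (fun f => by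
      change DerivedCategory.Q.map _ ≫ DerivedCategory.Q.map _ =
        DerivedCategory.Q.map _ ≫ DerivedCategory.Q.map _
      rw [← Functor.map_comp, τ.naturality, Functor.map_comp])

/-- The functor `Hom(-, L)` on complexes. -/
noncomputable abbrev homTo (L : Cplx S) : (Cplx S)ᵒᵖ ⥤ Cplx S := (homFunctor S).flip.obj L

variable {S} in
/-- The transformation `Hom(G -, L) ⟶ Hom(F -, L)` induced by `α : F ⟶ G`. -/
noncomputable def homToMap {F G : Cplx S ⥤ Cplx S} (α : F ⟶ G) (L : Cplx S) :
    G.op ⋙ homTo S L ⟶ F.op ⋙ homTo S L :=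
  Functor.whiskerRight (NatTrans.op α) (homTo S L)

variable {S} in
/-- The transformation `Hom(F -, L) ⟶ Hom(F -, L')` induced by `g : L ⟶ L'`. -/
noncomputable def homToPostcomp (F : Cplx S ⥤ Cplx S) {L L' : Cplx S} (g : L ⟶ L') :
    F.op ⋙ homTo S L ⟶ F.op ⋙ homTo S L' :=
  Functor.whiskerLeft F.op ((homFunctor S).flip.map g)

noncomputable instance lifting₂RHom : Localization.Lifting₂ DerivedCategory.Q.op DerivedCategory.Q
    (qis S).op (qis S) (preRHom S) (RHom S) :=
  inferInstanceAs (Localization.Lifting₂ _ _ _ _ _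
    (Localization.lift₂ (preRHom S) (preRHom_inverts S) DerivedCategory.Q.op DerivedCategory.Q))

/-- If `I` has finitely generated cohomology and is joined to `Hom_k(S, k)` by morphisms that are
isomorphisms as seen from torsion complexes, then `RHom(M, I)` is isomorphic to `(RΓ M)^∨`. On the
level of complexes, there are natural quasi-isomorphisms between `Hom(P, I)` for a resolution
`P → M`, `Hom(M, I)`, `Hom(RHom(S, M), I)`, `Hom(RΓ M, I)`, `Hom(RΓ M, X)`,
`Hom(RΓ M, Hom_k(S, k))`, and `(RΓ M)^∨`. -/
theorem nonempty_RHom_iso_dual_derivedTorsion (k : Type u) [Field k] [Algebra k S] [IsLocalRing S]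
    [IsNoetherianRing S] [IsAdicComplete (IsLocalRing.maximalIdeal S) S] {I X : Cplx S}
    [I.IsKInjective] [∀ n, Injective (I.X n)] (hI : ∀ n, Module.Finite S (I.homology n))
    [X.IsKInjective] (ι : X ⟶ I) (φ : X ⟶ dualizer k S)
    (h : ∀ Y : Cplx S, (∀ n y, y ∈ powTorsion (IsLocalRing.maximalIdeal S) (Y.X n)) →
        QuasiIso (homMap (𝟙 Y) ι) ∧ QuasiIso (homMap (𝟙 Y) φ)) :
    Nonempty ((RHom S).flip.obj (DerivedCategory.Q.obj I) ≅
      (derivedTorsion (IsLocalRing.maximalIdeal S)).op ⋙ dual k S) := by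
  let T := torsionCplx (IsLocalRing.maximalIdeal S)
  let V := (homFunctor S).obj (op (unitCplx S))
  let U := (homFunctor S).obj (op ((res S).obj (unitCplx S)))
  let t : T ⟶ U := torsionToHom (IsLocalRing.maximalIdeal S)
  let v : V ⟶ U := (homFunctor S).map ((resπ S).app (unitCplx S)).op
  have e₁ := isoOfQuasiIso (homToMap (resπ S) I) fun M =>
    homMap_quasiIso_left_of_isKInjective ((resπ S).app M.unop) I
  have e₂ := isoOfQuasiIso (homToMap (homUnitIso S).hom I) fun M =>
    quasiIso_homMap_of_isIso ((homUnitIso S).hom.app M.unop) I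
  have e₃ := isoOfQuasiIso (homToMap v I) fun M => by
    have : QuasiIso (homMap ((resπ S).app (unitCplx S)) (𝟙 M.unop)) :=
      @homMap_quasiIso_left _ _ (unitCplx S) _ _ _ ((resπ S).app (unitCplx S)) _ M.unop
    exact homMap_quasiIso_left_of_isKInjective (homMap ((resπ S).app (unitCplx S)) (𝟙 M.unop)) I
  have e₄ := isoOfQuasiIso (homToMap t I) fun M => homMap_torsionToHom_quasiIso k I hI M.unop
  have e₅ := isoOfQuasiIso (homToPostcomp T ι) fun M =>
    homMap_torsionCplx_quasiIso k (fun Y hY => (h Y hY).1) M.unop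
  have e₆ := isoOfQuasiIso (homToPostcomp T φ) fun M =>
    homMap_torsionCplx_quasiIso k (fun Y hY => (h Y hY).2) M.unop
  have e₇ := Functor.isoWhiskerRight (Functor.isoWhiskerLeft T.op (dualIsoHom k S))
    (DerivedCategory.Q : Cplx S ⥤ D S)
  let F₁ : (Cplx S)ᵒᵖ ⥤ D S := ((res S).op ⋙ homTo S I) ⋙ DerivedCategory.Q
  let F₂ : (Cplx S)ᵒᵖ ⥤ D S := (T.op ⋙ dualCplx k S) ⋙ DerivedCategory.Q
  have e : F₁ ≅ F₂ :=
    e₁.symm ≪≫ e₂.symm ≪≫ e₃.symm ≪≫ e₄ ≪≫ e₅.symm ≪≫ e₆ ≪≫ e₇.symm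
  have l₁ : Localization.Lifting DerivedCategory.Q.op (qis S).op F₁
      ((RHom S).flip.obj (DerivedCategory.Q.obj I)) :=
    Localization.Lifting₂.snd DerivedCategory.Q.op DerivedCategory.Q (qis S).op (qis S)
      (preRHom S) (RHom S) I
  have l₂ : Localization.Lifting DerivedCategory.Q.op (qis S).op F₂
      ((derivedTorsion (IsLocalRing.maximalIdeal S)).op ⋙ dual k S) := ⟨
    Functor.isoWhiskerRight (NatIso.op (Localization.fac (T ⋙ DerivedCategory.Q)
      (torsion_inverts _) DerivedCategory.Q)).symm (dual k S) ≪≫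
    Functor.isoWhiskerLeft T.op (Localization.fac (dualCplx k S ⋙ DerivedCategory.Q)
      (dual_inverts k S) DerivedCategory.Q.op)⟩
  exact ⟨Localization.liftNatIso DerivedCategory.Q.op (qis S).op F₁ F₂ _ _ e⟩

/-- The colimit of the dual complexes `(P ⊗ S ⧸ aⁿ)^∨`, for a resolution `P` of the argument, is the
colimit of the complexes `Hom(S ⧸ aⁿ, P^∨)`. -/
noncomputable def colimDualReductionsIso (S : Type u) [CommRing S] (k : Type u) [Field k]
    [Algebra k S] (a : Ideal S) : colimDualReductionsCplx k a ≅
      ((res S).op ⋙ dualCplx k S) ⋙ homColim (quotientPowersCplx a) :=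
  Functor.isoWhiskerRight (Functor.isoWhiskerLeft (res S).op ((flipFunctor _ _ _).mapIso
    (Functor.isoWhiskerLeft (quotientPowers a).rightOp (dualTensorIso k S)))) (seqColim S)

/-- If `I` is joined to `Hom_k(S, k)` by morphisms that are isomorphisms as seen from torsion complexes,
then `RΓ(RHom(M, I))` is isomorphic to `RΓ(M^∨)`, hence to the colimit of `(M ⊗ S ⧸ aⁿ)^∨`. -/
theorem nonempty_derivedTorsion_RHom_iso_colimDualReductions (k : Type u) [Field k] [Algebra k S] (a : Ideal S) {I X : Cplx S}
    [I.IsKInjective] [X.IsKInjective] (ι : X ⟶ I) (φ : X ⟶ dualizer k S)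
    (h : ∀ Y : Cplx S, (∀ n y, y ∈ powTorsion a (Y.X n)) →
        QuasiIso (homMap (𝟙 Y) ι) ∧ QuasiIso (homMap (𝟙 Y) φ)) :
    Nonempty ((RHom S).flip.obj (DerivedCategory.Q.obj I) ⋙ derivedTorsion a ≅
      colimDualReductions k a) := by
  let T := torsionCplx a
  have e₁ := isoOfQuasiIso (Functor.whiskerRight (homToPostcomp (res S) ι) T) fun M =>
    torsionCplx_map_homMap_quasiIso (fun Y hY => (h Y hY).1) ((res S).obj M.unop)
  have e₂ := isoOfQuasiIso (Functor.whiskerRight (homToPostcomp (res S) φ) T) fun M =>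
    torsionCplx_map_homMap_quasiIso (fun Y hY => (h Y hY).2) ((res S).obj M.unop)
  have e₃ := Functor.isoWhiskerRight (Functor.isoWhiskerRight (Functor.isoWhiskerLeft (res S).op
    (dualIsoHom k S)) T) (DerivedCategory.Q : Cplx S ⥤ D S)
  have e₄ := isoOfQuasiIso (Functor.whiskerLeft ((res S).op ⋙ dualCplx k S) (homColimToTorsion a))
    fun M => by
      have := isKInjective_dualCplx k ((res S).obj M.unop)
      exact inferInstanceAs (QuasiIso ((homColimToTorsion a).app
        ((dualCplx k S).obj (op ((res S).obj M.unop)))))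
  have e₅ := Functor.isoWhiskerRight (colimDualReductionsIso S k a)
    (DerivedCategory.Q : Cplx S ⥤ D S)
  let F₁ : (Cplx S)ᵒᵖ ⥤ D S := (((res S).op ⋙ homTo S I) ⋙ T) ⋙ DerivedCategory.Q
  let F₂ : (Cplx S)ᵒᵖ ⥤ D S := colimDualReductionsCplx k a ⋙ DerivedCategory.Q
  have e : F₁ ≅ F₂ := e₁.symm ≪≫ e₂ ≪≫ e₃.symm ≪≫ e₄.symm ≪≫ e₅.symm
  have l₁ : Localization.Lifting DerivedCategory.Q.op (qis S).op F₁
      ((RHom S).flip.obj (DerivedCategory.Q.obj I) ⋙ derivedTorsion a) := ⟨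
    Functor.isoWhiskerRight ((flipFunctor _ _ _).mapIso (Localization.Lifting₂.iso
      DerivedCategory.Q.op DerivedCategory.Q (qis S).op (qis S) (preRHom S) (RHom S)) |>.app I)
      (derivedTorsion a) ≪≫
    Functor.isoWhiskerLeft ((res S).op ⋙ homTo S I) (Localization.fac (T ⋙ DerivedCategory.Q)
      (torsion_inverts a) DerivedCategory.Q)⟩
  have l₂ : Localization.Lifting DerivedCategory.Q.op (qis S).op F₂ (colimDualReductions k a) :=
    ⟨Localization.fac _ (colimDualReductions_inverts k a) DerivedCategory.Q.op⟩
  exact ⟨Localization.liftNatIso DerivedCategory.Q.op (qis S).op F₁ F₂ _ _ e⟩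

/-- A natural quasi-isomorphism of bifunctors to complexes is an isomorphism of bifunctors to the
derived category. -/
noncomputable def isoOfQuasiIso₂ {S : Type u} [CommRing S] [HasDerivedCategory.{w} (ModuleCat.{u} S)]
    {A C : Type*} [Category* A] [Category* C] {F G : A ⥤ C ⥤ Cplx S}
    (τ : F ⟶ G) (h : ∀ X Y, QuasiIso ((τ.app X).app Y)) :
    F ⋙ (Functor.whiskeringRight _ _ _).obj (DerivedCategory.Q : Cplx S ⥤ D S) ≅
      G ⋙ (Functor.whiskeringRight _ _ _).obj DerivedCategory.Q :=
  NatIso.ofComponents (fun X => isoOfQuasiIso (τ.app X) (h X)) (fun f => by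
    ext Y
    change DerivedCategory.Q.map _ ≫ DerivedCategory.Q.map _ =
      DerivedCategory.Q.map _ ≫ DerivedCategory.Q.map _
    rw [← Functor.map_comp, ← Functor.map_comp, ← NatTrans.comp_app, τ.naturality]
    rfl)

/-- The adjunction `RHom(A, N^∨) ≅ (N ⊗ A)^∨`. Both sides are computed by `Hom(A, Q^∨) ≅ (Q ⊗ A)^∨` for
a K-projective resolution `Q → N`, as `Q^∨` is K-injective. -/
theorem nonempty_RHom_dual_iso_dual_derivedTensor (k : Type u) [Field k] [Algebra k S] :
    Nonempty ((inD S).op ⋙ RHom S ⋙ (Functor.whiskeringLeft _ _ _).obj (dual k S) ≅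
      (derivedTensor S).flip.op ⋙ Functor.opHom _ _ ⋙
          (Functor.whiskeringRight _ _ _).obj (dual k S)) := by
  let s : ModuleCat.{u} S ⥤ Cplx S := CochainComplex.singleFunctor (ModuleCat.{u} S) 0
  -- the maps `Hom(P, N^∨) → Hom(P, Q^∨)` for resolutions `P → A` and `Q → N`
  let τ₁ : s.op ⋙ (res S).op ⋙ homFunctor S ⋙ (Functor.whiskeringLeft _ _ _).obj (dualCplx k S) ⟶
      s.op ⋙ (res S).op ⋙ homFunctor S ⋙
        (Functor.whiskeringLeft _ _ _).obj ((res S).op ⋙ dualCplx k S) :=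
    Functor.whiskerLeft (s.op ⋙ (res S).op ⋙ homFunctor S) ((Functor.whiskeringLeft _ _ _).map
      (Functor.whiskerRight (NatTrans.op (resπ S)) (dualCplx k S)))
  -- the maps `Hom(A, Q^∨) → Hom(P, Q^∨)`
  let τ₂ : s.op ⋙ homFunctor S ⋙ (Functor.whiskeringLeft _ _ _).obj ((res S).op ⋙ dualCplx k S) ⟶
      s.op ⋙ (res S).op ⋙ homFunctor S ⋙
        (Functor.whiskeringLeft _ _ _).obj ((res S).op ⋙ dualCplx k S) :=
    Functor.whiskerLeft s.op (Functor.whiskerRight (NatTrans.op (resπ S))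
      (homFunctor S ⋙ (Functor.whiskeringLeft _ _ _).obj ((res S).op ⋙ dualCplx k S)))
  have e₁ := isoOfQuasiIso₂ τ₁ fun A N => by
    have := dualCplx_quasiIso k ((resπ S).app N.unop)
    exact homMap_quasiIso_right ((res S).obj (s.obj A.unop))
      ((dualCplx k S).map ((resπ S).app N.unop).op)
  have e₂ := isoOfQuasiIso₂ τ₂ fun A N => by
    have := isKInjective_dualCplx k ((res S).obj N.unop)
    exact homMap_quasiIso_left_of_isKInjective ((resπ S).app (s.obj A.unop))
      ((dualCplx k S).obj (op ((res S).obj N.unop)))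
  have e₃ := Functor.isoWhiskerRight (dualTensorIso k S)
    ((Functor.whiskeringLeft _ _ _).obj (res S).op ⋙
      (Functor.whiskeringRight _ _ _).obj (DerivedCategory.Q : Cplx S ⥤ D S))
  let G₁ : (ModuleCat.{u} S)ᵒᵖ ⥤ (Cplx S)ᵒᵖ ⥤ D S :=
    (s.op ⋙ (res S).op ⋙ homFunctor S ⋙ (Functor.whiskeringLeft _ _ _).obj (dualCplx k S)) ⋙
      (Functor.whiskeringRight _ _ _).obj (DerivedCategory.Q : Cplx S ⥤ D S)
  let G₂ : (ModuleCat.{u} S)ᵒᵖ ⥤ (Cplx S)ᵒᵖ ⥤ D S :=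
    ((tensorCplx S).op ⋙ Functor.opHom _ _ ⋙ (Functor.whiskeringRight _ _ _).obj (dualCplx k S)) ⋙
      (Functor.whiskeringLeft _ _ _).obj (res S).op ⋙
        (Functor.whiskeringRight _ _ _).obj (DerivedCategory.Q : Cplx S ⥤ D S)
  have e : G₁ ≅ G₂ := e₁ ≪≫ e₂.symm ≪≫ e₃.symm
  let W := (Functor.whiskeringLeft _ _ (D S)).obj (DerivedCategory.Q : Cplx S ⥤ D S).op
  have l₁ : ((inD S).op ⋙ RHom S ⋙ (Functor.whiskeringLeft _ _ _).obj (dual k S)) ⋙ W ≅ G₁ :=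
    Functor.isoWhiskerLeft ((inD S).op ⋙ RHom S) ((Functor.whiskeringLeft _ _ _).mapIso
      (Localization.fac (dualCplx k S ⋙ DerivedCategory.Q) (dual_inverts k S)
        DerivedCategory.Q.op)) ≪≫
    Functor.isoWhiskerRight (Functor.isoWhiskerLeft s.op (Localization.Lifting₂.iso
      DerivedCategory.Q.op DerivedCategory.Q (qis S).op (qis S) (preRHom S) (RHom S)))
      ((Functor.whiskeringLeft _ _ _).obj (dualCplx k S))
  have l₂ : ((derivedTensor S).flip.op ⋙ Functor.opHom _ _ ⋙
      (Functor.whiskeringRight _ _ _).obj (dual k S)) ⋙ W ≅ G₂ :=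
    Functor.isoWhiskerRight (NatIso.op ((flipFunctor _ _ _).mapIso (Localization.fac
      (preTensor S ⋙ (Functor.whiskeringRight _ _ _).obj DerivedCategory.Q) (tensor_inverts S)
      DerivedCategory.Q))).symm (Functor.opHom _ _ ⋙
        (Functor.whiskeringRight _ _ _).obj (dual k S)) ≪≫
    Functor.isoWhiskerLeft ((tensorCplx S).op ⋙ Functor.opHom _ _ ⋙
      (Functor.whiskeringLeft _ _ _).obj (res S).op) ((Functor.whiskeringRight _ _ _).mapIso
        (Localization.fac (dualCplx k S ⋙ DerivedCategory.Q) (dual_inverts k S)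
          DerivedCategory.Q.op))
  have : W.Full := Localization.full_whiskeringLeft DerivedCategory.Q.op (qis S).op (D S)
  have : W.Faithful := Localization.faithful_whiskeringLeft DerivedCategory.Q.op (qis S).op (D S)
  exact ⟨Functor.fullyFaithfulCancelRight W (l₁ ≪≫ e ≪≫ l₂.symm)⟩

end Derived

/-! ### Complexes representing a normalized dualizing complex -/

section Main
variable {S : Type u} [CommRing S] [HasDerivedCategory.{w} (ModuleCat.{u} S)]

/-- Complexes that are isomorphic in the derived category have the same cohomology. -/
noncomputable def homologyIsoOfDerivedIso {K L : Cplx S}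
    (e : (DerivedCategory.Q.obj K : D S) ≅ DerivedCategory.Q.obj L) (n : ℤ) :
    K.homology n ≅ L.homology n :=
  ((DerivedCategory.homologyFunctorFactors (ModuleCat.{u} S) n).app K).symm ≪≫
    (DerivedCategory.homologyFunctor (ModuleCat.{u} S) n).mapIso e ≪≫
      (DerivedCategory.homologyFunctorFactors (ModuleCat.{u} S) n).app L

theorem IsNormalizedDualizingComplex.finite_homology_of_iso [IsLocalRing S] {ω : D S}
    (hω : IsNormalizedDualizingComplex ω) {I : Cplx S} (e : ω ≅ DerivedCategory.Q.obj I) (n : ℤ) :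
    Module.Finite S (I.homology n) :=
  have := hω.finite_homology n
  Module.Finite.equiv ((DerivedCategory.homologyFunctor (ModuleCat.{u} S) n).mapIso e ≪≫
    (DerivedCategory.homologyFunctorFactors (ModuleCat.{u} S) n).app I).toLinearEquiv

/-- For a K-injective complex that represents `ω`, normalization can be expressed by the underived Hom
complex. -/
theorem IsNormalizedDualizingComplex.nonempty_iso_residueCplx [IsLocalRing S] {ω : D S}
    (hω : IsNormalizedDualizingComplex ω) {I : Cplx S} [I.IsKInjective]
    (e : ω ≅ DerivedCategory.Q.obj I) :
    Nonempty ((DerivedCategory.Q.obj (homCplx (residueCplx S) I) : D S) ≅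
      DerivedCategory.Q.obj (residueCplx S)) := by
  obtain ⟨f⟩ := hω.residueField
  have h : QuasiIso (homMap ((resπ S).app (residueCplx S)) (𝟙 I)) :=
    homMap_quasiIso_left_of_isKInjective ((resπ S).app (residueCplx S)) I
  have e₁ : (DerivedCategory.Q.obj (homCplx (residueCplx S) I) : D S) ≅
      DerivedCategory.Q.obj (homCplx ((res S).obj (residueCplx S)) I) :=
    @asIso _ _ _ _ (DerivedCategory.Q.map (homMap ((resπ S).app (residueCplx S)) (𝟙 I)))
      inferInstance
  have e₂ := ((Localization.Lifting₂.iso DerivedCategory.Q.op DerivedCategory.Q (qis S).op (qis S)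
      (preRHom S) (RHom S)).app (op (residueCplx S))).app I
  exact ⟨e₁ ≪≫ e₂.symm ≪≫ ((RHom S).obj _).mapIso e.symm ≪≫ f⟩

end Main

end GrothendieckDuality

theorem mainTheorem7 {k S : Type u} [Field k] [CommRing S] [Algebra k S]
    [IsLocalRing S] [IsNoetherianRing S] [IsAdicComplete (IsLocalRing.maximalIdeal S) S]
    (hk : Function.Bijective (algebraMap k (IsLocalRing.ResidueField S)))
    [HasDerivedCategory.{w} (ModuleCat.{u} S)]
    (ω : D S) (hω : IsNormalizedDualizingComplex ω) :
    Nonempty ((RHom S).flip.obj ω ≅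
      (derivedTorsion (IsLocalRing.maximalIdeal S)).op ⋙
        dual k S) ∧
    Nonempty ((FiniteLengthModule.incl S ⋙ inD S).op ⋙
        RHom S ⋙
          (Functor.whiskeringLeft _ _ _).obj (dual k S) ≅
      (FiniteLengthModule.incl S ⋙
        (derivedTensor S).flip).op ⋙ Functor.opHom _ _ ⋙
          (Functor.whiskeringRight _ _ _).obj (dual k S)) ∧
    Nonempty ((RHom S).flip.obj ω ⋙
        derivedTorsion (IsLocalRing.maximalIdeal S) ≅
      colimDualReductions k (IsLocalRing.maximalIdeal S)) := by
  obtain ⟨I, a, b, hIa, -, hinj, ⟨e⟩⟩ := hω.finite_injective_dimension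
  have : I.IsKInjective := CochainComplex.isKInjective_of_injective I a
  obtain ⟨f⟩ := hω.nonempty_iso_residueCplx e
  obtain ⟨X, ι, φ, hX, h⟩ := exists_dualizer_comparison hk I a
    (fun n hn => (HomologicalComplex.isZero_single_obj_homology (ComplexShape.up ℤ) 0 _ n hn).of_iso
      (homologyIsoOfDerivedIso f n))
    (homologyIsoOfDerivedIso f 0 ≪≫
      HomologicalComplex.singleObjHomologySelfIso (ComplexShape.up ℤ) 0 (residueModule S))
  obtain ⟨e₁⟩ := nonempty_RHom_iso_dual_derivedTorsion S k (hω.finite_homology_of_iso e) ι φ h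
  obtain ⟨e₂⟩ := nonempty_RHom_dual_iso_dual_derivedTensor S k
  obtain ⟨e₃⟩ := nonempty_derivedTorsion_RHom_iso_colimDualReductions S k (IsLocalRing.maximalIdeal S) ι φ h
  exact ⟨⟨(RHom S).flip.mapIso e ≪≫ e₁⟩,
    ⟨Functor.isoWhiskerLeft (FiniteLengthModule.incl S).op e₂⟩,
    ⟨Functor.isoWhiskerRight ((RHom S).flip.mapIso e) _ ≪≫ e₃⟩⟩
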